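/- Let $(W,\mathcal S)$ be a Coxeter system and let $k$ be a field of characteristic different from $2$. For a finite-dimensional representation $U$ of $W$ over $k$ let $R(U)=S(U^*)$ be the algebra of regular functions on $U$, graded with $U^*$ in degree $2$, with its induced $W$-action. For $s\in\mathcal S$ let $R(U)^s$ be the ring of $s$-invariants and $\theta_s=R(U)\otimes_{R(U)^s}R(U)$. The Soergel bimodules over $R(U)$ are the $\mathbb Z$-graded $(R(U),R(U))$-bimodules that are direct factors of finite direct sums of shifts $\theta_{s_1}\otimes_{R(U)}\cdots\otimes_{R(U)}\theta_{s_n}(d)$ with $n\ge 0$, $s_i\in\mathcal S$, $d\in\mathbb Z$ (the empty product is $R(U)$), where $M(d)_i=M_{i+d}$. Let $V$ be such a representation and $V'\subseteq V$ a subrepresentation forming a good pair, which means the following. 1. Every $s\in\mathcal S$ acts as a reflection on $V$ and on $V'$. 2. Let $\mathcal H$ be the Hecke algebra of $(W,\mathcal S)$ over $\mathbb Z[v,v^{-1}]$, with generators $T_s$, the braid relations and $T_s^2=q+(q-1)T_s$, where $q=v^{-2}$; let $(T_x)_{x\in W}$ be its standard basis and $\tau\left(\sum_x p_xT_x\right)=p_1$.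 For all $s_1,\dots,s_n\in\mathcal S$, if $\tau\big((1+T_{s_1})\cdots(1+T_{s_n})\big)=\sum_i n_iq^i$, then, with $R=R(V)$, there is an isomorphism of graded $R$-modules $$\mathrm{Hom}(\theta_{s_1}\otimes_R\cdots\otimes_R\theta_{s_n},R)\simeq\bigoplus_i R(2i)^{n_i}.$$ Assume moreover that $W$ acts faithfully on $V'$. Put $R=R(V)$, $R'=R(V')$, regard $R'$ as an $R$-algebra through the restriction of functions $R\to R'$, and put $\mathfrak X(M)=R'\otimes_R M\otimes_R R'$ for a graded $(R,R)$-bimodule $M$. For bimodules $M,N$, $\mathrm{Hom}(M,N)$ denotes the module of all bimodule homomorphisms, with the left action $(rf)(m)=r\,f(m)$ and with degree $d$ part $\{f : f(M_i)\subseteq N_{i+d}\text{ for all } i\}$. Then for all Soergel bimodules $M,N$ over $R$, the modules $\mathrm{Hom}_{R,R}(M,N)$ and $\mathrm{Hom}_{R',R'}(\mathfrak X(M),\mathfrak X(N))$ are the direct sums of their homogeneous parts, and the canonical map $$R'\otimes_R\mathrm{Hom}_{R,R}(M,N)\longrightarrow\mathrm{Hom}_{R',R'}(\mathfrak X(M),\mathfrak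 X(N)),\qquad r'\otimes f\longmapsto r'\cdot(\mathrm{id}\otimes f\otimes\mathrm{id}),$$ is an isomorphism of graded $R'$-modules. -/

import Mathlib

open scoped TensorProduct

namespace Soergel

noncomputable section

universe u v w u₁ u₂ u₃ w₁ w₂ w₃ w₄

/-! ### Bimodules with homogeneous components -/

/-- An `(A, B)`-bimodule over commutative rings together with a family of subgroups
`deg i`, its homogeneous components of degree `i`.  The right action `m ↦ m · b` is recorded as a
ring homomorphism from `B` to the left `A`-linear endomorphisms.  That the components form a
grading is the predicate `GrBimod.IsGraded` below. -/
structure GrBimod (A : Type u₁) (B : Type u₂) [CommRing A] [CommRing B] where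
  carrier : Type w₁
  [addCommGroup : AddCommGroup carrier]
  [leftModule : Module A carrier]
  right : B →+* Module.End A carrier
  deg : ℤ → AddSubgroup carrier

namespace GrBimod

attribute [instance] GrBimod.addCommGroup GrBimod.leftModule

section Basic

variable {A : Type u₁} {B : Type u₂} {C : Type u₃} [CommRing A] [CommRing B] [CommRing C]

/-- The components of `M` make it a graded bimodule over the rings `A`, `B` with components
`𝒜 i`, `ℬ i`. -/
structure IsGraded (𝒜 : ℤ → AddSubgroup A) (ℬ : ℤ → AddSubgroup B)
    (M : GrBimod.{u₁, u₂, w₁} A B) : Prop where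
  isInternal : DirectSum.IsInternal M.deg
  smul_mem : ∀ i j : ℤ, ∀ a ∈ 𝒜 i, ∀ m ∈ M.deg j, a • m ∈ M.deg (i + j)
  right_mem : ∀ i j : ℤ, ∀ b ∈ ℬ i, ∀ m ∈ M.deg j, M.right b m ∈ M.deg (i + j)

/-- All bimodule homomorphisms `M → N`, as a left `A`-module through `(a • f) m = a • f m`. -/
def Hom (M : GrBimod.{u₁, u₂, w₁} A B) (N : GrBimod.{u₁, u₂, w₂} A B) :
    Submodule A (M.carrier →ₗ[A] N.carrier) where
  carrier := {f | ∀ b m, f (M.right b m) = N.right b (f m)}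
  add_mem' := by
    intro f g hf hg b m
    simp [hf b m, hg b m]
  zero_mem' := by
    intro b m
    simp
  smul_mem' := by
    intro a f hf b m
    simp [hf b m]

/-- The bimodule homomorphisms that are homogeneous of degree `d`. -/
def homDeg (M : GrBimod.{u₁, u₂, w₁} A B) (N : GrBimod.{u₁, u₂, w₂} A B) (d : ℤ) :
    AddSubgroup (Hom M N) where
  carrier := {f | ∀ i, ∀ m ∈ M.deg i, f.1 m ∈ N.deg (i + d)}
  add_mem' := by
    intro f g hf hg i m hm
    exact (N.deg (i + d)).add_mem (hf i m hm) (hg i m hm)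
  zero_mem' := by
    intro i m _
    exact (N.deg (i + d)).zero_mem
  neg_mem' := by
    intro f hf i m hm
    exact (N.deg (i + d)).neg_mem (hf i m hm)

/-- A commutative ring `C` with components `𝒞 i`, as an `(A, B)`-bimodule along two ring
homomorphisms. -/
def ofRingHom (f : A →+* C) (g : B →+* C) (𝒞 : ℤ → AddSubgroup C) : GrBimod.{u₁, u₂, u₃} A B where
  carrier := C
  leftModule := Module.compHom C f
  right :=
    letI := Module.compHom C f
    { toFun := fun b =>
        { toFun := fun c => c * g b
          map_add' := fun x y => add_mul x y (g b)
          map_smul' := fun a x => mul_assoc (f a) x (g b) }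
      map_one' := by
        refine LinearMap.ext fun c => ?_
        change c * g 1 = c
        rw [map_one, mul_one]
      map_mul' := by
        intro b b'
        refine LinearMap.ext fun c => ?_
        change c * g (b * b') = (c * g b') * g b
        rw [map_mul, mul_assoc, mul_comm (g b)]
      map_zero' := by
        refine LinearMap.ext fun c => ?_
        change c * g 0 = 0
        rw [map_zero, mul_zero]
      map_add' := by
        intro b b'
        refine LinearMap.ext fun c => ?_
        change c * g (b + b') = c * g b + c * g b'
        rw [map_add, mul_add] }
  deg := 𝒞

/-- The shift `M(n)`, with `(M(n))_i = M_{i+n}`. -/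
def shift (M : GrBimod.{u₁, u₂, w₁} A B) (n : ℤ) : GrBimod.{u₁, u₂, w₁} A B where
  carrier := M.carrier
  right := M.right
  deg := fun i => M.deg (i + n)

/-- The direct sum of a finite family of bimodules. -/
def directSum {n : ℕ} (F : Fin n → GrBimod.{u₁, u₂, w₁} A B) : GrBimod.{u₁, u₂, w₁} A B where
  carrier := ∀ i, (F i).carrier
  right :=
    { toFun := fun b =>
        { toFun := fun x i => (F i).right b (x i)
          map_add' := by
            intro x y
            funext i
            simp
          map_smul' := by
            intro a x
            funext i
            simp }
      map_one' := by
        ext x i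
        simp
      map_mul' := by
        intro b b'
        ext x i
        simp
      map_zero' := by
        refine LinearMap.ext fun x => funext fun i => ?_
        simp
      map_add' := by
        intro b b'
        refine LinearMap.ext fun x => funext fun i => ?_
        simp }
  deg := fun d => AddSubgroup.pi Set.univ fun i => (F i).deg d

/-- The underlying group of `M`, viewed as a module through the right action only. -/
def AsRight (M : GrBimod.{u₁, u₂, w₁} A B) : Type w₁ := M.carrier

instance (M : GrBimod.{u₁, u₂, w₁} A B) : AddCommGroup M.AsRight := M.addCommGroup

instance (M : GrBimod.{u₁, u₂, w₁} A B) : Module B M.AsRight where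
  smul b m := M.right b m
  one_smul m := by
    change M.right 1 m = m
    rw [map_one]
    rfl
  mul_smul b b' m := by
    change M.right (b * b') m = M.right b (M.right b' m)
    rw [map_mul]
    rfl
  smul_zero b := map_zero (M.right b)
  smul_add b := map_add (M.right b)
  add_smul b b' m := by
    change M.right (b + b') m = M.right b m + M.right b' m
    rw [map_add]
    rfl
  zero_smul m := by
    change M.right 0 m = 0
    rw [map_zero]
    rfl

/-- The left action on `M.AsRight`; not an instance, as `A` and `B` may coincide. -/
abbrev leftOnAsRight (M : GrBimod.{u₁, u₂, w₁} A B) : Module A M.AsRight := M.leftModule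

theorem smulCommClass_asRight (M : GrBimod.{u₁, u₂, w₁} A B) :
    letI := M.leftOnAsRight
    SMulCommClass B A M.AsRight :=
  letI := M.leftOnAsRight
  ⟨fun b a m => (M.right b).map_smul a m⟩

/-- The tensor product `M ⊗_B N` of an `(A, B)`-bimodule and a `(B, C)`-bimodule; its component of
degree `d` is generated by the `m ⊗ n` with `m`, `n` homogeneous of degrees adding up to `d`. -/
def tensor (M : GrBimod.{u₁, u₂, w₁} A B) (N : GrBimod.{u₂, u₃, w₂} B C) :
    GrBimod.{u₁, u₃, max w₁ w₂} A C where
  carrier := M.AsRight ⊗[B] N.carrier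
  leftModule :=
    letI := M.leftOnAsRight
    haveI := M.smulCommClass_asRight
    TensorProduct.leftModule
  right :=
    letI := M.leftOnAsRight
    haveI := M.smulCommClass_asRight
    { toFun := fun c =>
        { toFun := TensorProduct.map (LinearMap.id : M.AsRight →ₗ[B] M.AsRight) (N.right c)
          map_add' := map_add _
          map_smul' := by
            intro a x
            induction x with
            | zero => simp
            | add x y hx hy => simp only [smul_add, map_add, hx, hy]
            | tmul m n => simp [TensorProduct.smul_tmul'] }
      map_one' := by
        refine LinearMap.ext fun x => ?_
        change TensorProduct.map LinearMap.id (N.right 1) x = x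
        rw [map_one]
        exact LinearMap.congr_fun TensorProduct.map_id x
      map_mul' := by
        intro c c'
        refine LinearMap.ext fun x => ?_
        change TensorProduct.map LinearMap.id (N.right (c * c')) x =
          TensorProduct.map LinearMap.id (N.right c) (TensorProduct.map LinearMap.id (N.right c') x)
        induction x with
        | zero => simp
        | add x y hx hy => simp only [map_add, hx, hy]
        | tmul m n => simp
      map_zero' := by
        refine LinearMap.ext fun x => ?_
        change TensorProduct.map LinearMap.id (N.right 0) x = 0
        rw [map_zero, TensorProduct.map_zero_right]
        rfl
      map_add' := by
        intro c c'
        refine LinearMap.ext fun x => ?_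
        change TensorProduct.map LinearMap.id (N.right (c + c')) x =
          TensorProduct.map LinearMap.id (N.right c) x +
            TensorProduct.map LinearMap.id (N.right c') x
        rw [map_add, TensorProduct.map_add_right]
        rfl }
  deg := fun d => AddSubgroup.closure
    {x | ∃ i j : ℤ, i + j = d ∧ ∃ m ∈ M.deg i, ∃ n ∈ N.deg j,
      x = TensorProduct.tmul B (M := M.AsRight) m n}

/-- The identity homomorphism. -/
def idHom (M : GrBimod.{u₁, u₂, w₁} A B) : Hom M M := ⟨LinearMap.id, fun _ _ => rfl⟩

/-- A bimodule homomorphism, as a linear map for the right actions. -/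
def homAsRight {M : GrBimod.{u₁, u₂, w₁} A B} {N : GrBimod.{u₁, u₂, w₂} A B} (f : Hom M N) :
    M.AsRight →ₗ[B] N.AsRight where
  toFun := f.1
  map_add' := f.1.map_add
  map_smul' := fun b m => f.2 b m

/-- The homomorphism `f ⊗ g`, `m ⊗ n ↦ f m ⊗ g n`. -/
def tensorHom {M : GrBimod.{u₁, u₂, w₁} A B} {M' : GrBimod.{u₁, u₂, w₂} A B}
    {N : GrBimod.{u₂, u₃, w₃} B C} {N' : GrBimod.{u₂, u₃, w₄} B C} (f : Hom M M') (g : Hom N N') :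
    Hom (M.tensor N) (M'.tensor N') :=
  ⟨{ toFun := TensorProduct.map (homAsRight f) g.1
     map_add' := map_add _
     map_smul' := by
      let _ := M.leftOnAsRight
      let _ := M'.leftOnAsRight
      have _ := M.smulCommClass_asRight
      have _ := M'.smulCommClass_asRight
      intro a (x : M.AsRight ⊗[B] N.carrier)
      change TensorProduct.map (homAsRight f) g.1 (a • x) =
        a • TensorProduct.map (homAsRight f) g.1 x
      induction x with
      | zero => simp
      | add x y hx hy => simp only [smul_add, map_add, hx, hy]
      | tmul m n =>
        rw [TensorProduct.smul_tmul', TensorProduct.map_tmul, TensorProduct.map_tmul,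
          TensorProduct.smul_tmul']
        congr 1
        exact f.1.map_smul a m },
   by
    intro c (x : M.AsRight ⊗[B] N.carrier)
    change TensorProduct.map (homAsRight f) g.1 (TensorProduct.map LinearMap.id (N.right c) x) =
      TensorProduct.map LinearMap.id (N'.right c) (TensorProduct.map (homAsRight f) g.1 x)
    induction x with
    | zero => simp
    | add x y hx hy => simp only [map_add, hx, hy]
    | tmul m n =>
      simp only [TensorProduct.map_tmul, LinearMap.id_coe, id_eq]
      congr 1
      exact g.2 c n⟩

end Basic

section Reduction

variable {A : Type u₁} {A' : Type u₂} [CommRing A] [CommRing A'] [Algebra A A']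

/-- The bimodule `A' ⊗_A M ⊗_A A'` over an `A`-algebra `A'` with components `𝒜' i`. -/
def reduction (𝒜' : ℤ → AddSubgroup A') (M : GrBimod.{u₁, u₁, w₁} A A) :
    GrBimod.{u₂, u₂, max u₂ w₁} A' A' :=
  ((ofRingHom (RingHom.id A') (algebraMap A A') 𝒜').tensor M).tensor
    (ofRingHom (algebraMap A A') (RingHom.id A') 𝒜')

/-- The homomorphism `id ⊗ f ⊗ id` induced by `f`. -/
def reductionHom (𝒜' : ℤ → AddSubgroup A') {M : GrBimod.{u₁, u₁, w₁} A A}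
    {N : GrBimod.{u₁, u₁, w₂} A A} (f : Hom M N) :
    Hom (M.reduction 𝒜') (N.reduction 𝒜') :=
  tensorHom (tensorHom (idHom (ofRingHom (RingHom.id A') (algebraMap A A') 𝒜')) f)
    (idHom (ofRingHom (algebraMap A A') (RingHom.id A') 𝒜'))

/-- The component of degree `d` of `A' ⊗_A Hom(M, N)`. -/
def baseChangeHomDeg (𝒜' : ℤ → AddSubgroup A') (M : GrBimod.{u₁, u₁, w₁} A A)
    (N : GrBimod.{u₁, u₁, w₂} A A) (d : ℤ) : AddSubgroup (A' ⊗[A] Hom M N) :=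
  AddSubgroup.closure
    {x | ∃ i j : ℤ, i + j = d ∧ ∃ a ∈ 𝒜' i, ∃ f ∈ homDeg M N j, x = a ⊗ₜ[A] f}

end Reduction

end GrBimod

/-! ### Regular functions on a representation -/

section RegularFunctions

variable (k : Type u) [Field k] (V : Type v) [AddCommGroup V] [Module k V]

/-- The algebra of regular functions on `V`: the symmetric algebra of the dual space. -/
abbrev Reg : Type (max u v) := SymmetricAlgebra k (Module.Dual k V)

/-- The grading of `Reg k V` with the linear forms in degree `2`; it is zero in odd and in negative
degrees. -/
def regDeg (i : ℤ) : AddSubgroup (Reg k V) :=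
  (⨆ (n : ℕ) (_ : i = 2 * n),
    LinearMap.range (SymmetricAlgebra.ι k (Module.Dual k V)) ^ n : Submodule k (Reg k V)).toAddSubgroup

/-- Restriction of regular functions to a subspace. -/
def restrictReg (V' : Submodule k V) : Reg k V →ₐ[k] Reg k V' :=
  SymmetricAlgebra.lift (SymmetricAlgebra.ι k (Module.Dual k V') ∘ₗ V'.subtype.dualMap)

instance (V' : Submodule k V) : Algebra (Reg k V) (Reg k V') := (restrictReg k V V').toAlgebra

/-- The functor `𝔛 : M ↦ R' ⊗_R M ⊗_R R'`, for `R`, `R'` the regular functions on `V`, `V'`. -/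
abbrev frakX {k : Type u} [Field k] {V : Type v} [AddCommGroup V] [Module k V]
    (V' : Submodule k V) (M : GrBimod.{max u v, max u v, w₁} (Reg k V) (Reg k V)) :
    GrBimod.{max u v, max u v, max u v w₁} (Reg k V') (Reg k V') :=
  M.reduction (regDeg k V')

end RegularFunctions

section Representation

variable {k : Type u} [Field k] {V : Type v} [AddCommGroup V] [Module k V]
  {W : Type w} [Group W] (ρ : Representation k W V)

/-- The action of `g` on regular functions, extending the contragredient action on linear forms. -/
def regAct (g : W) : Reg k V →ₐ[k] Reg k V :=
  SymmetricAlgebra.lift (SymmetricAlgebra.ι k (Module.Dual k V) ∘ₗ ρ.dual g)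

/-- The regular functions invariant under `g`. -/
def regInvariants (g : W) : Subalgebra k (Reg k V) :=
  AlgHom.equalizer (regAct ρ g) (AlgHom.id k (Reg k V))

/-- `f` is a reflection `v ↦ v - φ(v) x` with `φ(x) = 2`. -/
def IsLinearReflection (f : V →ₗ[k] V) : Prop :=
  ∃ (x : V) (φ : Module.Dual k V), φ x = 2 ∧ f = Module.preReflection x φ

variable (k V) in
/-- `R` as an `(R, R)`-bimodule. -/
def unitBimod : GrBimod.{max u v, max u v, max u v} (Reg k V) (Reg k V) :=
  GrBimod.ofRingHom (RingHom.id _) (RingHom.id _) (regDeg k V)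

/-- The bimodule `R ⊗_{R^g} R`. -/
def theta (g : W) : GrBimod.{max u v, max u v, max u v} (Reg k V) (Reg k V) :=
  (GrBimod.ofRingHom (RingHom.id _) (regInvariants ρ g).val.toRingHom (regDeg k V)).tensor
    (GrBimod.ofRingHom (regInvariants ρ g).val.toRingHom (RingHom.id _) (regDeg k V))

variable {I : Type*} {m : CoxeterMatrix I} (cs : CoxeterSystem m W)

/-- The product `θ_{s₁} ⊗_R ⋯ ⊗_R θ_{sₙ}` (which is `R` for the empty word). -/
def thetaWord : List I → GrBimod.{max u v, max u v, max u v} (Reg k V) (Reg k V)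
  | [] => unitBimod k V
  | i :: l => (theta ρ (cs.simple i)).tensor (thetaWord l)

/-- `M` is a Soergel bimodule: a graded bimodule that is, in degree zero, a direct factor of a
finite direct sum of shifted products `θ_{s₁} ⋯ θ_{sₙ}(d)`. -/
def IsSoergel (M : GrBimod.{max u v, max u v, w₁} (Reg k V) (Reg k V)) : Prop :=
  M.IsGraded (regDeg k V) (regDeg k V) ∧
  ∃ (n : ℕ) (l : Fin n → List I) (d : Fin n → ℤ),
    ∃ f ∈ GrBimod.homDeg M (GrBimod.directSum fun a => (thetaWord ρ cs (l a)).shift (d a)) 0,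
    ∃ g ∈ GrBimod.homDeg (GrBimod.directSum fun a => (thetaWord ρ cs (l a)).shift (d a)) M 0,
      g.1 ∘ₗ f.1 = LinearMap.id

end Representation

/-! ### The Hecke algebra -/

section Hecke

open scoped LaurentPolynomial
open LaurentPolynomial (T)

variable {I : Type u} (m : CoxeterMatrix I)

/-- The defining relations of the Hecke algebra over `ℤ[v, v⁻¹]`, where `T n` is `vⁿ`. -/
inductive HeckeRel : FreeAlgebra ℤ[T;T⁻¹] I → FreeAlgebra ℤ[T;T⁻¹] I → Prop
  | quadratic (i : I) : HeckeRel (FreeAlgebra.ι ℤ[T;T⁻¹] i ^ 2)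
      (algebraMap ℤ[T;T⁻¹] (FreeAlgebra ℤ[T;T⁻¹] I) (T (-2)) + (T (-2) - 1 : ℤ[T;T⁻¹]) • FreeAlgebra.ι ℤ[T;T⁻¹] i)
  | braid (i j : I) (h : m i j ≠ 0) : HeckeRel
      (((CoxeterSystem.alternatingWord i j (m i j)).map (FreeAlgebra.ι ℤ[T;T⁻¹])).prod)
      (((CoxeterSystem.alternatingWord j i (m i j)).map (FreeAlgebra.ι ℤ[T;T⁻¹])).prod)

/-- The Hecke algebra. -/
abbrev Hecke : Type u := RingQuot (HeckeRel m)

/-- The generator `T_s`. -/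
def heckeGen (i : I) : Hecke m := RingQuot.mkAlgHom ℤ[T;T⁻¹] (HeckeRel m) (FreeAlgebra.ι _ i)

variable {m} {W : Type w} [Group W] (cs : CoxeterSystem m W)

/-- The element `T_x`, computed from a reduced expression of `x` (it does not depend on which). -/
def heckeT (x : W) : Hecke m := (((cs.exists_isReduced x).choose).map (heckeGen m)).prod

/-- `τ(h) = c`: in the expansion `h = ∑ pₓ Tₓ` in the basis `(Tₓ)`, the coefficient `p₁` is `c`. -/
def IsTau (h : Hecke m) (c : ℤ[T;T⁻¹]) : Prop :=
  ∃ p : W →₀ ℤ[T;T⁻¹], h = p.sum (fun x a => a • heckeT cs x) ∧ p 1 = c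

/-- The Hom formula for `ρ`: for every word, if `τ((1 + T_{s₁}) ⋯ (1 + T_{sₙ})) = ∑ nᵢ qⁱ` with
`q = v⁻²`, then `Hom(θ_{s₁} ⋯ θ_{sₙ}, R)` is isomorphic to `⨁ᵢ R(2i)^{nᵢ}` as a graded module.
An element of the latter is a family of elements of `R`, homogeneous of degree `d` when the members
at the summands `R(2i)` lie in `R_{d+2i}`.  On `Hom(_, R)` the left and right actions of `R` agree. -/
def HomFormula {k : Type*} [Field k] {V : Type*} [AddCommGroup V] [Module k V]
    (ρ : Representation k W V) : Prop :=
  ∀ l : List I, ∃ n : ℤ →₀ ℕ,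
    IsTau cs ((l.map fun i => 1 + heckeGen m i).prod)
      (n.sum fun i c => (c : ℤ[T;T⁻¹]) * T (-2 * i)) ∧
    ∃ e : GrBimod.Hom (thetaWord ρ cs l) (unitBimod k V) ≃ₗ[Reg k V]
        ((Σ i : ℤ, Fin (n i)) →₀ Reg k V),
      ∀ (d : ℤ) (f : GrBimod.Hom (thetaWord ρ cs l) (unitBimod k V)),
        f ∈ GrBimod.homDeg (thetaWord ρ cs l) (unitBimod k V) d ↔
          ∀ p : Σ i : ℤ, Fin (n i), e f p ∈ regDeg k V (d + 2 * p.1)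

/-- `(V, V')` is a good pair: the simple reflections act as reflections on `V` and on the
subrepresentation `V'`, and `V` satisfies the Hom formula. -/
structure IsGoodPair {k : Type*} [Field k] {V : Type*} [AddCommGroup V] [Module k V]
    (ρ : Representation k W V) (V' : Subrepresentation ρ) : Prop where
  reflection : ∀ i : I, IsLinearReflection (ρ (cs.simple i))
  reflection_sub : ∀ i : I, IsLinearReflection (V'.toRepresentation (cs.simple i))
  homFormula : HomFormula cs ρ

end Hecke

end

end Soergel

namespace Soergel

/-! ### The exchange condition -/

section Coxeter

variable {B W : Type*} [Group W] {M : CoxeterMatrix B} (cs : CoxeterSystem M W)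

open CoxeterSystem

/-! Let J be the kernel of R → R', the ideal generated by the linear forms that vanish on V'. Each
simple reflection s also acts as a reflection on V', so its (-1)-eigenline lies in V' and these
forms are invariant. Invariants slide through every θ_s, hence act in the same way from both sides
on a Soergel bimodule N, and 𝔛(N) is N/JN. The claim becomes that Hom(M,N)/J Hom(M,N) → Hom(M,N/JN)
is bijective, which is `LiftsMod`. This passes to direct factors of finite sums
(`LiftsMod.of_isRetract`). The self-adjointness of θ_s is linear over the s-invariants, so it is
compatible with J and moves every letter of the target to the source (`LiftsMod.theta`). What
remains is M = θ_{s₁}⋯θ_{sₙ} and N = R.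

For such M one needs elements c_j of M and homomorphisms F_j : M → R with f = ∑ f(c_j) F_j for every
homomorphism f to R or to R' (`exists_dual_family`). To find them, consider for x in W the maps f
from M to a domain A, a quotient of R with a compatible faithful action of W, that are left linear
and x-twisted on the right. For the empty word f is determined by f(1), and faithfulness forces f =
0 unless x = 1. For a root φ of s, composing an x-twisted map on θ_s M with m ↦ 1⊗φm + φ⊗m gives an
x-twisted map on M, and composing with m ↦ 1⊗φm - φ⊗m and then applying s gives an sx-twisted one.
By induction on the word, the number and degrees of elements that detect x-twisted maps satisfy the
recursion of the coefficient of T_x in (1+T_{s₁})⋯(1+T_{sₙ}) (`wordCoeff_cons`,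
`hasDetecting_thetaWord`).

For x = 1 this matches the graded rank in the Hom formula. Evaluation at the c_j is thus an
injective homogeneous map between free graded R-modules of equal graded rank with finite-dimensional
components; it is therefore onto in each degree, and the F_j form the dual family. Since V' is
faithful, the same c_j detect homomorphisms to R', so f - ∑ f(c_j) F_j vanishes for those as well.

The condition `IsTau` only asks for some expansion in the T_x. Its uniqueness comes from the regular
representation of the Hecke algebra on the free module with basis W, which rests on the exchange
condition. -/

open Classical in
/-- The action of a simple reflection on `W × ZMod 2` that records inversions. -/
noncomputable def signStep (i : B) : Function.End (W × ZMod 2) := fun p =>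
  (cs.simple i * p.1 * cs.simple i, p.2 + if p.1 = cs.simple i then 1 else 0)

/-- Conjugation by `s_j` inverts the product `s_i s_j`. The next two lemmas use this to write the
elements `s_j (s_i s_j)^a` as conjugates of a simple reflection or of `s_j s_i s_j`. -/
theorem simple_mul_pow_comm (i j : B) (a : ℕ) :
    ((cs.simple i * cs.simple j) ^ a)⁻¹ * cs.simple j =
      cs.simple j * (cs.simple i * cs.simple j) ^ a := by
  induction a with
  | zero => simp
  | succ a ih =>
    have h : (cs.simple i * cs.simple j)⁻¹ * cs.simple j =
        cs.simple j * (cs.simple i * cs.simple j) := by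
      simp [mul_assoc]
    rw [pow_succ, mul_inv_rev, mul_assoc, ih, ← mul_assoc, h, mul_assoc, ← pow_succ', ← pow_succ]

theorem simple_mul_pow_two_mul (i j : B) (k : ℕ) :
    cs.simple j * (cs.simple i * cs.simple j) ^ (2 * k) =
      ((cs.simple i * cs.simple j) ^ k)⁻¹ * cs.simple j * (cs.simple i * cs.simple j) ^ k := by
  rw [two_mul, pow_add, ← mul_assoc, simple_mul_pow_comm]

theorem simple_mul_pow_two_mul_add_one (i j : B) (k : ℕ) :
    cs.simple j * (cs.simple i * cs.simple j) ^ (2 * k + 1) =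
      ((cs.simple i * cs.simple j) ^ k)⁻¹ * (cs.simple j * cs.simple i * cs.simple j) *
        (cs.simple i * cs.simple j) ^ k := by
  rw [show 2 * k + 1 = k + 1 + k by ring, pow_add, pow_succ, ← mul_assoc, ← mul_assoc,
    ← simple_mul_pow_comm]
  simp only [mul_assoc]

open Classical in
theorem signStep_mul_pow (i j : B) (k : ℕ) (t : W) (e : ZMod 2) :
    ((signStep cs i * signStep cs j) ^ k : Function.End (W × ZMod 2)) (t, e) =
      ((cs.simple i * cs.simple j) ^ k * t * ((cs.simple i * cs.simple j) ^ k)⁻¹,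
        e + ∑ a ∈ Finset.range (2 * k),
          if t = cs.simple j * (cs.simple i * cs.simple j) ^ a then 1 else 0) := by
  induction k with
  | zero => simp [Function.End.one_def]
  | succ k ih =>
    rw [pow_succ']
    change signStep cs i (signStep cs j (((signStep cs i * signStep cs j) ^ k :
      Function.End (W × ZMod 2)) (t, e))) = _
    rw [ih]
    set c := cs.simple i * cs.simple j with hc
    have h1 : (c ^ k * t * (c ^ k)⁻¹ = cs.simple j) ↔ t = cs.simple j * c ^ (2 * k) := by
      rw [hc, simple_mul_pow_two_mul, ← hc]
      constructor
      · intro h; rw [← h]; group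
      · rintro rfl; group
    have h2 : (cs.simple j * (c ^ k * t * (c ^ k)⁻¹) * cs.simple j = cs.simple i) ↔
        t = cs.simple j * c ^ (2 * k + 1) := by
      rw [hc, simple_mul_pow_two_mul_add_one, ← hc]
      constructor
      · intro h; rw [← h]; simp [mul_assoc]
      · rintro rfl; simp [mul_assoc]
    simp only [signStep]
    refine Prod.ext ?_ ?_
    · simp only [pow_succ' c, mul_inv_rev]
      rw [hc]
      simp [mul_assoc]
    · simp only [show 2 * (k + 1) = 2 * k + 1 + 1 by ring, Finset.sum_range_succ, h1, h2]
      simp only [add_assoc]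

/-- The sum over `2 * M i j` reflections splits into two halves. They agree because `(s_i s_j) ^ M i
j = 1`, so they cancel modulo 2. -/
theorem signStep_liftable : M.IsLiftable (signStep cs) := by
  classical
  intro i j
  funext ⟨t, e⟩
  rw [signStep_mul_pow]
  have h := cs.simple_mul_simple_pow i j
  refine Prod.ext (by simp [h, Function.End.one_def]) ?_
  have h2 : ∀ a : ZMod 2, a + a = 0 := by decide
  simp only [two_mul, Finset.sum_range_add, pow_add, h, one_mul, h2, add_zero]
  rfl

open Classical in
theorem signStep_prod (ω : List B) (t : W) (e : ZMod 2) :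
    cs.lift ⟨signStep cs, signStep_liftable cs⟩ (cs.wordProd ω) (t, e) =
      (cs.wordProd ω * t * (cs.wordProd ω)⁻¹, e + ((cs.rightInvSeq ω).count t : ZMod 2)) := by
  induction ω with
  | nil => simp [Function.End.one_def]
  | cons i ω ih =>
    rw [wordProd_cons, map_mul]
    change cs.lift ⟨signStep cs, signStep_liftable cs⟩ (cs.simple i)
      (cs.lift ⟨signStep cs, signStep_liftable cs⟩ (cs.wordProd ω) (t, e)) = _
    rw [ih, cs.lift_apply_simple, signStep, rightInvSeq]
    refine Prod.ext (by simp [mul_assoc]) ?_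
    have h : (cs.wordProd ω * t * (cs.wordProd ω)⁻¹ = cs.simple i) ↔
        ((cs.wordProd ω)⁻¹ * cs.simple i * cs.wordProd ω = t) := by
      constructor
      · intro h; rw [← h]; group
      · rintro rfl; group
    simp only [List.count_cons, h, beq_iff_eq]
    push_cast
    rw [add_assoc]

-- The operators define an action of the group itself, so the parity with which a reflection occurs
-- among the inversions of a word depends only on the product of the word.
open Classical in
theorem count_rightInvSeq_congr {ω ω' : List B} (h : cs.wordProd ω = cs.wordProd ω') (t : W) :
    ((cs.rightInvSeq ω).count t : ZMod 2) = ((cs.rightInvSeq ω').count t : ZMod 2) := by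
  have h1 := signStep_prod cs ω t 0
  rw [h, signStep_prod] at h1
  simpa using (congrArg Prod.snd h1).symm

theorem mem_rightInvSeq_of_mem {ω ω' : List B} (h : cs.wordProd ω = cs.wordProd ω')
    (hω : (cs.rightInvSeq ω).Nodup) {t : W} (ht : t ∈ cs.rightInvSeq ω) :
    t ∈ cs.rightInvSeq ω' := by
  classical
  have h1 := count_rightInvSeq_congr cs h t
  rw [List.count_eq_one_of_mem hω ht] at h1
  by_contra h2
  rw [List.count_eq_zero_of_not_mem h2] at h1
  simp at h1

/-- A reduced word of `x s_i` followed by `i` is a reduced word of `x` that has `s_i` as an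
inversion. Inversions of a reduced word occur once, so by parity `s_i` occurs for every other word
of `x`. -/
theorem mem_rightInvSeq_of_length_lt (ω : List B) (i : B)
    (h : cs.length (cs.wordProd ω * cs.simple i) < cs.length (cs.wordProd ω)) :
    cs.simple i ∈ cs.rightInvSeq ω := by
  obtain ⟨ω', hr, hω'⟩ := cs.exists_isReduced (cs.wordProd ω * cs.simple i)
  have hp : cs.wordProd (ω'.concat i) = cs.wordProd ω := by
    rw [wordProd_concat, ← hω']; simp
  have hred : cs.IsReduced (ω'.concat i) := by
    unfold CoxeterSystem.IsReduced
    rw [hp, List.length_concat, ← hr.eq, ← hω']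
    rcases cs.length_mul_simple (cs.wordProd ω) i with h1 | h1 <;> omega
  refine mem_rightInvSeq_of_mem cs hp hred.nodup_rightInvSeq ?_
  rw [rightInvSeq_concat]
  simp

/-- Pairwise distinct inversions must all occur among those of a reduced word with the same product,
which is therefore at least as long. -/
theorem isReduced_of_nodup_rightInvSeq {ω : List B} (h : (cs.rightInvSeq ω).Nodup) :
    cs.IsReduced ω := by
  obtain ⟨ω', hr, hω'⟩ := cs.exists_isReduced (cs.wordProd ω)
  have h1 : (cs.rightInvSeq ω).length ≤ (cs.rightInvSeq ω').length :=
    (List.subperm_of_subset h fun t ht => mem_rightInvSeq_of_mem cs hω' h ht).length_le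
  rw [length_rightInvSeq, length_rightInvSeq] at h1
  refine le_antisymm (cs.length_wordProd_le ω) ?_
  rw [hω', hr.eq]
  exact h1

/-- If `ℓ(sxt) = ℓ(x)` and `ℓ(sx) = ℓ(xt) > ℓ(x)`, then `sx = xt`. -/
theorem simple_mul_eq_mul_simple (x : W) (i j : B)
    (h1 : cs.length x < cs.length (cs.simple i * x))
    (h2 : cs.length x < cs.length (x * cs.simple j))
    (h3 : cs.length (cs.simple i * x * cs.simple j) < cs.length (cs.simple i * x)) :
    cs.simple i * x = x * cs.simple j := by
  obtain ⟨ω, hr, rfl⟩ := cs.exists_isReduced x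
  rw [← wordProd_cons] at h3
  have h4 := mem_rightInvSeq_of_length_lt cs (i :: ω) j h3
  rw [rightInvSeq, List.mem_cons] at h4
  rcases h4 with h4 | h4
  · rw [h4]; group
  · exact absurd (cs.isRightInversion_of_mem_rightInvSeq hr h4).2 (by omega)

theorem rightInvSeq_alternatingWord_succ (i j : B) (p : ℕ) :
    cs.rightInvSeq (alternatingWord i j (p + 1)) =
      cs.simple j * (cs.simple i * cs.simple j) ^ p ::
        cs.rightInvSeq (alternatingWord i j p) := by
  rw [alternatingWord_succ', rightInvSeq]
  congr 1
  rw [prod_alternatingWord_eq_mul_pow]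
  rcases Nat.even_or_odd' p with ⟨k, rfl | rfl⟩
  · have h1 : 2 * k / 2 = k := by omega
    simp only [even_two, Even.mul_right, ↓reduceIte, one_mul, h1, simple_mul_pow_two_mul]
  · have h1 : (2 * k + 1) / 2 = k := by omega
    have h2 : ¬ Even (2 * k + 1) := by simp
    simp only [h2, ↓reduceIte, h1, mul_inv_rev, inv_simple, simple_mul_pow_two_mul_add_one]
    simp only [mul_assoc]

theorem mem_rightInvSeq_alternatingWord (i j : B) (p : ℕ) (t : W)
    (ht : t ∈ cs.rightInvSeq (alternatingWord i j p)) :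
    ∃ a < p, t = cs.simple j * (cs.simple i * cs.simple j) ^ a := by
  induction p with
  | zero => simp [alternatingWord] at ht
  | succ p ih =>
    rw [rightInvSeq_alternatingWord_succ, List.mem_cons] at ht
    rcases ht with rfl | ht
    · exact ⟨p, p.lt_succ_self, rfl⟩
    · obtain ⟨a, ha, h⟩ := ih ht
      exact ⟨a, by omega, h⟩

/-- The inversions are the `s_j (s_i s_j)^a` with `a < p`, distinct up to the order of `s_i s_j`.
Infinite order is recorded as `0`, and then only the empty word is allowed. -/
theorem nodup_rightInvSeq_alternatingWord (i j : B) (p : ℕ)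
    (hp : p ≤ orderOf (cs.simple i * cs.simple j)) :
    (cs.rightInvSeq (alternatingWord i j p)).Nodup := by
  induction p with
  | zero => simp [alternatingWord]
  | succ p ih =>
    have h0 := ih (by omega)
    rw [rightInvSeq_alternatingWord_succ, List.nodup_cons]
    refine ⟨fun h => ?_, h0⟩
    obtain ⟨a, ha, h2⟩ := mem_rightInvSeq_alternatingWord cs i j p _ h
    have h3 := pow_injOn_Iio_orderOf (x := cs.simple i * cs.simple j)
      (show p ∈ Set.Iio _ from hp) (show a ∈ Set.Iio _ from by simp; omega) (mul_left_cancel h2)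
    omega

theorem wordProd_alternatingWord_orderOf (i j : B) :
    cs.wordProd (alternatingWord i j (orderOf (cs.simple i * cs.simple j))) =
      cs.wordProd (alternatingWord j i (orderOf (cs.simple i * cs.simple j))) := by
  have hd : cs.simple j * cs.simple i = (cs.simple i * cs.simple j)⁻¹ := by simp
  have h := pow_orderOf_eq_one (cs.simple i * cs.simple j)
  generalize orderOf (cs.simple i * cs.simple j) = p at h
  rw [prod_alternatingWord_eq_mul_pow, prod_alternatingWord_eq_mul_pow, hd]
  set c := cs.simple i * cs.simple j with hc
  rcases Nat.even_or_odd' p with ⟨k, rfl | rfl⟩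
  · have h1 : 2 * k / 2 = k := by omega
    simp only [even_two, Even.mul_right, ↓reduceIte, one_mul, h1]
    rw [two_mul, pow_add] at h
    rw [inv_pow, eq_inv_iff_mul_eq_one, h]
  · have h1 : (2 * k + 1) / 2 = k := by omega
    have h2 : ¬ Even (2 * k + 1) := by simp
    simp only [h2, ↓reduceIte, h1]
    rw [inv_pow, eq_mul_inv_iff_mul_eq, mul_assoc, ← pow_add, ← mul_right_inj (cs.simple i),
      ← mul_assoc, ← hc, ← pow_succ', ← two_mul, h]
    simp

end Coxeter

/-! ### The regular representation of the Hecke algebra -/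

section Regular

variable {B W : Type*} [Group W] {M : CoxeterMatrix B} (cs : CoxeterSystem M W)
  {L : Type*} [CommRing L] (q : L)

open CoxeterSystem Finsupp

open Classical in
/-- Left multiplication by `T_s` on the free module with basis `W`. -/
noncomputable def leftOp (i : B) : Module.End L (W →₀ L) :=
  Finsupp.linearCombination L fun x =>
    if cs.length x < cs.length (cs.simple i * x) then single (cs.simple i * x) 1
    else q • single (cs.simple i * x) 1 + (q - 1) • single x 1

open Classical in
/-- Right multiplication by `T_s` on the free module with basis `W`. -/
noncomputable def rightOp (i : B) : Module.End L (W →₀ L) :=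
  Finsupp.linearCombination L fun x =>
    if cs.length x < cs.length (x * cs.simple i) then single (x * cs.simple i) 1
    else q • single (x * cs.simple i) 1 + (q - 1) • single x 1

variable {cs}

theorem leftOp_up {i : B} {x : W} (h : cs.length x < cs.length (cs.simple i * x)) :
    leftOp cs q i (single x 1) = single (cs.simple i * x) 1 := by
  simp [leftOp, h]

theorem leftOp_down {i : B} {x : W} (h : cs.length (cs.simple i * x) < cs.length x) :
    leftOp cs q i (single x 1) = q • single (cs.simple i * x) 1 + (q - 1) • single x 1 := by
  simp only [leftOp, linearCombination_single, one_smul, if_neg h.not_gt]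

theorem rightOp_up {i : B} {x : W} (h : cs.length x < cs.length (x * cs.simple i)) :
    rightOp cs q i (single x 1) = single (x * cs.simple i) 1 := by
  simp [rightOp, h]

theorem rightOp_down {i : B} {x : W} (h : cs.length (x * cs.simple i) < cs.length x) :
    rightOp cs q i (single x 1) = q • single (x * cs.simple i) 1 + (q - 1) • single x 1 := by
  simp only [rightOp, linearCombination_single, one_smul, if_neg h.not_gt]

variable (cs)

/-- The lengths of `x`, `s_i x`, `x s_j` and `s_i x s_j` decide which rules apply. The two orders
agree formally except when multiplication on one side changes the direction on the other side, and
then the exchange condition gives `s_i x = x s_j`. -/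
theorem leftOp_rightOp_single (i j : B) (x : W) :
    leftOp cs q i (rightOp cs q j (single x 1)) = rightOp cs q j (leftOp cs q i (single x 1)) := by
  have hi := cs.length_simple_mul x i
  have hj := cs.length_mul_simple x j
  have hij := cs.length_simple_mul (x * cs.simple j) i
  have hji := cs.length_mul_simple (cs.simple i * x) j
  have hassoc : cs.simple i * (x * cs.simple j) = cs.simple i * x * cs.simple j := by
    rw [mul_assoc]
  rw [hassoc] at hij
  have ii : cs.simple i * (cs.simple i * x) = x := by simp
  have jj : x * cs.simple j * cs.simple j = x := by simp
  rcases hi with hi | hi <;> rcases hj with hj | hj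
  · rw [leftOp_up q (by omega), rightOp_up q (by omega)]
    rcases hij with hij | hij
    · rw [leftOp_up q (by rw [hassoc]; omega), rightOp_up q (by omega), hassoc]
    · rw [leftOp_down q (by rw [hassoc]; omega), rightOp_down q (by omega), hassoc,
        simple_mul_eq_mul_simple cs x i j (by omega) (by omega) (by omega)]
  · rw [leftOp_up q (by omega), rightOp_down q (by omega), rightOp_down q (by omega), map_add,
      map_smul, map_smul, leftOp_up q (x := x) (by omega),
      leftOp_up q (x := x * cs.simple j) (by rw [hassoc]; omega), hassoc]
  · rw [rightOp_up q (by omega), leftOp_down q (x := x) (by omega),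
      leftOp_down q (x := x * cs.simple j) (by rw [hassoc]; omega), map_add, map_smul, map_smul,
      rightOp_up q (x := x) (by omega), rightOp_up q (x := cs.simple i * x) (by omega), hassoc]
  · rw [rightOp_down q (by omega), leftOp_down q (by omega)]
    simp only [map_add, map_smul]
    rw [rightOp_down q (x := x) (by omega), leftOp_down q (x := x) (by omega)]
    rcases hij with hij | hij
    · have h : cs.simple i * (cs.simple i * x) = cs.simple i * x * cs.simple j :=
        simple_mul_eq_mul_simple cs (cs.simple i * x) i j (by rw [ii]; omega) (by omega)
          (by rw [ii]; omega)
      rw [ii] at h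
      have h' : cs.simple i * x = x * cs.simple j := by
        conv_rhs => rw [h]
        simp
      rw [leftOp_up q (by rw [hassoc]; omega), rightOp_up q (by omega), hassoc, h']
    · rw [leftOp_down q (by rw [hassoc]; omega), rightOp_down q (by omega), hassoc]
      simp only [smul_add]
      simp only [← mul_smul, mul_comm]
      abel

theorem commute_leftOp_rightOp (i j : B) : Commute (leftOp cs q i) (rightOp cs q j) := by
  refine Finsupp.lhom_ext' fun x => LinearMap.ext_ring ?_
  exact leftOp_rightOp_single cs q i j x

/-- An operator that commutes with the right operators is determined by its value at `1`. -/
theorem eq_of_commute_rightOp {f g : Module.End L (W →₀ L)}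
    (hf : ∀ j, Commute f (rightOp cs q j)) (hg : ∀ j, Commute g (rightOp cs q j))
    (h : f (single 1 1) = g (single 1 1)) : f = g := by
  refine Finsupp.lhom_ext' fun x => LinearMap.ext_ring ?_
  change f (single x 1) = g (single x 1)
  induction hn : cs.length x generalizing x with
  | zero => rw [cs.length_eq_zero_iff.1 hn, h]
  | succ n ih =>
    have hx : x ≠ 1 := by rintro rfl; simp at hn
    obtain ⟨j, hj⟩ := cs.exists_rightDescent_of_ne_one hx
    rw [isRightDescent_iff] at hj
    have h1 : single x (1 : L) = rightOp cs q j (single (x * cs.simple j) 1) := by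
      rw [rightOp_up q (by simp; omega)]; simp
    have h2 := ih (x * cs.simple j) (by omega)
    rw [h1, ← Module.End.mul_apply, ← Module.End.mul_apply, hf j, hg j, Module.End.mul_apply,
      Module.End.mul_apply, h2]

theorem prod_leftOp_single_one {ω : List B} (h : cs.IsReduced ω) :
    (ω.map (leftOp cs q)).prod (single 1 1) = single (cs.wordProd ω) 1 := by
  induction ω with
  | nil => simp
  | cons i ω ih =>
    have h1 : cs.IsReduced ω := by simpa using h.drop 1
    have h2 := h.eq
    rw [wordProd_cons, List.length_cons, ← h1.eq] at h2
    rw [List.map_cons, List.prod_cons, Module.End.mul_apply, ih h1, leftOp_up q (by omega),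
      wordProd_cons]

theorem commute_prod_leftOp (ω : List B) (j : B) :
    Commute (ω.map (leftOp cs q)).prod (rightOp cs q j) := by
  refine Commute.list_prod_left _ _ fun f hf => ?_
  obtain ⟨i, -, rfl⟩ := List.mem_map.1 hf
  exact commute_leftOp_rightOp cs q i j

/-- A braid relation of length `p` implies the one of length `p * k`, both sides being a `k`-th
power. This makes it enough to know that the order of `s_i s_j` divides `M i j`. -/
theorem prod_map_alternatingWord_mul {G : Type*} [Monoid G] (f : B → G) (i j : B) (p : ℕ)
    (h : ((alternatingWord i j p).map f).prod = ((alternatingWord j i p).map f).prod) (k : ℕ) :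
    ((alternatingWord i j (p * k)).map f).prod = ((alternatingWord i j p).map f).prod ^ k ∧
    ((alternatingWord j i (p * k)).map f).prod = ((alternatingWord i j p).map f).prod ^ k := by
  have h1 : ∀ (i j : B) (a b : ℕ), alternatingWord i j (a + b) =
      (if Even b then alternatingWord i j a else alternatingWord j i a) ++
        alternatingWord i j b := by
    intro i j a b
    induction b generalizing i j with
    | zero => simp [alternatingWord]
    | succ b ih =>
      rw [← add_assoc, alternatingWord_succ, ih, alternatingWord_succ]
      by_cases hb : Even b
      · simp [hb, Nat.even_add_one]
      · simp [hb, Nat.even_add_one]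
  induction k with
  | zero => simp [alternatingWord]
  | succ k ih =>
    rw [Nat.mul_succ, add_comm (p * k), h1 i j, h1 j i]
    split_ifs
    · simp [ih.1, ih.2, ← h, ← pow_succ']
    · simp [ih.1, ih.2, ← h, ← pow_succ']

/-- At length equal to the order of `s_i s_j`, both alternating words are reduced with the same
product. The two operators thus agree on the basis vector at `1`, and since they commute with all
right operators they are equal. -/
theorem leftOp_braid (i j : B) :
    ((alternatingWord i j (M i j)).map (leftOp cs q)).prod =
      ((alternatingWord j i (M i j)).map (leftOp cs q)).prod := by
  obtain ⟨k, hk⟩ := orderOf_dvd_of_pow_eq_one (cs.simple_mul_simple_pow i j)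
  have h1 : orderOf (cs.simple i * cs.simple j) = orderOf (cs.simple j * cs.simple i) := by
    rw [← orderOf_inv]; simp
  have h2 := prod_map_alternatingWord_mul (leftOp cs q) i j
    (orderOf (cs.simple i * cs.simple j)) (by
      refine eq_of_commute_rightOp cs q (commute_prod_leftOp cs q _) (commute_prod_leftOp cs q _) ?_
      rw [prod_leftOp_single_one cs q (isReduced_of_nodup_rightInvSeq cs
          (nodup_rightInvSeq_alternatingWord cs i j _ le_rfl)),
        prod_leftOp_single_one cs q (isReduced_of_nodup_rightInvSeq cs
          (nodup_rightInvSeq_alternatingWord cs j i _ h1.le)),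
        wordProd_alternatingWord_orderOf]) k
  rw [hk, h2.1, h2.2]

theorem leftOp_sq (i : B) :
    leftOp cs q i ^ 2 = algebraMap L _ q + (q - 1) • leftOp cs q i := by
  refine Finsupp.lhom_ext' fun x => LinearMap.ext_ring ?_
  change (leftOp cs q i ^ 2) (single x 1) = q • single x 1 + (q - 1) • leftOp cs q i (single x 1)
  rw [sq, Module.End.mul_apply]
  have ii : cs.simple i * (cs.simple i * x) = x := by simp
  rcases cs.length_simple_mul x i with h | h
  · rw [leftOp_up q (by omega), leftOp_down q (by rw [ii]; omega), ii]
  · rw [leftOp_down q (by omega), map_add, map_smul, map_smul, leftOp_up q (by rw [ii]; omega),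
      leftOp_down q (by omega), ii]

end Regular

/-! ### The Hecke algebra acting on the free module with basis W, and the coefficients of word
products -/

section HeckeModule

open scoped LaurentPolynomial
open LaurentPolynomial (T)
open CoxeterSystem Finsupp

variable {B W : Type*} [Group W] {M : CoxeterMatrix B} (cs : CoxeterSystem M W)

/-- The action of the Hecke algebra on the free module with basis `W`. -/
noncomputable def heckeRep : Hecke M →ₐ[ℤ[T;T⁻¹]] Module.End ℤ[T;T⁻¹] (W →₀ ℤ[T;T⁻¹]) :=
  RingQuot.liftAlgHom ℤ[T;T⁻¹] ⟨FreeAlgebra.lift ℤ[T;T⁻¹] (leftOp cs (T (-2))), by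
    intro a b hab
    induction hab with
    | quadratic i => simpa using leftOp_sq cs (T (-2) : ℤ[T;T⁻¹]) i
    | braid i j =>
      have := leftOp_braid cs (T (-2) : ℤ[T;T⁻¹]) i j
      simpa [map_list_prod, Function.comp_def] using this⟩

@[simp]
theorem heckeRep_gen (i : B) : heckeRep cs (heckeGen M i) = leftOp cs (T (-2)) i := by
  simp [heckeRep, heckeGen]

/-- The word chosen in `heckeT` is reduced, so every step goes up. Applying an expansion in the
`T_x` to the basis vector at `1` therefore returns its coefficients, which makes them unique. -/
theorem heckeRep_heckeT (x : W) :
    heckeRep cs (heckeT cs x) (single 1 1) = single x 1 := by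
  have h := (cs.exists_isReduced x).choose_spec
  rw [heckeT, map_list_prod, List.map_map]
  simp only [Function.comp_def, heckeRep_gen]
  rw [prod_leftOp_single_one cs _ h.1, ← h.2]

/-- `IsTau` computes the coefficient at `1` in the regular representation. -/
theorem IsTau.eq {h : Hecke M} {c : ℤ[T;T⁻¹]} (hc : IsTau cs h c) :
    c = heckeRep cs h (single 1 1) 1 := by
  classical
  obtain ⟨p, rfl, rfl⟩ := hc
  have h1 : heckeRep cs (p.sum fun x a => a • heckeT cs x) (single 1 1) = p := by
    simp only [Finsupp.sum, map_sum, map_smul, LinearMap.sum_apply, LinearMap.smul_apply,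
      heckeRep_heckeT, smul_single, smul_eq_mul, mul_one]
    exact p.sum_single
  rw [h1]

/-- The coefficient of `T_x` in `(1 + T_{s₁}) ⋯ (1 + T_{sₙ})`. -/
noncomputable def wordCoeff (l : List B) (x : W) : ℤ[T;T⁻¹] :=
  heckeRep cs ((l.map fun i => 1 + heckeGen M i).prod) (single 1 1) x

theorem wordCoeff_nil_one : wordCoeff cs [] 1 = 1 := by
  simp [wordCoeff]

theorem wordCoeff_nil_ne {x : W} (hx : x ≠ 1) : wordCoeff cs [] x = 0 := by
  simp [wordCoeff, hx.symm]

/-- Only the positions `x` and `s_i x` contribute, and the factor `q` sits on the longer of the two.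
This asymmetry is the one reproduced by the degrees in `HasDetecting.theta_up` and
`HasDetecting.theta_down`. -/
theorem one_add_leftOp_apply {L : Type*} [CommRing L] (q : L) (i : B) (f : W →₀ L) (x : W) :
    ((1 + leftOp cs q i) f) x = if cs.length x < cs.length (cs.simple i * x)
      then f x + q * f (cs.simple i * x) else q * f x + f (cs.simple i * x) := by
  classical
  induction f using Finsupp.induction_linear with
  | zero => simp
  | add f g hf hg =>
    rw [map_add, Finsupp.add_apply, hf, hg]
    split_ifs <;> simp only [Finsupp.add_apply] <;> ring
  | single y a =>
    have h1 : single y a = a • single y (1 : L) := by simp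
    have hxy : y = cs.simple i * x ↔ cs.simple i * y = x := by
      constructor
      · rintro rfl; simp
      · rintro rfl; simp
    have hne : cs.simple i * y ≠ y := by
      intro h
      exact cs.length_simple_mul_ne y i (by rw [h])
    rw [h1, map_smul, LinearMap.add_apply, Module.End.one_apply]
    have hy := cs.length_simple_mul y i
    have hx := cs.length_simple_mul x i
    simp only [Finsupp.smul_apply, smul_eq_mul, Finsupp.add_apply, single_apply, hxy]
    rcases hy with hy | hy
    · rw [leftOp_up q (by omega), single_apply]
      by_cases h2 : y = x
      · subst h2
        rw [if_pos (by omega : cs.length y < _)]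
        simp [hne]
      · by_cases h3 : cs.simple i * y = x
        · subst h3
          have : cs.simple i * (cs.simple i * y) = y := by simp
          rw [this] at hx ⊢
          simp [h2, show ¬ cs.length (cs.simple i * y) < cs.length y by omega]
        · simp [h2, h3]
    · rw [leftOp_down q (by omega)]
      simp only [Finsupp.add_apply, Finsupp.smul_apply, single_apply, smul_eq_mul]
      by_cases h2 : y = x
      · subst h2
        rw [if_neg (by omega : ¬ cs.length y < _)]
        simp [hne]
        ring
      · by_cases h3 : cs.simple i * y = x
        · subst h3
          have : cs.simple i * (cs.simple i * y) = y := by simp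
          rw [this] at hx ⊢
          simp [h2, show cs.length (cs.simple i * y) < cs.length y by omega]
          ring
        · simp [h2, h3]

theorem wordCoeff_cons (i : B) (l : List B) (x : W) :
    wordCoeff cs (i :: l) x = if cs.length x < cs.length (cs.simple i * x)
      then wordCoeff cs l x + T (-2) * wordCoeff cs l (cs.simple i * x)
      else T (-2) * wordCoeff cs l x + wordCoeff cs l (cs.simple i * x) := by
  have h := one_add_leftOp_apply cs (T (-2) : ℤ[T;T⁻¹]) i
    (heckeRep cs ((l.map fun i => 1 + heckeGen M i).prod) (single 1 1)) x
  rw [wordCoeff, List.map_cons, List.prod_cons, map_mul, Module.End.mul_apply, map_add, map_one,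
    heckeRep_gen]
  exact h

end HeckeModule

end Soergel

namespace Soergel

/-! ### Regular functions: the group action and restriction to a subspace -/

section RegLemmas

variable {k : Type*} [Field k] {V : Type*} [AddCommGroup V] [Module k V]
  {W : Type*} [Group W] (ρ : Representation k W V)

/-- A linear form, as a regular function. -/
noncomputable abbrev linForm : Module.Dual k V →ₗ[k] Reg k V :=
  SymmetricAlgebra.ι k (Module.Dual k V)

@[simp]
theorem regAct_linForm (g : W) (ψ : Module.Dual k V) :
    regAct ρ g (linForm ψ) = linForm (ρ.dual g ψ) := by
  simp [regAct, linForm, SymmetricAlgebra.lift_ι_apply]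

theorem regAct_mul_apply (g h : W) (r : Reg k V) :
    regAct ρ (g * h) r = regAct ρ g (regAct ρ h r) := by
  have : regAct ρ (g * h) = (regAct ρ g).comp (regAct ρ h) := by
    refine SymmetricAlgebra.algHom_ext (LinearMap.ext fun ψ => ?_)
    change regAct ρ (g * h) (linForm ψ) = regAct ρ g (regAct ρ h (linForm ψ))
    rw [regAct_linForm, regAct_linForm, regAct_linForm, map_mul]
    rfl
  rw [this, AlgHom.comp_apply]

theorem regAct_one_apply (r : Reg k V) : regAct ρ 1 r = r := by
  have : regAct ρ 1 = AlgHom.id k _ := by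
    refine SymmetricAlgebra.algHom_ext (LinearMap.ext fun ψ => ?_)
    change regAct ρ 1 (linForm ψ) = linForm ψ
    rw [regAct_linForm, map_one]
    rfl
  rw [this, AlgHom.id_apply]

theorem mem_regInvariants {g : W} {r : Reg k V} : r ∈ regInvariants ρ g ↔ regAct ρ g r = r := by
  simp [regInvariants, AlgHom.mem_equalizer]

@[simp]
theorem restrictReg_linForm (V' : Submodule k V) (ψ : Module.Dual k V) :
    restrictReg k V V' (linForm ψ) = linForm (ψ ∘ₗ V'.subtype) := by
  simp [restrictReg, linForm, SymmetricAlgebra.lift_ι_apply]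
  rfl

theorem algebraMap_eq_restrictReg (V' : Submodule k V) (r : Reg k V) :
    algebraMap (Reg k V) (Reg k V') r = restrictReg k V V' r := rfl

theorem restrictReg_regAct (V' : Subrepresentation ρ) (g : W) (r : Reg k V) :
    restrictReg k V V'.toSubmodule (regAct ρ g r) =
      regAct V'.toRepresentation g (restrictReg k V V'.toSubmodule r) := by
  have : (restrictReg k V V'.toSubmodule).comp (regAct ρ g) =
      (regAct V'.toRepresentation g).comp (restrictReg k V V'.toSubmodule) := by
    refine SymmetricAlgebra.algHom_ext (LinearMap.ext fun ψ => ?_)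
    change restrictReg k V V'.toSubmodule (regAct ρ g (linForm ψ)) =
      regAct V'.toRepresentation g (restrictReg k V V'.toSubmodule (linForm ψ))
    simp only [regAct_linForm, restrictReg_linForm]
    congr 1
  exact DFunLike.congr_fun this r

theorem exists_dual_restrict (V' : Submodule k V) (ψ : Module.Dual k V') :
    ∃ ψ' : Module.Dual k V, ψ' ∘ₗ V'.subtype = ψ :=
  LinearMap.exists_extend ψ

theorem restrictReg_surjective (V' : Submodule k V) :
    Function.Surjective (restrictReg k V V') := by
  intro r
  induction r using SymmetricAlgebra.induction with
  | algebraMap c => exact ⟨algebraMap k _ c, by simp⟩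
  | ι ψ =>
    obtain ⟨ψ', rfl⟩ := exists_dual_restrict V' ψ
    exact ⟨linForm ψ', by simp⟩
  | mul a b ha hb =>
    obtain ⟨a, rfl⟩ := ha
    obtain ⟨b, rfl⟩ := hb
    exact ⟨a * b, by simp⟩
  | add a b ha hb =>
    obtain ⟨a, rfl⟩ := ha
    obtain ⟨b, rfl⟩ := hb
    exact ⟨a + b, by simp⟩

/-- The linear forms that vanish on `V'`, as regular functions. -/
def vanishingForms (V' : Submodule k V) : Set (Reg k V) :=
  {y | ∃ ψ : Module.Dual k V, ψ ∘ₗ V'.subtype = 0 ∧ y = linForm ψ}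

/-- A linear section of the restriction of linear forms extends to an algebra section `S`. The
differences `r - S (r|V')` lie in the ideal, because they do for linear forms and the property
passes to sums and products. -/
theorem ker_restrictReg (V' : Submodule k V) :
    RingHom.ker (restrictReg k V V') = Ideal.span (vanishingForms V') := by
  refine le_antisymm ?_ ?_
  · have hs : Function.Surjective (fun ψ : Module.Dual k V => ψ ∘ₗ V'.subtype) :=
      fun ψ => exists_dual_restrict V' ψ
    obtain ⟨σ, hσ⟩ := LinearMap.exists_rightInverse_of_surjective
      (V'.subtype.dualMap) (LinearMap.range_eq_top.2 hs)
    let S : Reg k V' →ₐ[k] Reg k V :=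
      SymmetricAlgebra.lift (SymmetricAlgebra.ι k (Module.Dual k V) ∘ₗ σ)
    have h : ∀ r, r - S (restrictReg k V V' r) ∈ Ideal.span (vanishingForms V') := by
      intro r
      induction r using SymmetricAlgebra.induction with
      | algebraMap c => simp
      | ι ψ =>
        refine Ideal.subset_span ⟨ψ - σ (ψ ∘ₗ V'.subtype), ?_, ?_⟩
        · have := LinearMap.congr_fun hσ (ψ ∘ₗ V'.subtype)
          change σ (ψ ∘ₗ V'.subtype) ∘ₗ V'.subtype = ψ ∘ₗ V'.subtype at this
          rw [LinearMap.sub_comp, this, sub_self]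
        · rw [restrictReg_linForm]
          simp [S, linForm, SymmetricAlgebra.lift_ι_apply]
      | mul a b ha hb =>
        have : a * b - S (restrictReg k V V' (a * b)) =
            a * (b - S (restrictReg k V V' b)) +
              S (restrictReg k V V' b) * (a - S (restrictReg k V V' a)) := by
          simp only [map_mul]; ring
        rw [this]
        exact Ideal.add_mem _ (Ideal.mul_mem_left _ _ hb) (Ideal.mul_mem_left _ _ ha)
      | add a b ha hb =>
        have : a + b - S (restrictReg k V V' (a + b)) =
            (a - S (restrictReg k V V' a)) + (b - S (restrictReg k V V' b)) := by
          simp only [map_add]; ring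
        rw [this]
        exact Ideal.add_mem _ ha hb
    intro r hr
    have := h r
    rwa [(RingHom.mem_ker).1 hr, map_zero, sub_zero] at this
  · rw [Ideal.span_le]
    rintro _ ⟨ψ, hψ, rfl⟩
    change restrictReg k V V' (linForm ψ) = 0
    rw [restrictReg_linForm, hψ, map_zero]

/-! ### The grading of the regular functions -/

/-- The component of degree `i`, as a subspace. -/
noncomputable def regDegSubmodule (k : Type*) [Field k] (V : Type*) [AddCommGroup V] [Module k V]
    (i : ℤ) : Submodule k (Reg k V) :=
  ⨆ (n : ℕ) (_ : i = 2 * n), LinearMap.range (SymmetricAlgebra.ι k (Module.Dual k V)) ^ n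

theorem mem_regDegSubmodule {i : ℤ} {r : Reg k V} : r ∈ regDegSubmodule k V i ↔ r ∈ regDeg k V i :=
  Iff.rfl

theorem regDegSubmodule_two_mul (n : ℕ) : regDegSubmodule k V (2 * n) =
    LinearMap.range (SymmetricAlgebra.ι k (Module.Dual k V)) ^ n := by
  refine le_antisymm (iSup₂_le fun n' h => ?_) (le_iSup₂_of_le n rfl le_rfl)
  rw [show n' = n by omega]

theorem regDegSubmodule_eq_bot {i : ℤ} (h : ∀ n : ℕ, i ≠ 2 * n) : regDegSubmodule k V i = ⊥ :=
  eq_bot_iff.2 (iSup₂_le fun n hn => absurd hn (h n))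

instance [FiniteDimensional k V] (i : ℤ) : FiniteDimensional k (regDegSubmodule k V i) := by
  by_cases h : ∃ n : ℕ, i = 2 * n
  · obtain ⟨n, rfl⟩ := h
    rw [regDegSubmodule_two_mul]
    exact Module.Finite.iff_fg.2 ((Module.Finite.iff_fg.1 inferInstance).pow n)
  · push Not at h
    rw [regDegSubmodule_eq_bot h]
    infer_instance

theorem one_mem_regDeg : (1 : Reg k V) ∈ regDeg k V 0 := by
  have : (1 : Reg k V) ∈ regDegSubmodule k V (2 * (0 : ℕ)) := by
    rw [regDegSubmodule_two_mul, pow_zero]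
    exact Submodule.one_le.1 le_rfl
  rw [← mem_regDegSubmodule]
  simpa using this

theorem linForm_mem_regDeg (ψ : Module.Dual k V) : linForm ψ ∈ regDeg k V 2 := by
  have : linForm ψ ∈ regDegSubmodule k V (2 * (1 : ℕ)) := by
    rw [regDegSubmodule_two_mul, pow_one]
    exact ⟨ψ, rfl⟩
  rw [← mem_regDegSubmodule]
  simpa using this

theorem mul_mem_regDeg {i j : ℤ} {a b : Reg k V} (ha : a ∈ regDeg k V i) (hb : b ∈ regDeg k V j) :
    a * b ∈ regDeg k V (i + j) := by
  rw [← mem_regDegSubmodule] at *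
  by_cases hi : ∃ n : ℕ, i = 2 * n
  · by_cases hj : ∃ n : ℕ, j = 2 * n
    · obtain ⟨n, rfl⟩ := hi
      obtain ⟨n', rfl⟩ := hj
      rw [show (2 * (n : ℤ) + 2 * n') = 2 * (n + n' : ℕ) by push_cast; ring]
      rw [regDegSubmodule_two_mul] at *
      rw [pow_add]
      exact Submodule.mul_mem_mul ha hb
    · push Not at hj
      rw [regDegSubmodule_eq_bot hj, Submodule.mem_bot] at hb
      rw [hb, mul_zero]
      exact zero_mem _
  · push Not at hi
    rw [regDegSubmodule_eq_bot hi, Submodule.mem_bot] at ha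
    rw [ha, zero_mul]
    exact zero_mem _

/-- Regular functions are sums of homogeneous ones. -/
theorem regDeg_induction {P : Reg k V → Prop} (hom : ∀ i, ∀ r ∈ regDeg k V i, P r)
    (add : ∀ a b, P a → P b → P (a + b)) (r : Reg k V) : P r := by
  have h : ∀ r : Reg k V, r ∈ AddSubgroup.closure {r | ∃ i, r ∈ regDeg k V i} := by
    intro r
    induction r using SymmetricAlgebra.induction with
    | algebraMap c =>
      refine AddSubgroup.subset_closure ⟨0, ?_⟩
      rw [Algebra.algebraMap_eq_smul_one, ← mem_regDegSubmodule]
      exact Submodule.smul_mem _ _ one_mem_regDeg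
    | ι ψ => exact AddSubgroup.subset_closure ⟨2, linForm_mem_regDeg ψ⟩
    | mul a b ha hb =>
      induction ha using AddSubgroup.closure_induction with
      | mem a ha =>
        obtain ⟨i, ha⟩ := ha
        induction hb using AddSubgroup.closure_induction with
        | mem b hb =>
          obtain ⟨j, hb⟩ := hb
          exact AddSubgroup.subset_closure ⟨i + j, mul_mem_regDeg ha hb⟩
        | zero => rw [mul_zero]; exact zero_mem _
        | add x y _ _ hx hy => rw [mul_add]; exact add_mem hx hy
        | neg x _ hx => rw [mul_neg]; exact neg_mem hx
      | zero => rw [zero_mul]; exact zero_mem _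
      | add x y _ _ hx hy => rw [add_mul]; exact add_mem hx hy
      | neg x _ hx => rw [neg_mul]; exact neg_mem hx
    | add a b ha hb => exact add_mem ha hb
  refine AddSubgroup.closure_induction'' (p := fun r _ => P r) ?_ ?_ ?_ ?_ (h r)
  · rintro x ⟨i, hx⟩; exact hom i x hx
  · rintro x ⟨i, hx⟩; exact hom i _ (neg_mem hx)
  · exact hom 0 0 (zero_mem _)
  · intro x y _ _ hx hy; exact add x y hx hy

theorem restrictReg_map_regDegSubmodule (V' : Submodule k V) (i : ℤ) :
    (regDegSubmodule k V i).map (restrictReg k V V').toLinearMap = regDegSubmodule k V' i := by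
  by_cases h : ∃ n : ℕ, i = 2 * n
  · obtain ⟨n, rfl⟩ := h
    rw [regDegSubmodule_two_mul, regDegSubmodule_two_mul]
    rw [Submodule.map_pow]
    congr 1
    ext r
    constructor
    · rintro ⟨_, ⟨ψ, rfl⟩, rfl⟩
      exact ⟨ψ ∘ₗ V'.subtype, (restrictReg_linForm V' ψ).symm⟩
    · rintro ⟨ψ, rfl⟩
      obtain ⟨ψ', rfl⟩ := exists_dual_restrict V' ψ
      exact ⟨_, ⟨ψ', rfl⟩, restrictReg_linForm V' ψ'⟩
  · push Not at h
    rw [regDegSubmodule_eq_bot h, regDegSubmodule_eq_bot h, Submodule.map_bot]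

theorem exists_restrictReg_of_mem_regDeg (V' : Submodule k V) {i : ℤ} {r : Reg k V'}
    (hr : r ∈ regDeg k V' i) : ∃ r' ∈ regDeg k V i, restrictReg k V V' r' = r := by
  rw [← mem_regDegSubmodule, ← restrictReg_map_regDegSubmodule V' i] at hr
  exact hr

/-! ### Reflections -/

/-- `φ` is a root of `g`: the linear form `φ` is negated by the involution `g`, which is the
identity modulo `φ`. -/
structure IsRoot (g : W) (φ : Module.Dual k V) : Prop where
  ne_zero : φ ≠ 0
  neg : regAct ρ g (linForm φ) = -linForm φ
  dvd : ∀ r, linForm φ ∣ r - regAct ρ g r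
  invol : ∀ r, regAct ρ g (regAct ρ g r) = r

variable {ρ}

theorem linForm_ne_zero {φ : Module.Dual k V} (h : φ ≠ 0) : linForm φ ≠ 0 := by
  intro h0
  have hb := Module.Basis.ofVectorSpace k (Module.Dual k V)
  have h1 := congrArg (SymmetricAlgebra.equivMvPolynomial hb) h0
  rw [linForm] at h1
  apply h
  apply hb.ext_elem
  intro i
  have h2 : SymmetricAlgebra.equivMvPolynomial hb (SymmetricAlgebra.ι k _ φ) =
      (hb.repr φ).sum fun i c => MvPolynomial.monomial (Finsupp.single i 1) c := by
    conv_lhs => rw [← hb.linearCombination_repr φ]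
    simp only [Finsupp.linearCombination_apply, Finsupp.sum, map_sum, map_smul,
      SymmetricAlgebra.equivMvPolynomial_ι_apply, MvPolynomial.X, MvPolynomial.smul_monomial,
      smul_eq_mul, mul_one]
  rw [h2, map_zero] at h1
  have h3 := congrArg (MvPolynomial.coeff (Finsupp.single i 1)) h1
  classical
  simp only [Finsupp.sum, MvPolynomial.coeff_sum, MvPolynomial.coeff_monomial,
    MvPolynomial.coeff_zero, Finsupp.single_left_inj one_ne_zero] at h3
  simpa using h3

theorem IsRoot.linForm_ne_zero {g : W} {φ : Module.Dual k V} (h : IsRoot ρ g φ) :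
    linForm φ ≠ 0 :=
  Soergel.linForm_ne_zero h.ne_zero

/-- On linear forms `g` is `ψ ↦ ψ - ψ(x) φ`. Divisibility of `r - g r` by `φ` extends to products by
the twisted Leibniz rule. -/
theorem isRoot_of_reflection {g : W} (hg : g⁻¹ = g) {x : V} {φ : Module.Dual k V} (hx : φ x = 2)
    (h2 : (2 : k) ≠ 0) (h : ρ g = Module.preReflection x φ) : IsRoot ρ g φ := by
  have hd : ∀ ψ : Module.Dual k V, ρ.dual g ψ = ψ - ψ x • φ := by
    intro ψ
    ext v
    rw [Representation.dual_apply, hg, h]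
    simp [Module.preReflection_apply, Module.Dual.transpose_apply, mul_comm]
  have hneg : regAct ρ g (linForm φ) = -linForm φ := by
    rw [regAct_linForm, hd, hx, ← map_neg]
    congr 1
    rw [two_smul]; abel
  refine ⟨?_, hneg, ?_, ?_⟩
  · rintro rfl
    exact h2 (by simpa using hx.symm)
  · intro r
    induction r using SymmetricAlgebra.induction with
    | algebraMap c => simp
    | ι ψ =>
      change linForm φ ∣ linForm ψ - regAct ρ g (linForm ψ)
      rw [regAct_linForm, hd, map_sub, map_smul, sub_sub_cancel]
      exact ⟨algebraMap k _ (ψ x), by rw [Algebra.smul_def, mul_comm]⟩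
    | mul a b ha hb =>
      have : a * b - regAct ρ g (a * b) =
          a * (b - regAct ρ g b) + regAct ρ g b * (a - regAct ρ g a) := by
        rw [map_mul]; ring
      rw [this]
      exact dvd_add (hb.mul_left _) (ha.mul_left _)
    | add a b ha hb =>
      rw [map_add, add_sub_add_comm]
      exact dvd_add ha hb
  · intro r
    rw [← regAct_mul_apply]
    have : g * g = 1 := by nth_rw 1 [← hg]; simp
    rw [this, regAct_one_apply]

end RegLemmas

end Soergel

namespace Soergel

/-! ### Demazure operators and the decomposition R = R^g ⊕ φ R^g -/

section Demazure

variable {k : Type*} [Field k] {V : Type*} [AddCommGroup V] [Module k V]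
  {W : Type*} [Group W] {ρ : Representation k W V} {g : W} {φ : Module.Dual k V}

/-- The operator `r ↦ (r - g r) / 2 φ`. -/
noncomputable def demazure (h : IsRoot ρ g φ) (r : Reg k V) : Reg k V :=
  (2⁻¹ : k) • (h.dvd r).choose

theorem demazure_spec (h2 : (2 : k) ≠ 0) (h : IsRoot ρ g φ) (r : Reg k V) :
    r - regAct ρ g r = 2 * (linForm φ * demazure h r) := by
  rw [demazure, mul_smul_comm, ← (h.dvd r).choose_spec, two_mul, ← add_smul]
  rw [← two_mul, mul_inv_cancel₀ h2, one_smul]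

theorem two_ne_zero_reg (h2 : (2 : k) ≠ 0) : (2 : Reg k V) ≠ 0 := by
  intro h
  have : algebraMap k (Reg k V) 2 = 0 := by rw [map_ofNat, h]
  exact h2 ((SymmetricAlgebra.algebraMap_eq_zero_iff _ _).1 this)

theorem demazure_unique (h2 : (2 : k) ≠ 0) (h : IsRoot ρ g φ) {r b : Reg k V}
    (hb : r - regAct ρ g r = 2 * (linForm φ * b)) : demazure h r = b := by
  rw [demazure_spec h2 h] at hb
  exact mul_left_cancel₀ h.linForm_ne_zero (mul_left_cancel₀ (two_ne_zero_reg h2) hb)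

/-- Both `r - g r` and `φ` change sign under `g`, so their quotient is invariant. -/
theorem regAct_demazure (h2 : (2 : k) ≠ 0) (h : IsRoot ρ g φ) (r : Reg k V) :
    regAct ρ g (demazure h r) = demazure h r := by
  symm
  apply demazure_unique h2 h
  have h1 := congrArg (regAct ρ g) (demazure_spec h2 h r)
  simp only [map_sub, map_mul, h.invol, h.neg, map_ofNat] at h1
  linear_combination -h1

theorem demazure_add (h2 : (2 : k) ≠ 0) (h : IsRoot ρ g φ) (r r' : Reg k V) :
    demazure h (r + r') = demazure h r + demazure h r' := by
  apply demazure_unique h2 h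
  rw [map_add]
  linear_combination demazure_spec h2 h r + demazure_spec h2 h r'

theorem demazure_mul_inv (h2 : (2 : k) ≠ 0) (h : IsRoot ρ g φ) (r : Reg k V) {a : Reg k V}
    (ha : regAct ρ g a = a) : demazure h (r * a) = demazure h r * a := by
  apply demazure_unique h2 h
  rw [map_mul, ha]
  linear_combination a * demazure_spec h2 h r

theorem demazure_of_inv (h2 : (2 : k) ≠ 0) (h : IsRoot ρ g φ) {a : Reg k V}
    (ha : regAct ρ g a = a) : demazure h a = 0 := by
  apply demazure_unique h2 h
  rw [ha]
  ring

theorem regAct_root_sq (h : IsRoot ρ g φ) :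
    regAct ρ g (linForm φ * linForm φ) = linForm φ * linForm φ := by
  rw [map_mul, h.neg, neg_mul_neg]

/-- `r = a + φ b` with invariant `a`, `b`. -/
theorem eq_demazure_add (h2 : (2 : k) ≠ 0) (h : IsRoot ρ g φ) (r : Reg k V) :
    r = demazure h (linForm φ * r) + linForm φ * demazure h r := by
  have h1 := demazure_spec h2 h (linForm φ * r)
  have h3 := demazure_spec h2 h r
  rw [map_mul, h.neg] at h1
  apply mul_left_cancel₀ (mul_ne_zero (two_ne_zero_reg (V := V) h2) h.linForm_ne_zero)
  linear_combination h1 + linForm φ * h3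

end Demazure

namespace GrBimod

/-! ### Elementary tensors of bimodules -/

section TensorElements

universe u₁ u₂ u₃ w₁ w₂ w₃

variable {A : Type u₁} {B : Type u₂} {C : Type u₃} [CommRing A] [CommRing B] [CommRing C]
  {M : GrBimod.{u₁, u₂, w₁} A B} {N : GrBimod.{u₂, u₃, w₂} B C}

/-- The element `m ⊗ n` of the tensor product of two bimodules. -/
def tmk (m : M.carrier) (n : N.carrier) : (M.tensor N).carrier :=
  TensorProduct.tmul B (M := M.AsRight) m n

theorem tmk_add_left (m m' : M.carrier) (n : N.carrier) :
    tmk (m + m') n = tmk m n + tmk m' n :=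
  TensorProduct.add_tmul (M := M.AsRight) m m' n

theorem tmk_add_right (m : M.carrier) (n n' : N.carrier) :
    tmk m (n + n') = tmk m n + tmk m n' :=
  TensorProduct.tmul_add (M := M.AsRight) m n n'

theorem tmk_zero_right (m : M.carrier) : tmk m (0 : N.carrier) = 0 :=
  TensorProduct.tmul_zero (M := M.AsRight) N.carrier m

theorem tmk_right (m : M.carrier) (b : B) (n : N.carrier) :
    tmk (M.right b m) n = tmk m (b • n) :=
  TensorProduct.smul_tmul (M := M.AsRight) b m n

theorem tmk_induction {P : (M.tensor N).carrier → Prop} (tmk : ∀ m n, P (tmk m n))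
    (add : ∀ x y, P x → P y → P (x + y)) (x : (M.tensor N).carrier) : P x :=
  TensorProduct.induction_on x
    ((congrArg P (tmk_zero_right (M := M) (N := N) 0)).mp (tmk 0 0)) tmk (fun x y => add x y)

/-- A balanced biadditive map factors through the tensor product. -/
def tensorLift {P : Type w₃} [AddCommGroup P] (β : M.carrier →+ N.carrier →+ P)
    (h : ∀ m (b : B) n, β (M.right b m) n = β m (b • n)) : (M.tensor N).carrier →+ P :=
  TensorProduct.liftAddHom (M := M.AsRight) (N := N.carrier) (R := B) β (fun b m n => h m b n)

theorem tmk_mem_deg {i j : ℤ} {m : M.carrier} {n : N.carrier} (hm : m ∈ M.deg i)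
    (hn : n ∈ N.deg j) : tmk m n ∈ (M.tensor N).deg (i + j) :=
  AddSubgroup.subset_closure ⟨i, j, rfl, m, hm, n, hn, rfl⟩

end TensorElements

end GrBimod

/-! ### The bimodule θ_g ⊗ M as R ⊗ M over the g-invariants -/

section Theta

variable {k : Type*} [Field k] {V : Type*} [AddCommGroup V] [Module k V]
  {W : Type*} [Group W] {ρ : Representation k W V} {g : W} {φ : Module.Dual k V}
  {B : Type*} [CommRing B]

open GrBimod

/-- The element `(r ⊗ 1) ⊗ m` of `θ_g ⊗ M`. -/
noncomputable def thetaMk (ρ : Representation k W V) (g : W) {M : GrBimod (Reg k V) B}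
    (r : Reg k V) (m : M.carrier) : ((theta ρ g).tensor M).carrier :=
  tmk (M := theta ρ g) (tmk
    (M := ofRingHom (RingHom.id _) (regInvariants ρ g).val.toRingHom (regDeg k V))
    (N := ofRingHom (regInvariants ρ g).val.toRingHom (RingHom.id _) (regDeg k V))
      r (1 : Reg k V)) m

variable {M : GrBimod (Reg k V) B}

theorem thetaMk_add_left (r r' : Reg k V) (m : M.carrier) :
    thetaMk ρ g (r + r') m = thetaMk ρ g r m + thetaMk ρ g r' m :=
  (congrArg (fun t => tmk (M := theta ρ g) t m) (tmk_add_left _ _ _)).trans (tmk_add_left _ _ _)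

theorem thetaMk_add_right (r : Reg k V) (m m' : M.carrier) :
    thetaMk ρ g r (m + m') = thetaMk ρ g r m + thetaMk ρ g r m' :=
  tmk_add_right _ _ _

/-- The middle factor is absorbed into `M`. All later computations in θ_g ⊗ M can then use elements
`r ⊗ m` balanced over the invariants. -/
theorem tmk_tmk_eq_thetaMk (r r' : Reg k V) (m : M.carrier) :
    tmk (M := theta ρ g) (tmk
    (M := ofRingHom (RingHom.id _) (regInvariants ρ g).val.toRingHom (regDeg k V))
    (N := ofRingHom (regInvariants ρ g).val.toRingHom (RingHom.id _) (regDeg k V)) r r') m =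
      thetaMk ρ g r (r' • m) := by
  refine Eq.trans ?_ (tmk_right _ _ _)
  refine congrArg (fun t => tmk (M := theta ρ g) t m) ?_
  exact congrArg (tmk _) (one_mul r').symm

theorem thetaMk_mul_inv (r : Reg k V) {a : Reg k V} (ha : regAct ρ g a = a) (m : M.carrier) :
    thetaMk ρ g (r * a) m = thetaMk ρ g r (a • m) := by
  rw [← tmk_tmk_eq_thetaMk]
  refine congrArg (fun t => tmk (M := theta ρ g) t m) ?_
  refine (tmk_right (M := ofRingHom (RingHom.id _) (regInvariants ρ g).val.toRingHom (regDeg k V))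
    r (⟨a, (mem_regInvariants ρ).2 ha⟩ : regInvariants ρ g) _).trans ?_
  exact congrArg (tmk _) (mul_one a)

theorem smul_thetaMk (c r : Reg k V) (m : M.carrier) :
    c • thetaMk ρ g r m = thetaMk ρ g (c * r) m := rfl

theorem right_thetaMk (b : B) (r : Reg k V) (m : M.carrier) :
    ((theta ρ g).tensor M).right b (thetaMk ρ g r m) = thetaMk ρ g r (M.right b m) := rfl

theorem thetaMk_induction {P : ((theta ρ g).tensor M).carrier → Prop}
    (mk : ∀ r m, P (thetaMk ρ g r m)) (add : ∀ x y, P x → P y → P (x + y))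
    (x : ((theta ρ g).tensor M).carrier) : P x := by
  refine tmk_induction (fun t m => ?_) add x
  refine tmk_induction (P := fun t => P (tmk (M := theta ρ g) t m)) (fun r r' => ?_)
    (fun t t' h h' => ?_) t
  · exact (congrArg P (tmk_tmk_eq_thetaMk r r' m)).mpr (mk _ _)
  · exact (congrArg P (tmk_add_left (M := theta ρ g) t t' m)).mpr (add _ _ h h')

theorem thetaMk_mem_deg {i j : ℤ} {r : Reg k V} {m : M.carrier} (hr : r ∈ regDeg k V i)
    (hm : m ∈ M.deg j) : thetaMk ρ g r m ∈ ((theta ρ g).tensor M).deg (i + j) := by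
  refine tmk_mem_deg ?_ hm
  have := tmk_mem_deg
    (M := ofRingHom (RingHom.id _) (regInvariants ρ g).val.toRingHom (regDeg k V))
    (N := ofRingHom (regInvariants ρ g).val.toRingHom (RingHom.id _) (regDeg k V))
    (m := r) (n := (1 : Reg k V)) hr one_mem_regDeg
  rwa [add_zero] at this

/-- The map `(r, r') ↦ (m ↦ β r (r' m))`. -/
def smulRight {R N P : Type*} [CommRing R] [AddCommGroup N] [Module R N] [AddCommGroup P]
    (β : R →+ N →+ P) : R →+ R →+ N →+ P where
  toFun r :=
    { toFun := fun r' => (β r).comp (DistribSMul.toAddMonoidHom N r')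
      map_zero' := by ext m; simp
      map_add' := fun a b => by ext m; simp [add_smul] }
  map_zero' := by ext r' m; simp
  map_add' a b := by ext r' m; simp

/-- A biadditive map that is balanced over the invariants, extended to `θ_g × M`. -/
noncomputable def thetaLiftAux {P : Type*} [AddCommGroup P] (β : Reg k V →+ M.carrier →+ P)
    (h : ∀ r a m, regAct ρ g a = a → β (r * a) m = β r (a • m)) :
    (theta ρ g).carrier →+ M.carrier →+ P :=
  tensorLift
    (M := ofRingHom (RingHom.id _) (regInvariants ρ g).val.toRingHom (regDeg k V))
    (N := ofRingHom (regInvariants ρ g).val.toRingHom (RingHom.id _) (regDeg k V))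
    (smulRight (R := Reg k V) β)
    (fun r a r' => AddMonoidHom.ext fun m =>
      (h r a.1 ((show Reg k V from r') • m) ((mem_regInvariants ρ).1 a.2)).trans
        (congrArg (β r) (mul_smul a.1 (show Reg k V from r') m).symm))

/-- A biadditive map that is balanced over the invariants factors through `θ_g ⊗ M`. -/
noncomputable def thetaLift {P : Type*} [AddCommGroup P] (β : Reg k V →+ M.carrier →+ P)
    (h : ∀ r a m, regAct ρ g a = a → β (r * a) m = β r (a • m)) :
    ((theta ρ g).tensor M).carrier →+ P :=
  tensorLift (M := theta ρ g) (thetaLiftAux β h) fun t b m => by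
    refine tmk_induction (P := fun t => thetaLiftAux β h ((theta ρ g).right b t) m =
        thetaLiftAux β h t (b • m)) (fun r r' => ?_) (fun t t' h1 h2 => ?_) t
    · refine congrArg (β r) ?_
      exact mul_smul (show Reg k V from r') b m
    · refine (DFunLike.congr_fun ((congrArg (thetaLiftAux β h) (map_add _ t t')).trans
        (map_add (thetaLiftAux β h) _ _)) m).trans ?_
      refine Eq.trans ?_ (DFunLike.congr_fun (map_add (thetaLiftAux β h) t t') (b • m)).symm
      exact congrArg₂ (· + ·) h1 h2

@[simp]
theorem thetaLift_mk {P : Type*} [AddCommGroup P] (β : Reg k V →+ M.carrier →+ P)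
    (h : ∀ r a m, regAct ρ g a = a → β (r * a) m = β r (a • m)) (r : Reg k V) (m : M.carrier) :
    thetaLift β h (thetaMk ρ g r m) = β r m :=
  congrArg (β r) (one_smul _ m)

/-- The map `(r, m) ↦ r • h m`. -/
def smulComp {R N P : Type*} [CommRing R] [AddCommGroup N] [AddCommGroup P] [Module R P]
    (h : N →+ P) : R →+ N →+ P where
  toFun r := (DistribSMul.toAddMonoidHom P r).comp h
  map_zero' := by ext m; simp
  map_add' a b := by ext m; simp [add_smul]

/-- The additive map `r ⊗ m ↦ r • h m`. -/
noncomputable def thetaHomAux {N : GrBimod (Reg k V) B} (h : M.carrier →+ N.carrier)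
    (hl : ∀ a m, regAct ρ g a = a → h (a • m) = a • h m) :
    ((theta ρ g).tensor M).carrier →+ N.carrier :=
  thetaLift (smulComp h) fun r a m ha => by
    change (r * a) • h m = r • h (a • m)
    rw [hl a m ha, mul_smul]

theorem thetaHomAux_mk {N : GrBimod (Reg k V) B} (h : M.carrier →+ N.carrier)
    (hl : ∀ a m, regAct ρ g a = a → h (a • m) = a • h m) (r : Reg k V) (m : M.carrier) :
    thetaHomAux h hl (thetaMk ρ g r m) = r • h m :=
  thetaLift_mk _ _ r m

/-- The homomorphism `r ⊗ m ↦ r • h m`. -/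
noncomputable def thetaHom {N : GrBimod (Reg k V) B} (h : M.carrier →+ N.carrier)
    (hl : ∀ a m, regAct ρ g a = a → h (a • m) = a • h m)
    (hr : ∀ b m, h (M.right b m) = N.right b (h m)) : Hom ((theta ρ g).tensor M) N :=
  ⟨{ toFun := thetaHomAux h hl
     map_add' := map_add _
     map_smul' := fun c x => by
      rw [RingHom.id_apply]
      induction x using thetaMk_induction with
      | mk r m => rw [smul_thetaMk, thetaHomAux_mk, thetaHomAux_mk, mul_smul]
      | add x y hx hy => rw [smul_add, map_add, hx, hy, map_add, smul_add] }, fun b x => by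
    change thetaHomAux h hl _ = N.right b (thetaHomAux h hl x)
    induction x using thetaMk_induction with
    | mk r m => rw [right_thetaMk, thetaHomAux_mk, thetaHomAux_mk, hr, map_smul]
    | add x y hx hy => rw [map_add, map_add, hx, hy, map_add, map_add]⟩

@[simp]
theorem thetaHom_mk {N : GrBimod (Reg k V) B} (h : M.carrier →+ N.carrier)
    (hl : ∀ a m, regAct ρ g a = a → h (a • m) = a • h m)
    (hr : ∀ b m, h (M.right b m) = N.right b (h m)) (r : Reg k V) (m : M.carrier) :
    (thetaHom h hl hr).1 (thetaMk ρ g r m) = r • h m :=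
  thetaHomAux_mk h hl r m

/-- The map `r ⊗ m ↦ ∂(r) m`. -/
noncomputable def thetaTrace (h2 : (2 : k) ≠ 0) (h : IsRoot ρ g φ) (M : GrBimod (Reg k V) B) :
    ((theta ρ g).tensor M).carrier →+ M.carrier :=
  thetaLift
    { toFun := fun r => DistribSMul.toAddMonoidHom M.carrier (demazure h r)
      map_zero' := by ext m; simp [demazure_of_inv h2 h (map_zero _)]
      map_add' := fun a b => by ext m; simp [demazure_add h2 h, add_smul] }
    (fun r a m ha => by
      change demazure h (r * a) • m = demazure h r • a • m
      rw [demazure_mul_inv h2 h r ha, mul_smul])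

@[simp]
theorem thetaTrace_mk (h2 : (2 : k) ≠ 0) (h : IsRoot ρ g φ) (r : Reg k V) (m : M.carrier) :
    thetaTrace h2 h M (thetaMk ρ g r m) = demazure h r • m :=
  thetaLift_mk _ _ r m

theorem thetaTrace_smul (h2 : (2 : k) ≠ 0) (h : IsRoot ρ g φ) {a : Reg k V}
    (ha : regAct ρ g a = a) (x : ((theta ρ g).tensor M).carrier) :
    thetaTrace h2 h M (a • x) = a • thetaTrace h2 h M x := by
  induction x using thetaMk_induction with
  | mk r m =>
    rw [smul_thetaMk, thetaTrace_mk, thetaTrace_mk, mul_comm, demazure_mul_inv h2 h r ha, mul_comm,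
      mul_smul]
  | add x y hx hy => rw [smul_add, map_add, hx, hy, map_add, smul_add]

theorem thetaTrace_right (h2 : (2 : k) ≠ 0) (h : IsRoot ρ g φ) (b : B)
    (x : ((theta ρ g).tensor M).carrier) :
    thetaTrace h2 h M (((theta ρ g).tensor M).right b x) = M.right b (thetaTrace h2 h M x) := by
  induction x using thetaMk_induction with
  | mk r m => rw [right_thetaMk, thetaTrace_mk, thetaTrace_mk, map_smul]
  | add x y hx hy => rw [map_add, map_add, hx, hy, map_add, map_add]

/-- Every element of `θ_g ⊗ M` is `1 ⊗ m + φ ⊗ m'`. -/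
theorem eq_thetaMk_add (h2 : (2 : k) ≠ 0) (h : IsRoot ρ g φ)
    (x : ((theta ρ g).tensor M).carrier) :
    x = thetaMk ρ g 1 (thetaTrace h2 h M (linForm φ • x)) +
      thetaMk ρ g (linForm φ) (thetaTrace h2 h M x) := by
  induction x using thetaMk_induction with
  | mk r m =>
    rw [smul_thetaMk, thetaTrace_mk, thetaTrace_mk,
      ← thetaMk_mul_inv _ (regAct_demazure h2 h _), ← thetaMk_mul_inv _ (regAct_demazure h2 h _),
      one_mul, ← thetaMk_add_left, ← eq_demazure_add h2 h]
  | add x y hx hy =>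
    nth_rw 1 [hx, hy]
    rw [smul_add, map_add, map_add, thetaMk_add_right, thetaMk_add_right]
    abel

end Theta
end Soergel

namespace Soergel

open GrBimod

namespace GrBimod

theorem tensor_deg_le {A B C : Type*} [CommRing A] [CommRing B] [CommRing C]
    {M : GrBimod A B} {N : GrBimod B C} {d : ℤ} {S : AddSubgroup (M.tensor N).carrier}
    (h : ∀ i j, i + j = d → ∀ m ∈ M.deg i, ∀ n ∈ N.deg j, tmk m n ∈ S) :
    (M.tensor N).deg d ≤ S := by
  refine (AddSubgroup.closure_le S).2 ?_
  rintro y ⟨i, j, hd, m, hm, n, hn, rfl⟩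
  exact h i j hd m hm n hn

theorem smul_mem_tensor_deg {A B C : Type*} [CommRing A] [CommRing B] [CommRing C]
    {M : GrBimod A B} {N : GrBimod B C} {i : ℤ} {a : A}
    (h : ∀ j, ∀ m ∈ M.deg j, a • m ∈ M.deg (i + j)) {j : ℤ} {y : (M.tensor N).carrier}
    (hy : y ∈ (M.tensor N).deg j) : a • y ∈ (M.tensor N).deg (i + j) := by
  refine tensor_deg_le (S := ((M.tensor N).deg (i + j)).comap
    (DistribSMul.toAddMonoidHom _ a)) (fun p q hd m hm n hn => ?_) hy
  rw [← hd, ← add_assoc]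
  exact tmk_mem_deg (h p m hm) hn

end GrBimod

/-! ### Linearity tested on the invariants and on a root -/

section Linearity

variable {k : Type*} [Field k] {V : Type*} [AddCommGroup V] [Module k V]
  {W : Type*} [Group W] {ρ : Representation k W V} {g : W} {φ : Module.Dual k V}
  {M P : Type*} [AddCommGroup M] [AddCommGroup P] [Module (Reg k V) M] [Module (Reg k V) P]

theorem map_smul_of_root (h2 : (2 : k) ≠ 0) (h : IsRoot ρ g φ) (f : M →+ P)
    (ha : ∀ a m, regAct ρ g a = a → f (a • m) = a • f m)
    (hφ : ∀ m, f (linForm φ • m) = linForm φ • f m) (r : Reg k V) (m : M) :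
    f (r • m) = r • f m := by
  conv_lhs => rw [eq_demazure_add h2 h r]
  conv_rhs => rw [eq_demazure_add h2 h r]
  rw [add_smul, add_smul, map_add, ha _ _ (regAct_demazure h2 h _), mul_smul, mul_smul, hφ,
    ha _ _ (regAct_demazure h2 h _)]

theorem map_smul_of_root_neg (h2 : (2 : k) ≠ 0) (h : IsRoot ρ g φ) (f : M →+ P)
    (ha : ∀ a m, regAct ρ g a = a → f (a • m) = a • f m)
    (hφ : ∀ m, f (linForm φ • m) = -(linForm φ • f m)) (r : Reg k V) (m : M) :
    f (r • m) = regAct ρ g r • f m := by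
  conv_lhs => rw [eq_demazure_add h2 h r]
  conv_rhs => rw [eq_demazure_add h2 h r]
  rw [add_smul, map_add, map_add, map_mul, ha _ _ (regAct_demazure h2 h _), mul_smul, hφ,
    ha _ _ (regAct_demazure h2 h _), regAct_demazure h2 h, regAct_demazure h2 h, h.neg, add_smul,
    neg_mul, neg_smul, mul_smul]

end Linearity

/-! ### Twisted homomorphisms and the elements that detect them -/

section Twisted

universe u v w

variable {k : Type u} [Field k] {V : Type v} [AddCommGroup V] [Module k V]
  {W : Type w} [Group W] {ρ : Representation k W V} {g : W} {φ : Module.Dual k V}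

/-- A quotient of the ring of regular functions with a compatible faithful action of `W`. -/
structure FaithfulQuotient (ρ : Representation k W V) (A : Type*) [CommRing A]
    [Algebra (Reg k V) A] where
  act : W → A →+* A
  act_mul : ∀ g h a, act (g * h) a = act g (act h a)
  act_algebraMap : ∀ g r, act g (algebraMap _ A r) = algebraMap _ A (regAct ρ g r)
  surjective : Function.Surjective (algebraMap (Reg k V) A)
  faithful : ∀ g, (∀ a, act g a = a) → g = 1

variable {A : Type*} [CommRing A] [Algebra (Reg k V) A] (t : FaithfulQuotient ρ A)

/-- A homomorphism to `A`, with the right action of `R` on `A` twisted by `x`. -/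
structure IsTwisted (x : W) {M : GrBimod (Reg k V) (Reg k V)} (f : M.carrier →+ A) : Prop where
  smul : ∀ (r : Reg k V) m, f (r • m) = r • f m
  right : ∀ r m, f (M.right r m) = regAct ρ x r • f m

variable {M : GrBimod (Reg k V) (Reg k V)}

theorem FaithfulQuotient.act_smul (g : W) (r : Reg k V) (a : A) :
    t.act g (r • a) = regAct ρ g r • t.act g a := by
  rw [Algebra.smul_def, map_mul, t.act_algebraMap, Algebra.smul_def]

/-- The map `m ↦ 1 ⊗ φ m + φ ⊗ m`. -/
noncomputable def thetaPlus (ρ : Representation k W V) (g : W) (φ : Module.Dual k V)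
    (M : GrBimod (Reg k V) (Reg k V)) : M.carrier →+ ((theta ρ g).tensor M).carrier :=
  AddMonoidHom.mk' (fun m => thetaMk ρ g 1 (linForm φ • m) + thetaMk ρ g (linForm φ) m)
    fun a b => by rw [smul_add, thetaMk_add_right, thetaMk_add_right]; abel

/-- The map `m ↦ 1 ⊗ φ m - φ ⊗ m`. -/
noncomputable def thetaMinus (ρ : Representation k W V) (g : W) (φ : Module.Dual k V)
    (M : GrBimod (Reg k V) (Reg k V)) : M.carrier →+ ((theta ρ g).tensor M).carrier :=
  AddMonoidHom.mk' (fun m => thetaMk ρ g 1 (linForm φ • m) - thetaMk ρ g (linForm φ) m)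
    fun a b => by rw [smul_add, thetaMk_add_right, thetaMk_add_right]; abel

/-- The map `m ↦ 1 ⊗ m`. -/
noncomputable def thetaOne (ρ : Representation k W V) (g : W)
    (M : GrBimod (Reg k V) (Reg k V)) : M.carrier →+ ((theta ρ g).tensor M).carrier :=
  AddMonoidHom.mk' (fun m => thetaMk ρ g 1 m) (thetaMk_add_right _)

theorem thetaPlus_apply (m : M.carrier) : thetaPlus ρ g φ M m =
    thetaMk ρ g 1 (linForm φ • m) + thetaMk ρ g (linForm φ) m := rfl

theorem thetaMinus_apply (m : M.carrier) : thetaMinus ρ g φ M m =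
    thetaMk ρ g 1 (linForm φ • m) - thetaMk ρ g (linForm φ) m := rfl

theorem thetaOne_apply (m : M.carrier) : thetaOne ρ g M m = thetaMk ρ g 1 m := rfl

theorem thetaMk_inv_smul (r : Reg k V) {a : Reg k V} (ha : regAct ρ g a = a) (m : M.carrier) :
    thetaMk ρ g r (a • m) = a • thetaMk ρ g r m := by
  rw [← thetaMk_mul_inv r ha, smul_thetaMk, mul_comm]

/-- As `φ²` is invariant, `1 ⊗ φ²m = φ² ⊗ m`. Hence replacing `m` by `φm` and multiplying by `φ`
give the same two terms; for `thetaMinus` they differ by a sign, which yields semilinearity instead.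
-/
theorem thetaPlus_smul (h2 : (2 : k) ≠ 0) (h : IsRoot ρ g φ) (r : Reg k V) (m : M.carrier) :
    thetaPlus ρ g φ M (r • m) = r • thetaPlus ρ g φ M m := by
  refine map_smul_of_root h2 h _ (fun a m ha => ?_) (fun m => ?_) r m
  · simp only [thetaPlus_apply]
    rw [smul_comm, thetaMk_inv_smul _ ha, thetaMk_inv_smul _ ha, smul_add]
  · simp only [thetaPlus_apply]
    rw [smul_smul, thetaMk_inv_smul _ (regAct_root_sq h), smul_add, smul_thetaMk, smul_thetaMk,
      smul_thetaMk, mul_one, mul_one, add_comm]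

theorem thetaMinus_smul (h2 : (2 : k) ≠ 0) (h : IsRoot ρ g φ) (r : Reg k V) (m : M.carrier) :
    thetaMinus ρ g φ M (r • m) = regAct ρ g r • thetaMinus ρ g φ M m := by
  refine map_smul_of_root_neg h2 h _ (fun a m ha => ?_) (fun m => ?_) r m
  · simp only [thetaMinus_apply]
    rw [smul_comm, thetaMk_inv_smul _ ha, thetaMk_inv_smul _ ha, smul_sub]
  · simp only [thetaMinus_apply]
    rw [smul_smul, thetaMk_inv_smul _ (regAct_root_sq h), smul_sub, smul_thetaMk, smul_thetaMk,
      smul_thetaMk, mul_one, mul_one, neg_sub]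

theorem thetaPlus_right (r : Reg k V) (m : M.carrier) :
    thetaPlus ρ g φ M (M.right r m) =
      ((theta ρ g).tensor M).right r (thetaPlus ρ g φ M m) := by
  rw [thetaPlus_apply, thetaPlus_apply, map_add, right_thetaMk, right_thetaMk, map_smul]

theorem thetaMinus_right (r : Reg k V) (m : M.carrier) :
    thetaMinus ρ g φ M (M.right r m) =
      ((theta ρ g).tensor M).right r (thetaMinus ρ g φ M m) := by
  rw [thetaMinus_apply, thetaMinus_apply, map_sub, right_thetaMk, right_thetaMk, map_smul]

variable {x : W} {f : ((theta ρ g).tensor M).carrier →+ A}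

theorem IsTwisted.comp_thetaPlus (h2 : (2 : k) ≠ 0) (h : IsRoot ρ g φ)
    (hf : IsTwisted (ρ := ρ) x f) : IsTwisted (ρ := ρ) x (f.comp (thetaPlus ρ g φ M)) where
  smul r m := by
    rw [AddMonoidHom.comp_apply, thetaPlus_smul h2 h, hf.smul, AddMonoidHom.comp_apply]
  right r m := by
    rw [AddMonoidHom.comp_apply, thetaPlus_right, hf.right, AddMonoidHom.comp_apply]

/-- Applying `g` to the values undoes the semilinearity of `thetaMinus` on the left, and shifts the
twist on the right from `x` to `g * x`. -/
theorem IsTwisted.comp_thetaMinus (h2 : (2 : k) ≠ 0) (h : IsRoot ρ g φ)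
    (hf : IsTwisted (ρ := ρ) x f) :
    IsTwisted (ρ := ρ) (g * x) ((t.act g : A →+ A).comp (f.comp (thetaMinus ρ g φ M))) where
  smul r m := by
    simp only [AddMonoidHom.comp_apply, AddMonoidHom.coe_coe]
    rw [thetaMinus_smul h2 h, hf.smul, t.act_smul, h.invol]
  right r m := by
    simp only [AddMonoidHom.comp_apply, AddMonoidHom.coe_coe]
    rw [thetaMinus_right, hf.right, t.act_smul, regAct_mul_apply]

theorem IsTwisted.apply_root_mk (hf : IsTwisted (ρ := ρ) x f) (m : M.carrier) :
    f (thetaMk ρ g (linForm φ) m) = linForm φ • f (thetaMk ρ g 1 m) := by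
  rw [← hf.smul, smul_thetaMk, mul_one]

/-- The restriction of `f` to `1 ⊗ M` is a priori linear only over invariants. The vanishing on
`thetaMinus` is the missing relation `f(1 ⊗ φm) = φ f(1 ⊗ m)`; the vanishing on `thetaPlus` in the
next lemma gives it with the opposite sign, hence the twist by `g * x`. -/
theorem IsTwisted.comp_thetaOne_of_minus (h2 : (2 : k) ≠ 0) (h : IsRoot ρ g φ)
    (hf : IsTwisted (ρ := ρ) x f) (h0 : f.comp (thetaMinus ρ g φ M) = 0) :
    IsTwisted (ρ := ρ) x (f.comp (thetaOne ρ g M)) where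
  smul := by
    refine map_smul_of_root h2 h _ (fun a m ha => ?_) (fun m => ?_)
    · rw [AddMonoidHom.comp_apply, thetaOne_apply, thetaMk_inv_smul _ ha, hf.smul]
      rfl
    · have h1 := DFunLike.congr_fun h0 m
      rw [AddMonoidHom.comp_apply, thetaMinus_apply, map_sub, hf.apply_root_mk,
        AddMonoidHom.zero_apply, sub_eq_zero] at h1
      exact h1
  right r m := by
    rw [AddMonoidHom.comp_apply, thetaOne_apply, ← right_thetaMk, hf.right]
    rfl

theorem IsTwisted.comp_thetaOne_of_plus (h2 : (2 : k) ≠ 0) (h : IsRoot ρ g φ)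
    (hf : IsTwisted (ρ := ρ) x f) (h0 : f.comp (thetaPlus ρ g φ M) = 0) :
    IsTwisted (ρ := ρ) (g * x) ((t.act g : A →+ A).comp (f.comp (thetaOne ρ g M))) where
  smul := by
    have h3 := map_smul_of_root_neg h2 h (f.comp (thetaOne ρ g M)) (fun a m ha => ?_)
      (fun m => ?_)
    · intro r m
      rw [AddMonoidHom.comp_apply, h3]
      simp only [AddMonoidHom.comp_apply, AddMonoidHom.coe_coe]
      rw [t.act_smul, h.invol]
    · rw [AddMonoidHom.comp_apply, thetaOne_apply, thetaMk_inv_smul _ ha, hf.smul]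
      rfl
    · have h1 := DFunLike.congr_fun h0 m
      rw [AddMonoidHom.comp_apply, thetaPlus_apply, map_add, hf.apply_root_mk,
        AddMonoidHom.zero_apply, add_eq_zero_iff_eq_neg] at h1
      exact h1
  right r m := by
    simp only [AddMonoidHom.comp_apply, AddMonoidHom.coe_coe]
    rw [thetaOne_apply, ← right_thetaMk, hf.right, t.act_smul, regAct_mul_apply]
    rfl

theorem IsTwisted.eq_zero_of_thetaOne (hf : IsTwisted (ρ := ρ) x f)
    (h0 : f.comp (thetaOne ρ g M) = 0) : f = 0 := by
  ext z
  rw [AddMonoidHom.zero_apply]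
  induction z using thetaMk_induction with
  | mk r m =>
    have h1 : f (thetaMk ρ g 1 m) = 0 := DFunLike.congr_fun h0 m
    rw [show thetaMk ρ g r m = r • thetaMk ρ g 1 m by rw [smul_thetaMk, mul_one], hf.smul, h1,
      smul_zero]
  | add a b ha hb => rw [map_add, ha, hb, add_zero]

theorem FaithfulQuotient.act_injective (t : FaithfulQuotient ρ A) {g : W} (hg : g * g = 1) {a : A}
    (h : t.act g a = 0) : a = 0 := by
  obtain ⟨r, rfl⟩ := t.surjective a
  have h1 := congrArg (t.act g) h
  rw [map_zero, t.act_algebraMap, t.act_algebraMap, ← regAct_mul_apply, hg, regAct_one_apply] at h1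
  exact h1

open scoped LaurentPolynomial
open LaurentPolynomial (T)

/-- Homomorphisms from `M`, twisted by `x`, are determined by their values on finitely many
homogeneous elements, with `p` the generating function of their degrees. -/
def HasDetecting (ρ : Representation k W V) (M : GrBimod.{max u v, max u v, max u v}
    (Reg k V) (Reg k V)) (x : W) (p : ℤ[T;T⁻¹]) : Prop :=
  ∃ (ι : Type) (_ : Fintype ι) (c : ι → M.carrier) (D : ι → ℤ),
    (∀ j, c j ∈ M.deg (2 * D j)) ∧ ∑ j, T (-2 * D j) = p ∧
    ∀ (A : Type (max u v)) [CommRing A] [IsDomain A] [Algebra (Reg k V) A]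
      (_ : FaithfulQuotient ρ A) (f : M.carrier →+ A),
      IsTwisted (ρ := ρ) x f → (∀ j, f (c j) = 0) → f = 0

theorem IsTwisted.unitBimod_apply {f : (unitBimod k V).carrier →+ A}
    (hf : IsTwisted (ρ := ρ) x f) (r : Reg k V) : f r = r • f (1 : Reg k V) :=
  (congrArg f (mul_one r).symm).trans (hf.smul r (1 : Reg k V))

theorem IsTwisted.unitBimod_apply_right {f : (unitBimod k V).carrier →+ A}
    (hf : IsTwisted (ρ := ρ) x f) (r : Reg k V) : f r = regAct ρ x r • f (1 : Reg k V) :=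
  (congrArg f (one_mul r).symm).trans (hf.right r (1 : Reg k V))

theorem hasDetecting_unitBimod_one : HasDetecting ρ (unitBimod k V) 1 1 := by
  refine ⟨Unit, inferInstance, fun _ => (1 : Reg k V), fun _ => 0, fun _ => ?_, by simp, ?_⟩
  · exact one_mem_regDeg
  · intro A _ _ _ t f hf h0
    refine AddMonoidHom.ext fun r => (hf.unitBimod_apply r).trans ?_
    exact (congrArg (HSMul.hSMul (α := Reg k V) r) (h0 ())).trans (smul_zero _)

/-- Left linearity and the twist give `r f(1) = x(r) f(1)` for all `r`. In a domain, `f(1) ≠ 0`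
would make `x` act trivially, against faithfulness. No detecting element is needed. -/
theorem hasDetecting_unitBimod_ne (hx : x ≠ 1) : HasDetecting ρ (unitBimod k V) x 0 := by
  refine ⟨Empty, inferInstance, Empty.elim, Empty.elim, fun j => j.elim, by simp, ?_⟩
  intro A _ _ _ t f hf _
  have h1 : f (1 : Reg k V) = 0 := by
    by_contra hne
    refine hx (t.faithful x fun a => ?_)
    obtain ⟨r, rfl⟩ := t.surjective a
    have h3 := (hf.unitBimod_apply r).symm.trans (hf.unitBimod_apply_right r)
    rw [Algebra.smul_def, Algebra.smul_def] at h3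
    rw [t.act_algebraMap]
    exact (mul_right_cancel₀ hne h3).symm
  refine AddMonoidHom.ext fun r => (hf.unitBimod_apply r).trans ?_
  exact (congrArg (HSMul.hSMul (α := Reg k V) r) h1).trans (smul_zero _)

theorem mul_self_of_root_act (t : FaithfulQuotient ρ A) (h : IsRoot ρ g φ) : g * g = 1 := by
  refine t.faithful _ fun a => ?_
  obtain ⟨r, rfl⟩ := t.surjective a
  rw [t.act_algebraMap, regAct_mul_apply, h.invol]

theorem thetaOne_mem_deg {d : ℤ} {b : M.carrier} (hb : b ∈ M.deg d) :
    thetaOne ρ g M b ∈ ((theta ρ g).tensor M).deg d := by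
  have := thetaMk_mem_deg (ρ := ρ) (g := g) one_mem_regDeg hb
  rwa [zero_add] at this

theorem thetaMk_root_mem_deg {d : ℤ} {b : M.carrier} (hb : b ∈ M.deg d) :
    thetaMk ρ g (linForm φ) b ∈ ((theta ρ g).tensor M).deg (d + 2) := by
  rw [add_comm]
  exact thetaMk_mem_deg (linForm_mem_regDeg φ) hb

theorem thetaMk_one_root_smul_mem_deg
    (hM : ∀ i j : ℤ, ∀ a ∈ regDeg k V i, ∀ m ∈ M.deg j, a • m ∈ M.deg (i + j))
    {d : ℤ} {b : M.carrier} (hb : b ∈ M.deg d) :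
    thetaMk ρ g 1 (linForm φ • b) ∈ ((theta ρ g).tensor M).deg (d + 2) := by
  refine thetaOne_mem_deg ?_
  rw [add_comm]
  exact hM 2 d _ (linForm_mem_regDeg φ) b hb

/-- First kill the `g * x`-twisted map obtained from `thetaMinus`; then `f` on `1 ⊗ M` is
`x`-twisted and can be killed as well. Detecting elements pushed through `thetaMinus` rise by degree
2, which accounts for the factor `T (-2)`. Lengths play no role here: the choice between this lemma
and the next one only serves to match `wordCoeff_cons`. -/
theorem HasDetecting.theta_up {M : GrBimod.{max u v, max u v, max u v} (Reg k V) (Reg k V)}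
    (hM : ∀ i j : ℤ, ∀ a ∈ regDeg k V i, ∀ m ∈ M.deg j, a • m ∈ M.deg (i + j))
    (h2 : (2 : k) ≠ 0) (h : IsRoot ρ g φ) {p p' : ℤ[T;T⁻¹]} (hx : HasDetecting ρ M x p)
    (hx' : HasDetecting ρ M (g * x) p') :
    HasDetecting ρ ((theta ρ g).tensor M) x (p + T (-2) * p') := by
  obtain ⟨ι, _, c, D, hc, rfl, hdet⟩ := hx
  obtain ⟨ι', _, c', D', hc', rfl, hdet'⟩ := hx'
  refine ⟨ι ⊕ ι', inferInstance, Sum.elim (fun j => thetaOne ρ g M (c j))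
    (fun j => thetaMinus ρ g φ M (c' j)), Sum.elim D (fun j => D' j + 1), ?_, ?_, ?_⟩
  · rintro (j | j)
    · exact thetaOne_mem_deg (hc j)
    · simp only [Sum.elim_inr, mul_add, mul_one]
      exact sub_mem (thetaMk_one_root_smul_mem_deg hM (hc' j)) (thetaMk_root_mem_deg (hc' j))
  · rw [Fintype.sum_sum_type, Finset.mul_sum]
    simp only [Sum.elim_inl, Sum.elim_inr]
    congr 1
    refine Finset.sum_congr rfl fun j _ => ?_
    rw [← LaurentPolynomial.T_add]
    congr 1
    ring
  · intro A _ _ _ t f hf h0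
    have h1 : f.comp (thetaMinus ρ g φ M) = 0 := by
      have h3 := hdet' A t _ (hf.comp_thetaMinus t h2 h) fun j => by
        have := h0 (Sum.inr j)
        simp only [Sum.elim_inr] at this
        simp [this]
      ext b
      exact t.act_injective (mul_self_of_root_act t h) (DFunLike.congr_fun h3 b)
    exact hf.eq_zero_of_thetaOne (hdet A t _ (hf.comp_thetaOne_of_minus h2 h h1)
      fun j => h0 (Sum.inl j))

/-- The mirror argument: first the `x`-twisted map from `thetaPlus`, which carries the degree shift,
then the `g * x`-twisted map on `1 ⊗ M`. -/
theorem HasDetecting.theta_down {M : GrBimod.{max u v, max u v, max u v} (Reg k V) (Reg k V)}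
    (hM : ∀ i j : ℤ, ∀ a ∈ regDeg k V i, ∀ m ∈ M.deg j, a • m ∈ M.deg (i + j))
    (h2 : (2 : k) ≠ 0) (h : IsRoot ρ g φ) {p p' : ℤ[T;T⁻¹]} (hx : HasDetecting ρ M x p)
    (hx' : HasDetecting ρ M (g * x) p') :
    HasDetecting ρ ((theta ρ g).tensor M) x (T (-2) * p + p') := by
  obtain ⟨ι, _, c, D, hc, rfl, hdet⟩ := hx
  obtain ⟨ι', _, c', D', hc', rfl, hdet'⟩ := hx'
  refine ⟨ι ⊕ ι', inferInstance, Sum.elim (fun j => thetaPlus ρ g φ M (c j))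
    (fun j => thetaOne ρ g M (c' j)), Sum.elim (fun j => D j + 1) D', ?_, ?_, ?_⟩
  · rintro (j | j)
    · simp only [Sum.elim_inl, mul_add, mul_one]
      exact add_mem (thetaMk_one_root_smul_mem_deg hM (hc j)) (thetaMk_root_mem_deg (hc j))
    · exact thetaOne_mem_deg (hc' j)
  · rw [Fintype.sum_sum_type, Finset.mul_sum]
    simp only [Sum.elim_inl, Sum.elim_inr]
    congr 1
    refine Finset.sum_congr rfl fun j _ => ?_
    rw [← LaurentPolynomial.T_add]
    congr 1
    ring
  · intro A _ _ _ t f hf h0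
    have h1 : f.comp (thetaPlus ρ g φ M) = 0 :=
      hdet A t _ (hf.comp_thetaPlus h2 h) fun j => h0 (Sum.inl j)
    have h3 := hdet' A t _ (hf.comp_thetaOne_of_plus t h2 h h1) fun j => by
      have := h0 (Sum.inr j)
      simp only [Sum.elim_inr] at this
      simp [this]
    refine hf.eq_zero_of_thetaOne ?_
    ext b
    exact t.act_injective (mul_self_of_root_act t h) (DFunLike.congr_fun h3 b)

variable {I : Type*} {m : CoxeterMatrix I} (cs : CoxeterSystem m W)

theorem theta_tensor_smul_mem_deg {i j : ℤ} {a : Reg k V} (ha : a ∈ regDeg k V i)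
    {y : ((theta ρ g).tensor M).carrier} (hy : y ∈ ((theta ρ g).tensor M).deg j) :
    a • y ∈ ((theta ρ g).tensor M).deg (i + j) := by
  refine smul_mem_tensor_deg (fun j t ht => ?_) hy
  refine smul_mem_tensor_deg (M := GrBimod.ofRingHom (RingHom.id _)
    (regInvariants ρ g).val.toRingHom (regDeg k V)) (fun j r hr => ?_) ht
  exact mul_mem_regDeg ha hr

theorem thetaWord_smul_mem_deg (l : List I) (i j : ℤ) (a : Reg k V) (ha : a ∈ regDeg k V i)
    (y : (thetaWord ρ cs l).carrier) (hy : y ∈ (thetaWord ρ cs l).deg j) :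
    a • y ∈ (thetaWord ρ cs l).deg (i + j) := by
  cases l with
  | nil => exact mul_mem_regDeg ha hy
  | cons s l => exact theta_tensor_smul_mem_deg ha hy

/-- Twisted homomorphisms on a word are determined by their values on finitely many homogeneous
elements, with degrees given by the expansion of `(1 + T_{s₁}) ⋯ (1 + T_{sₙ})`. -/
theorem hasDetecting_thetaWord (h2 : (2 : k) ≠ 0) (φ : I → Module.Dual k V)
    (hφ : ∀ i, IsRoot ρ (cs.simple i) (φ i)) (l : List I) (x : W) :
    HasDetecting ρ (thetaWord ρ cs l) x (wordCoeff cs l x) := by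
  induction l generalizing x with
  | nil =>
    by_cases hx : x = 1
    · subst hx
      rw [wordCoeff_nil_one]
      exact hasDetecting_unitBimod_one
    · rw [wordCoeff_nil_ne cs hx]
      exact hasDetecting_unitBimod_ne hx
  | cons i l ih =>
    rw [wordCoeff_cons]
    split_ifs
    · exact (ih x).theta_up (thetaWord_smul_mem_deg cs l) h2 (hφ i) (ih _)
    · exact (ih x).theta_down (thetaWord_smul_mem_deg cs l) h2 (hφ i) (ih _)

end Twisted

end Soergel

namespace Soergel

open GrBimod

/-! ### The rings of regular functions on V and V' as faithful quotients -/

section Faithful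

variable {k : Type*} [Field k] {V : Type*} [AddCommGroup V] [Module k V]
  {W : Type*} [Group W] (ρ : Representation k W V)

theorem eq_one_of_regAct (hρ : Function.Injective ρ) {g : W} (h : ∀ r, regAct ρ g r = r) :
    g = 1 := by
  have h1 : ρ g⁻¹ = 1 := by
    ext v
    rw [← sub_eq_zero, ← Module.forall_dual_apply_eq_zero_iff k]
    intro ψ
    have h2 := h (linForm ψ)
    rw [regAct_linForm, ← sub_eq_zero, ← map_sub] at h2
    have h3 : ρ.dual g ψ - ψ = 0 := by
      by_contra h4
      exact linForm_ne_zero h4 h2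
    have h5 := LinearMap.congr_fun h3 v
    rw [LinearMap.sub_apply, Representation.dual_apply, Module.Dual.transpose_apply] at h5
    rw [map_sub]
    exact h5
  rw [← map_one ρ] at h1
  exact inv_eq_one.1 (hρ h1)

/-- The ring of regular functions on a faithful representation. -/
noncomputable def faithfulQuotientSelf (hρ : Function.Injective ρ) :
    FaithfulQuotient ρ (Reg k V) where
  act g := regAct ρ g
  act_mul := regAct_mul_apply ρ
  act_algebraMap _ _ := rfl
  surjective r := ⟨r, rfl⟩
  faithful _ h := eq_one_of_regAct ρ hρ h

/-- The ring of regular functions on a faithful subrepresentation. -/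
noncomputable def faithfulQuotientRestrict (V' : Subrepresentation ρ)
    (hρ : Function.Injective V'.toRepresentation) :
    FaithfulQuotient ρ (Reg k V'.toSubmodule) where
  act g := regAct V'.toRepresentation g
  act_mul := regAct_mul_apply _
  act_algebraMap g r := (restrictReg_regAct ρ V' g r).symm
  surjective := restrictReg_surjective _
  faithful _ h := eq_one_of_regAct _ hρ h

theorem injective_of_subrepresentation (V' : Subrepresentation ρ)
    (hρ : Function.Injective V'.toRepresentation) : Function.Injective ρ := by
  intro g h hgh
  refine hρ (LinearMap.ext fun v => Subtype.ext ?_)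
  exact LinearMap.congr_fun hgh v

end Faithful

/-! ### Functionals on Laurent polynomials -/

section Laurent

open scoped LaurentPolynomial
open LaurentPolynomial (T)

/-- The additive functional with value `δ i` at `T i`. -/
noncomputable def laurentEval (δ : ℤ → ℤ) : ℤ[T;T⁻¹] →+ ℤ where
  toFun p := Finsupp.linearCombination ℤ δ p.coeff
  map_zero' := by simp
  map_add' p q := by simp

theorem laurentEval_T (δ : ℤ → ℤ) (i : ℤ) : laurentEval δ (T i) = δ i := by
  change Finsupp.linearCombination ℤ δ (Finsupp.single i 1) = δ i
  simp

end Laurent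

/-! ### Dual families from the Hom formula -/

section DualFamily

universe u v w

variable {k : Type u} [Field k] {V : Type v} [AddCommGroup V] [Module k V]
  {W : Type w} [Group W] {ρ : Representation k W V}

/-- Homogeneous coordinates: if an injective linear map between finite free modules is
homogeneous and its source and target have the same generating function, it is bijective on each
component. -/
theorem exists_preimage_of_regDeg [FiniteDimensional k V] {P ι : Type*} [Fintype P] [Fintype ι]
    (E : (P →₀ Reg k V) →ₗ[Reg k V] (ι → Reg k V)) (hE : Function.Injective E) (a : P → ℤ)
    (b : ι → ℤ)
    (hdeg : ∀ r : P →₀ Reg k V, (∀ p, r p ∈ regDeg k V (a p)) → ∀ j, E r j ∈ regDeg k V (b j))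
    (hrank : ∑ p, (Module.finrank k (regDegSubmodule k V (a p)) : ℤ) =
      ∑ j, (Module.finrank k (regDegSubmodule k V (b j)) : ℤ))
    (t : ι → Reg k V) (ht : ∀ j, t j ∈ regDeg k V (b j)) : ∃ r, E r = t := by
  let S : (∀ p, regDegSubmodule k V (a p)) →ₗ[k] (P →₀ Reg k V) :=
    (Finsupp.linearEquivFunOnFinite k (Reg k V) P).symm.toLinearMap ∘ₗ
      LinearMap.pi fun p => (regDegSubmodule k V (a p)).subtype ∘ₗ LinearMap.proj p
  have hS : ∀ r p, S r p = (r p : Reg k V) := fun r p => rfl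
  let G : (∀ p, regDegSubmodule k V (a p)) →ₗ[k] (∀ j, regDegSubmodule k V (b j)) :=
    LinearMap.pi fun j => LinearMap.codRestrict _
      (LinearMap.proj j ∘ₗ E.restrictScalars k ∘ₗ S)
      fun r => hdeg (S r) (fun p => (r p).2) j
  have hG : ∀ r j, ((G r) j : Reg k V) = E (S r) j := fun r j => rfl
  have hinj : Function.Injective G := by
    intro r r' h
    have h1 : E (S r) = E (S r') := by
      funext j
      rw [← hG, ← hG, h]
    have h2 := hE h1
    funext p
    exact Subtype.ext (by rw [← hS, ← hS, h2])
  have hfr : Module.finrank k (∀ p, regDegSubmodule k V (a p)) =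
      Module.finrank k (∀ j, regDegSubmodule k V (b j)) := by
    rw [Module.finrank_pi_fintype, Module.finrank_pi_fintype]
    exact_mod_cast hrank
  obtain ⟨r, hr⟩ := (LinearMap.injective_iff_surjective_of_finrank_eq_finrank hfr).1 hinj
    fun j => ⟨t j, ht j⟩
  refine ⟨S r, funext fun j => ?_⟩
  rw [← hG, hr]

variable {I : Type*} {m : CoxeterMatrix I} (cs : CoxeterSystem m W)

/-- The evaluation `f ↦ (f (c j))_j`. -/
def evalHom {M : GrBimod (Reg k V) (Reg k V)} {ι : Type*} (c : ι → M.carrier) :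
    Hom M (unitBimod k V) →ₗ[Reg k V] (ι → Reg k V) where
  toFun f j := f.1 (c j)
  map_add' _ _ := rfl
  map_smul' _ _ := rfl

/-- A homomorphism to the unit bimodule, as an additive map. -/
def Hom.toReg {M : GrBimod (Reg k V) (Reg k V)} (f : Hom M (unitBimod k V)) :
    M.carrier →+ Reg k V :=
  f.1.toAddMonoidHom

theorem Hom.toReg_smul {M : GrBimod (Reg k V) (Reg k V)} (f : Hom M (unitBimod k V))
    (r : Reg k V) (m : M.carrier) : Hom.toReg f (r • m) = r * Hom.toReg f m :=
  f.1.map_smul r m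

theorem Hom.toReg_right {M : GrBimod (Reg k V) (Reg k V)} (f : Hom M (unitBimod k V))
    (r : Reg k V) (m : M.carrier) : Hom.toReg f (M.right r m) = r * Hom.toReg f m :=
  (f.2 r m).trans (mul_comm (G := Reg k V) _ _)

/-- Evaluation at the detecting elements is injective on Hom to R. The Hom formula gives its source
the same graded rank as its target, so the coordinate vectors are attained. The detecting elements
do not depend on `A`, so the resulting expansion holds for every faithful quotient. -/
theorem exists_dual_family [FiniteDimensional k V] (h2 : (2 : k) ≠ 0) (φ : I → Module.Dual k V)
    (hφ : ∀ i, IsRoot ρ (cs.simple i) (φ i)) (hρ : Function.Injective ρ) (hf : HomFormula cs ρ)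
    (l : List I) :
    ∃ (ι : Type) (_ : Fintype ι) (c : ι → (thetaWord ρ cs l).carrier)
      (F : ι → Hom (thetaWord ρ cs l) (unitBimod k V)),
      ∀ (A : Type (max u v)) [CommRing A] [IsDomain A] [Algebra (Reg k V) A]
        (_ : FaithfulQuotient ρ A) (f : (thetaWord ρ cs l).carrier →+ A),
        IsTwisted (ρ := ρ) 1 f → ∀ x, f x = ∑ j, Hom.toReg (F j) x • f (c j) := by
  classical
  obtain ⟨ι, _, c, D, hc, hD, hdet⟩ := hasDetecting_thetaWord cs h2 φ hφ l 1
  obtain ⟨n, hn, e, he⟩ := hf l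
  have hP : Finite (Σ i : ℤ, Fin (n i)) := by
    refine Finite.of_injective (β := Σ i : n.support, Fin (n i))
      (fun p => ⟨⟨p.1, Finsupp.mem_support_iff.2 (Fin.pos p.2).ne'⟩, p.2⟩) ?_
    rintro ⟨i, p⟩ ⟨j, q⟩ h
    simp only [Sigma.mk.injEq, Subtype.mk.injEq] at h
    obtain ⟨rfl, h⟩ := h
    rw [eq_of_heq h]
  have := Fintype.ofFinite (Σ i : ℤ, Fin (n i))
  have hself (f : Hom (thetaWord ρ cs l) (unitBimod k V)) :
      IsTwisted (ρ := ρ) 1 (Hom.toReg f) :=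
    ⟨Hom.toReg_smul f, fun r x => by
      rw [Hom.toReg_right, regAct_one_apply, smul_eq_mul]⟩
  let E := evalHom c ∘ₗ e.symm.toLinearMap
  have hE : Function.Injective E := by
    refine (injective_iff_map_eq_zero E).2 fun r hr => ?_
    have h1 : Hom.toReg (e.symm r) = 0 :=
      hdet (Reg k V) (faithfulQuotientSelf ρ hρ) _ (hself _) (congrFun hr)
    have h3 : e.symm r = 0 := Subtype.ext (LinearMap.ext fun x => DFunLike.congr_fun h1 x)
    exact e.symm.map_eq_zero_iff.1 h3
  -- Both multisets of exponents have generating function the coefficient at 1, so any functional of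
  -- exponents has the same sum over them. It is used below with dimensions of components.
  have hgen : ∀ δ : ℤ → ℤ, ∑ p : Σ i : ℤ, Fin (n i), δ (-2 * p.1) = ∑ j, δ (-2 * D j) := by
    intro δ
    have h1 := congrArg (laurentEval δ) (hn.eq.trans (Eq.trans rfl hD.symm))
    rw [Finsupp.sum, map_sum, map_sum] at h1
    simp only [laurentEval_T] at h1
    rw [← h1]
    have h3 : ∀ i, laurentEval δ ((n i : LaurentPolynomial ℤ) * LaurentPolynomial.T (-2 * i)) =
        n i * δ (-2 * i) := by
      intro i
      rw [← nsmul_eq_mul, map_nsmul, laurentEval_T, nsmul_eq_mul]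
    simp only [h3]
    rw [← Finset.sum_subset (s₁ := n.support.sigma fun i => (Finset.univ : Finset (Fin (n i))))
      (Finset.subset_univ _)]
    · rw [Finset.sum_sigma]
      simp
    · rintro ⟨i, p⟩ _ h
      simp only [Finset.mem_sigma, Finset.mem_univ, and_true, Finsupp.mem_support_iff,
        not_not] at h
      exact absurd (Fin.pos p) (by omega)
  have hdual : ∀ i, ∃ f : Hom (thetaWord ρ cs l) (unitBimod k V),
      ∀ j, Hom.toReg f (c j) = if j = i then 1 else 0 := by
    intro i
    have hex : ∃ r, E r = fun j => if j = i then 1 else 0 := by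
      -- The functional dual to `c i` has degree `-2 * D i`, so that its value `1` at `c i` has
      -- degree 0.
      refine exists_preimage_of_regDeg E hE (fun p => -2 * D i + 2 * p.1)
        (fun j => -2 * D i + 2 * D j) (fun r hr j => ?_) ?_ _ ?_
      · have h1 := (he (-2 * D i) (e.symm r)).2 (by simpa using hr) (2 * D j) (c j) (hc j)
        rw [add_comm] at h1
        exact h1
      · have h3 : ∀ δ : ℤ → ℤ, ∑ p : Σ i : ℤ, Fin (n i), δ (-2 * D i + 2 * p.1) =
            ∑ j, δ (-2 * D i + 2 * D j) := by
          intro δ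
          -- The reflection of the argument turns the exponents `-2 * p.1` and `-2 * D j` into
          -- degrees with a plus sign.
          have := hgen fun a => δ (-2 * D i - a)
          simpa only [sub_eq_add_neg, neg_mul, neg_neg] using this
        exact h3 fun a => Module.finrank k (regDegSubmodule k V a)
      · intro j
        split_ifs with h
        · subst h
          rw [show -2 * D j + 2 * D j = 0 by ring]
          exact one_mem_regDeg
        · exact zero_mem _
    obtain ⟨r, hr⟩ := hex
    exact ⟨e.symm r, fun j => congrFun hr j⟩
  choose F hF using hdual
  refine ⟨ι, inferInstance, c, F, fun A _ _ _ t f hf x => ?_⟩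
  let f' : (thetaWord ρ cs l).carrier →+ A :=
    ∑ j, ((LinearMap.toSpanSingleton (Reg k V) A (f (c j))).toAddMonoidHom).comp
      (Hom.toReg (F j))
  have hf' : ∀ x, f' x = ∑ j, Hom.toReg (F j) x • f (c j) := by
    intro x
    simp [f']
  have h0 : f - f' = 0 := by
    refine hdet A t _ ⟨fun r x => ?_, fun r x => ?_⟩ fun j => ?_
    · rw [AddMonoidHom.sub_apply, AddMonoidHom.sub_apply, hf.smul, hf', hf', smul_sub,
        Finset.smul_sum]
      simp only [Hom.toReg_smul, mul_smul]
    · rw [AddMonoidHom.sub_apply, AddMonoidHom.sub_apply, hf.right, hf', hf', smul_sub,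
        Finset.smul_sum]
      simp only [Hom.toReg_right, mul_smul, regAct_one_apply]
    · rw [AddMonoidHom.sub_apply, hf']
      simp [hF]
  rw [← hf', ← sub_eq_zero]
  exact DFunLike.congr_fun h0 x

end DualFamily

end Soergel

namespace Soergel

open GrBimod

/-! ### Homomorphisms modulo an ideal -/

section SpanSMul

variable {R M P : Type*} [CommRing R] [AddCommGroup M] [Module R M] [AddCommGroup P] [Module R P]

/-- An additive map that commutes with generators of an ideal `J` maps `J M` into `J P`. -/
theorem map_mem_smul_top {Y : Set R} (f : M →+ P)
    (hf : ∀ y ∈ Y, ∀ m, f (y • m) = y • f m) {m : M}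
    (hm : m ∈ Ideal.span Y • (⊤ : Submodule R M)) :
    f m ∈ Ideal.span Y • (⊤ : Submodule R P) := by
  induction hm using Submodule.smul_induction_on' with
  | smul r hr m _ =>
    induction hr using Submodule.span_induction generalizing m with
    | mem y hy =>
      rw [hf y hy]
      exact Submodule.smul_mem_smul (Ideal.subset_span hy) trivial
    | zero => rw [zero_smul, map_zero]; exact zero_mem _
    | add a b _ _ ha hb =>
      rw [add_smul, map_add]
      exact add_mem (ha m trivial) (hb m trivial)
    | smul a b _ hb =>
      rw [smul_eq_mul, mul_comm, mul_smul]
      exact hb _ trivial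
  | add a _ b _ ha hb =>
    rw [map_add]
    exact add_mem ha hb

end SpanSMul

namespace GrBimod

section Quot

variable {A B : Type*} [CommRing A] [CommRing B]

/-- The quotient `N / J N` by an ideal of the ring acting on the left. -/
def quot (J : Ideal A) (N : GrBimod A B) : GrBimod A B where
  carrier := N.carrier ⧸ (J • ⊤ : Submodule A N.carrier)
  right :=
    { toFun := fun b => Submodule.mapQ _ _ (N.right b) (Submodule.smul_top_le_comap_smul_top J _)
      map_one' := by
        ext n
        simp
      map_mul' := by
        intro b b'
        ext n
        simp
      map_zero' := by
        ext n
        simp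
      map_add' := by
        intro b b'
        ext n
        simp }
  deg d := (N.deg d).map (Submodule.mkQ (J • ⊤ : Submodule A N.carrier)).toAddMonoidHom

variable {J : Ideal A} {N : GrBimod A B}

/-- The projection `N → N / J N`. -/
def quotMk (J : Ideal A) (N : GrBimod A B) : Hom N (N.quot J) :=
  ⟨Submodule.mkQ _, fun _ _ => rfl⟩

theorem quotMk_surjective : Function.Surjective (quotMk J N).1 :=
  Submodule.mkQ_surjective _

theorem quotMk_eq_zero {n : N.carrier} :
    (quotMk J N).1 n = 0 ↔ n ∈ (J • ⊤ : Submodule A N.carrier) :=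
  Submodule.Quotient.mk_eq_zero _

theorem quotMk_eq {n n' : N.carrier} :
    (quotMk J N).1 n = (quotMk J N).1 n' ↔ n - n' ∈ (J • ⊤ : Submodule A N.carrier) :=
  Submodule.Quotient.eq _

/-- The map induced on quotients by an additive map that respects the subgroups `J N`. -/
def quotMap {N' : GrBimod A B} (f : N.carrier →+ N'.carrier)
    (hf : ∀ n ∈ (J • ⊤ : Submodule A N.carrier), f n ∈ (J • ⊤ : Submodule A N'.carrier)) :
    (N.quot J).carrier →+ (N'.quot J).carrier :=
  QuotientAddGroup.map (Submodule.toAddSubgroup _) (Submodule.toAddSubgroup _) f hf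

/-- The composition of bimodule homomorphisms. -/
def homComp {M : GrBimod A B} {N : GrBimod A B} {P : GrBimod A B} (g : Hom N P) (f : Hom M N) :
    Hom M P :=
  ⟨g.1 ∘ₗ f.1, fun b m => (congrArg g.1 (f.2 b m)).trans (g.2 b (f.1 m))⟩

theorem homComp_apply {M : GrBimod A B} {N : GrBimod A B} {P : GrBimod A B} (g : Hom N P)
    (f : Hom M N) (m : M.carrier) : (homComp g f).1 m = g.1 (f.1 m) := rfl

/-- Homomorphisms modulo `J` lift, uniquely up to multiples of `J`. -/
structure LiftsMod (J : Ideal A) (M : GrBimod A B) (N : GrBimod A B) : Prop where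
  lift : ∀ h : Hom M (N.quot J), ∃ f : Hom M N, ∀ m, (quotMk J N).1 (f.1 m) = h.1 m
  mem : ∀ f : Hom M N, (∀ m, f.1 m ∈ (J • ⊤ : Submodule A N.carrier)) →
    f ∈ (J • ⊤ : Submodule A (Hom M N))

end Quot

end GrBimod

/-! ### Self-adjointness of θ_g modulo an ideal generated by invariants -/

section Adjunction

variable {k : Type*} [Field k] {V : Type*} [AddCommGroup V] [Module k V]
  {W : Type*} [Group W] {ρ : Representation k W V} {g : W} {φ : Module.Dual k V}
  {M N : GrBimod (Reg k V) (Reg k V)} {Y : Set (Reg k V)}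

/-- The homomorphism `m ↦ 1 ⊗ h (φ m) + φ ⊗ h m`. -/
noncomputable def thetaCohom (h2 : (2 : k) ≠ 0) (hr : IsRoot ρ g φ)
    (F : Hom ((theta ρ g).tensor M) N) : Hom M ((theta ρ g).tensor N) :=
  ⟨{ toFun := fun m => thetaMk ρ g 1 (F.1 (thetaMk ρ g 1 (linForm φ • m))) +
        thetaMk ρ g (linForm φ) (F.1 (thetaMk ρ g 1 m))
     map_add' := fun a b => by
      rw [smul_add, thetaMk_add_right, thetaMk_add_right, map_add, map_add, thetaMk_add_right,
        thetaMk_add_right]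
      abel
     map_smul' := map_smul_of_root h2 hr
      (AddMonoidHom.mk' (fun m => thetaMk ρ g 1 (F.1 (thetaMk ρ g 1 (linForm φ • m))) +
        thetaMk ρ g (linForm φ) (F.1 (thetaMk ρ g 1 m))) fun a b => by
          rw [smul_add, thetaMk_add_right, thetaMk_add_right, map_add, map_add, thetaMk_add_right,
            thetaMk_add_right]
          abel)
      (fun a m ha => by
        simp only [AddMonoidHom.mk'_apply]
        rw [smul_comm, thetaMk_inv_smul _ ha, thetaMk_inv_smul _ ha, map_smul, map_smul,
          thetaMk_inv_smul _ ha, thetaMk_inv_smul _ ha, smul_add])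
      (fun m => by
        simp only [AddMonoidHom.mk'_apply]
        rw [smul_smul, thetaMk_inv_smul _ (regAct_root_sq hr), map_smul,
          thetaMk_inv_smul _ (regAct_root_sq hr), smul_add, smul_thetaMk, smul_thetaMk,
          smul_thetaMk, mul_one, mul_one, add_comm]) },
   fun b m => by
    change thetaMk ρ g 1 (F.1 (thetaMk ρ g 1 (linForm φ • M.right b m))) +
        thetaMk ρ g (linForm φ) (F.1 (thetaMk ρ g 1 (M.right b m))) =
      ((theta ρ g).tensor N).right b (thetaMk ρ g 1 (F.1 (thetaMk ρ g 1 (linForm φ • m))) +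
        thetaMk ρ g (linForm φ) (F.1 (thetaMk ρ g 1 m)))
    rw [map_add, right_thetaMk, right_thetaMk, ← F.2, ← F.2, right_thetaMk, right_thetaMk,
      map_smul]⟩

theorem thetaCohom_apply (h2 : (2 : k) ≠ 0) (hr : IsRoot ρ g φ)
    (F : Hom ((theta ρ g).tensor M) N) (m : M.carrier) : (thetaCohom h2 hr F).1 m =
      thetaMk ρ g 1 (F.1 (thetaMk ρ g 1 (linForm φ • m))) +
        thetaMk ρ g (linForm φ) (F.1 (thetaMk ρ g 1 m)) := rfl

theorem thetaCohom_add (h2 : (2 : k) ≠ 0) (hr : IsRoot ρ g φ)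
    (F F' : Hom ((theta ρ g).tensor M) N) :
    thetaCohom h2 hr (F + F') = thetaCohom h2 hr F + thetaCohom h2 hr F' := by
  refine Subtype.ext (LinearMap.ext fun m => ?_)
  change thetaMk ρ g 1 (F.1 _ + F'.1 _) + thetaMk ρ g (linForm φ) (F.1 _ + F'.1 _) =
    (thetaCohom h2 hr F).1 m + (thetaCohom h2 hr F').1 m
  rw [thetaCohom_apply, thetaCohom_apply, thetaMk_add_right, thetaMk_add_right]
  abel

theorem thetaCohom_smul (h2 : (2 : k) ≠ 0) (hr : IsRoot ρ g φ) {a : Reg k V}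
    (ha : regAct ρ g a = a) (F : Hom ((theta ρ g).tensor M) N) :
    thetaCohom h2 hr (a • F) = a • thetaCohom h2 hr F := by
  refine Subtype.ext (LinearMap.ext fun m => ?_)
  change thetaMk ρ g 1 (a • F.1 _) + thetaMk ρ g (linForm φ) (a • F.1 _) =
    a • (thetaCohom h2 hr F).1 m
  rw [thetaCohom_apply, thetaMk_inv_smul _ ha, thetaMk_inv_smul _ ha, smul_add]

theorem thetaMk_mem_smul_top (hY : ∀ y ∈ Y, regAct ρ g y = y) (r : Reg k V) {n : N.carrier}
    (hn : n ∈ (Ideal.span Y • ⊤ : Submodule (Reg k V) N.carrier)) :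
    thetaMk ρ g r n ∈
      (Ideal.span Y • ⊤ : Submodule (Reg k V) ((theta ρ g).tensor N).carrier) :=
  map_mem_smul_top (AddMonoidHom.mk' (fun n => thetaMk ρ g r n) (thetaMk_add_right r))
    (fun y hy m => thetaMk_inv_smul r (hY y hy) m) hn

theorem thetaTrace_mem_smul_top (h2 : (2 : k) ≠ 0) (hr : IsRoot ρ g φ)
    (hY : ∀ y ∈ Y, regAct ρ g y = y) (x : ((theta ρ g).tensor N).carrier)
    (hx : x ∈ (Ideal.span Y • ⊤ : Submodule (Reg k V) ((theta ρ g).tensor N).carrier)) :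
    thetaTrace h2 hr N x ∈ (Ideal.span Y • ⊤ : Submodule (Reg k V) N.carrier) :=
  map_mem_smul_top (thetaTrace h2 hr N) (fun y hy => thetaTrace_smul h2 hr (hY y hy)) hx

/-- `θ_g` is adjoint to itself, also modulo an ideal generated by invariants. -/
theorem LiftsMod.theta (h2 : (2 : k) ≠ 0) (hr : IsRoot ρ g φ)
    (hY : ∀ y ∈ Y, regAct ρ g y = y)
    (h : LiftsMod (Ideal.span Y) ((theta ρ g).tensor M) N) :
    LiftsMod (Ideal.span Y) M ((theta ρ g).tensor N) where
  lift η := by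
    -- The trace is linear over the invariants only, which suffices to descend modulo `J` since the
    -- generators of `J` are invariant. The adjoint of `η` is then `r ⊗ m ↦ r T(η m)`.
    let T := quotMap (J := Ideal.span Y) (thetaTrace h2 hr N) (thetaTrace_mem_smul_top h2 hr hY)
    have hT (x) : T ((quotMk _ _).1 x) = (quotMk _ _).1 (thetaTrace h2 hr N x) := rfl
    obtain ⟨F, hF⟩ := h.lift (thetaHom (T.comp η.1.toAddMonoidHom) (fun a m ha => by
        change T (η.1 (a • m)) = a • T (η.1 m)
        obtain ⟨x, hx⟩ := quotMk_surjective (η.1 m)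
        rw [map_smul, ← hx, ← map_smul, hT, hT, thetaTrace_smul h2 hr ha, map_smul])
      (fun b m => by
        change T (η.1 (M.right b m)) = (N.quot _).right b (T (η.1 m))
        obtain ⟨x, hx⟩ := quotMk_surjective (η.1 m)
        rw [η.2, ← hx, ← (quotMk _ _).2, hT, hT, thetaTrace_right, (quotMk _ _).2]))
    have hF1 : ∀ m x, (quotMk _ _).1 x = η.1 m →
        F.1 (thetaMk ρ g 1 m) - thetaTrace h2 hr N x ∈
          (Ideal.span Y • ⊤ : Submodule (Reg k V) N.carrier) := by
      intro m x hx
      rw [← quotMk_eq, hF, thetaHom_mk, one_smul, ← hT, hx]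
      rfl
    refine ⟨thetaCohom h2 hr F, fun m => ?_⟩
    obtain ⟨x, hx⟩ := quotMk_surjective (η.1 m)
    rw [← hx, thetaCohom_apply, quotMk_eq]
    -- Compared with the coordinates of `x`, those of `thetaCohom` at `m` differ by elements of `J
    -- N`, by `hF1` at `φ m` and at `m`.
    nth_rw 1 [eq_thetaMk_add h2 hr x]
    have e1 := thetaMk_mem_smul_top hY 1 (hF1 (linForm φ • m) (linForm φ • x) (by
      rw [map_smul, hx, map_smul]))
    have e2 := thetaMk_mem_smul_top hY (linForm φ) (hF1 m x hx)
    have hsub : ∀ (r : Reg k V) (a b : N.carrier),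
        thetaMk ρ g r (a - b) = thetaMk ρ g r a - thetaMk ρ g r b := fun r =>
      map_sub (AddMonoidHom.mk' (fun n => thetaMk ρ g r n) (thetaMk_add_right (M := N) r))
    rw [hsub] at e1 e2
    rw [add_sub_add_comm]
    exact add_mem e1 e2
  mem f hf := by
    let F : Hom ((Soergel.theta ρ g).tensor M) N :=
      thetaHom ((thetaTrace h2 hr N).comp f.1.toAddMonoidHom) (fun a m ha => by
        change thetaTrace h2 hr N (f.1 (a • m)) = a • thetaTrace h2 hr N (f.1 m)
        rw [map_smul, thetaTrace_smul h2 hr ha])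
      (fun b m => by
        change thetaTrace h2 hr N (f.1 (M.right b m)) = N.right b (thetaTrace h2 hr N (f.1 m))
        rw [f.2, thetaTrace_right])
    have hF1 : ∀ m, F.1 (thetaMk ρ g 1 m) = thetaTrace h2 hr N (f.1 m) := fun m => by
      rw [thetaHom_mk, one_smul]
      rfl
    have hfF : thetaCohom h2 hr F = f := by
      refine Subtype.ext (LinearMap.ext fun m => ?_)
      rw [thetaCohom_apply, hF1, hF1, map_smul]
      exact (eq_thetaMk_add h2 hr (f.1 m)).symm
    have hFJ : F ∈ (Ideal.span Y • ⊤ : Submodule (Reg k V) _) := by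
      refine h.mem F fun x => ?_
      induction x using thetaMk_induction with
      | mk r m =>
        rw [thetaHom_mk]
        exact Submodule.smul_mem _ _ (thetaTrace_mem_smul_top h2 hr hY _ (hf m))
      | add x y hx hy =>
        rw [map_add]
        exact add_mem hx hy
    rw [← hfF]
    -- Passing back from the adjoint is not R-linear, but it commutes with the invariant generators
    -- of `J`.
    exact map_mem_smul_top (AddMonoidHom.mk' (thetaCohom h2 hr) (thetaCohom_add h2 hr))
      (fun y hy => thetaCohom_smul h2 hr (hY y hy)) hFJ

end Adjunction

/-! ### Lifting homomorphisms between products of the θ_s -/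

section Words

universe u v w

variable {k : Type u} [Field k] {V : Type v} [AddCommGroup V] [Module k V]
  {W : Type w} [Group W] {ρ : Representation k W V}
  {I : Type*} {m : CoxeterMatrix I} (cs : CoxeterSystem m W)

theorem mem_unitBimod_smul_top {J : Ideal (Reg k V)} {r : Reg k V} :
    r ∈ (J • ⊤ : Submodule (Reg k V) (unitBimod k V).carrier) ↔ r ∈ J := by
  have : (J • ⊤ : Submodule (Reg k V) (unitBimod k V).carrier) = J := by
    change (J • ⊤ : Ideal (Reg k V)) = J
    rw [smul_eq_mul, Ideal.mul_top]
  exact SetLike.ext_iff.1 this r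

/-- The dual family is used twice. Over `A` it expresses a homomorphism to R/J by its values at the
`c j`, and lifting these values to R lifts the homomorphism. Over R itself it gives `f = ∑ f(c j) F
j`, with coefficients in J when `f` has values in J. -/
theorem liftsMod_unitBimod [FiniteDimensional k V] (h2 : (2 : k) ≠ 0) (φ : I → Module.Dual k V)
    (hφ : ∀ i, IsRoot ρ (cs.simple i) (φ i)) (hρ : Function.Injective ρ) (hf : HomFormula cs ρ)
    (A : Type (max u v)) [CommRing A] [IsDomain A] [Algebra (Reg k V) A]
    (t : FaithfulQuotient ρ A) (l : List I) :
    LiftsMod (RingHom.ker (algebraMap (Reg k V) A)) (thetaWord ρ cs l) (unitBimod k V) := by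
  obtain ⟨ι, _, c, F, hF⟩ := exists_dual_family cs h2 φ hφ hρ hf l
  have hsum : ∀ (r : ι → Reg k V) x,
      Hom.toReg (∑ j, r j • F j) x = ∑ j, r j * Hom.toReg (F j) x := by
    intro r x
    have h1 : ∀ s : Finset ι, Hom.toReg (∑ j ∈ s, r j • F j) x =
        ∑ j ∈ s, r j * Hom.toReg (F j) x := by
      classical
      intro s
      induction s using Finset.induction_on with
      | empty => rfl
      | insert j s hj ih =>
        rw [Finset.sum_insert hj, Finset.sum_insert hj, ← ih]
        rfl
    exact h1 _
  constructor
  · intro h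
    let q : (unitBimod k V).carrier →+ A := (algebraMap (Reg k V) A : Reg k V →+ A)
    let Q : ((unitBimod k V).quot (RingHom.ker (algebraMap (Reg k V) A))).carrier →+ A :=
      QuotientAddGroup.lift (Submodule.toAddSubgroup _) q
        fun r hr => (RingHom.mem_ker (f := algebraMap (Reg k V) A)).1
          (mem_unitBimod_smul_top.1 hr)
    have hQ : ∀ r : Reg k V, Q ((quotMk _ _).1 r) = algebraMap _ A r := fun _ => rfl
    have hQinj : ∀ z, Q z = 0 → z = 0 := by
      intro z hz
      obtain ⟨r, rfl⟩ := quotMk_surjective z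
      exact quotMk_eq_zero.2 (mem_unitBimod_smul_top.2 ((RingHom.mem_ker).2 hz))
    have ht : IsTwisted (ρ := ρ) 1 (Q.comp h.1.toAddMonoidHom) := by
      refine ⟨fun r x => ?_, fun r x => ?_⟩
      · change Q (h.1 (r • x)) = r • Q (h.1 x)
        obtain ⟨z, hz⟩ := quotMk_surjective (h.1 x)
        rw [map_smul, ← hz, ← map_smul, Algebra.smul_def]
        exact map_mul (algebraMap (Reg k V) A) r z
      · change Q (h.1 (_)) = _ • Q (h.1 x)
        obtain ⟨z, hz⟩ := quotMk_surjective (h.1 x)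
        rw [h.2, ← hz, ← (quotMk _ _).2, Algebra.smul_def, regAct_one_apply, mul_comm]
        exact map_mul (algebraMap (Reg k V) A) (show Reg k V from z) r
    choose r hr using fun j => t.surjective (Q (h.1 (c j)))
    refine ⟨∑ j, r j • F j, fun x => ?_⟩
    rw [← sub_eq_zero]
    apply hQinj
    rw [map_sub, sub_eq_zero]
    refine (congrArg (algebraMap _ A) (hsum r x)).trans (Eq.trans ?_ (hF A t _ ht x).symm)
    rw [map_sum]
    refine Finset.sum_congr rfl fun j _ => ?_
    rw [map_mul, mul_comm, Algebra.smul_def, hr]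
    rfl
  · intro f hf
    have ht : IsTwisted (ρ := ρ) 1 (Hom.toReg f) := ⟨Hom.toReg_smul f, fun r x => by
      rw [Hom.toReg_right, regAct_one_apply, smul_eq_mul]⟩
    have h1 : f = ∑ j, Hom.toReg f (c j) • F j := by
      refine Subtype.ext (LinearMap.ext fun x => ?_)
      refine (hF _ (faithfulQuotientSelf ρ hρ) _ ht x).trans (Eq.trans ?_ (hsum _ x).symm)
      exact Finset.sum_congr rfl fun j _ => mul_comm _ _
    rw [h1]
    exact sum_mem fun j _ =>
      Submodule.smul_mem_smul (mem_unitBimod_smul_top.1 (hf (c j))) trivial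

/-- Adjunction moves the letters of `l'` one at a time to the front of `l`, hence the generalization
over `l`. -/
theorem liftsMod_thetaWord [FiniteDimensional k V] (h2 : (2 : k) ≠ 0) (φ : I → Module.Dual k V)
    (hφ : ∀ i, IsRoot ρ (cs.simple i) (φ i)) (hρ : Function.Injective ρ) (hf : HomFormula cs ρ)
    (A : Type (max u v)) [CommRing A] [IsDomain A] [Algebra (Reg k V) A]
    (t : FaithfulQuotient ρ A) {Y : Set (Reg k V)}
    (hA : RingHom.ker (algebraMap (Reg k V) A) = Ideal.span Y)
    (hY : ∀ i, ∀ y ∈ Y, regAct ρ (cs.simple i) y = y) (l l' : List I) :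
    LiftsMod (Ideal.span Y) (thetaWord ρ cs l) (thetaWord ρ cs l') := by
  induction l' generalizing l with
  | nil =>
    rw [← hA]
    exact liftsMod_unitBimod cs h2 φ hφ hρ hf A t l
  | cons i l' ih => exact LiftsMod.theta h2 (hφ i) (hY i) (ih (i :: l))

end Words

end Soergel

namespace Soergel

open GrBimod

namespace GrBimod

/-! ### Finite sums and direct factors -/

section DirectSum

variable {A B : Type*} [CommRing A] [CommRing B] {n : ℕ} (F : Fin n → GrBimod A B)

/-- The projection to a summand. -/
def directSumProj (a : Fin n) : Hom (directSum F) (F a) :=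
  ⟨LinearMap.proj (R := A) (φ := fun i => (F i).carrier) a, fun _ _ => rfl⟩

/-- The inclusion of a summand. -/
def directSumSingle (a : Fin n) : Hom (F a) (directSum F) :=
  ⟨LinearMap.single A (fun i => (F i).carrier) a, fun b x => by
    change (Pi.single a ((F a).right b x) : ∀ i, (F i).carrier) =
      fun i => (F i).right b ((Pi.single a x : ∀ i, (F i).carrier) i)
    funext i
    by_cases h : i = a
    · subst h
      rw [Pi.single_eq_same, Pi.single_eq_same]
    · rw [Pi.single_eq_of_ne h, Pi.single_eq_of_ne h, map_zero]⟩

theorem sum_directSumSingle (x : (directSum F).carrier) :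
    ∑ a, (directSumSingle F a).1 ((directSumProj F a).1 x) = x :=
  Finset.univ_sum_single (M := fun i => (F i).carrier) x

end DirectSum

end GrBimod

section Retract

variable {A B : Type*} [CommRing A] [CommRing B]

/-- `M` is a direct factor of the sum of a finite family of bimodules, ignoring the gradings. -/
def IsRetract (M : GrBimod A B) {n : ℕ} (F : Fin n → GrBimod A B) : Prop :=
  ∃ (i : ∀ a, Hom M (F a)) (p : ∀ a, Hom (F a) M), ∀ x, ∑ a, (p a).1 ((i a).1 x) = x

variable {M N : GrBimod A B} {n n' : ℕ} {F : Fin n → GrBimod A B} {F' : Fin n' → GrBimod A B}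

theorem isRetract_of_directSum (f : Hom M (directSum F)) (g : Hom (directSum F) M)
    (h : g.1 ∘ₗ f.1 = LinearMap.id) : IsRetract M F := by
  refine ⟨fun a => homComp (directSumProj F a) f, fun a => homComp g (directSumSingle F a),
    fun x => ?_⟩
  have h1 := LinearMap.congr_fun h x
  refine Eq.trans ?_ h1
  refine (map_sum g.1 (fun a => (directSumSingle F a).1 ((directSumProj F a).1 (f.1 x)))
    Finset.univ).symm.trans ?_
  rw [sum_directSumSingle]
  rfl

theorem finite_of_isRetract (h : IsRetract M F) (hF : ∀ a, Module.Finite A (F a).carrier) :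
    Module.Finite A M.carrier := by
  obtain ⟨i, p, hip⟩ := h
  refine Module.Finite.of_surjective
    (LinearMap.lsum A (fun a => (F a).carrier) A fun a => (p a).1) fun x => ?_
  refine ⟨fun a => (i a).1 x, ?_⟩
  rw [LinearMap.lsum_apply, LinearMap.sum_apply]
  exact hip x

theorem right_eq_smul_of_isRetract {M : GrBimod A A} {F : Fin n → GrBimod A A}
    (h : IsRetract M F) {y : A} (hF : ∀ a x, (F a).right y x = y • x) (x : M.carrier) :
    M.right y x = y • x := by
  obtain ⟨i, p, hip⟩ := h
  rw [← hip x, map_sum, Finset.smul_sum]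
  refine Finset.sum_congr rfl fun a _ => ?_
  rw [← (p a).2, hF, map_smul]

/-- Composition on both sides. -/
def homConj {P Q : GrBimod A B} (g : Hom Q N) (f : Hom M P) : Hom P Q →ₗ[A] Hom M N where
  toFun h := homComp g (homComp h f)
  map_add' _ _ := Subtype.ext (LinearMap.ext fun _ => map_add g.1 _ _)
  map_smul' _ _ := Subtype.ext (LinearMap.ext fun _ => map_smul g.1 _ _)

theorem homConj_apply {P Q : GrBimod A B} (g : Hom Q N) (f : Hom M P) (h : Hom P Q)
    (m : M.carrier) : (homConj g f h).1 m = g.1 (h.1 (f.1 m)) := rfl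

theorem sum_hom_apply {α : Type*} (s : Finset α) (f : α → Hom M N) (m : M.carrier) :
    (∑ a ∈ s, f a).1 m = ∑ a ∈ s, (f a).1 m := by
  rw [Submodule.coe_sum, LinearMap.sum_apply]

/-- The homomorphism induced on quotients. -/
def quotHom (J : Ideal A) (f : Hom M N) : Hom (M.quot J) (N.quot J) :=
  ⟨Submodule.mapQ _ _ f.1 (Submodule.smul_top_le_comap_smul_top J _), fun b x => by
    obtain ⟨x, rfl⟩ := quotMk_surjective x
    exact congrArg (quotMk J N).1 (f.2 b x)⟩

theorem quotHom_mk (J : Ideal A) (f : Hom M N) (x : M.carrier) :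
    (quotHom J f).1 ((quotMk J M).1 x) = (quotMk J N).1 (f.1 x) := rfl

/-- A homomorphism is the sum of its matrix entries between the summands, compressed back to `M` and
`N`. Each entry is treated separately. -/
theorem LiftsMod.of_isRetract {J : Ideal A} (hM : IsRetract M F) (hN : IsRetract N F')
    (h : ∀ a b, LiftsMod J (F a) (F' b)) : LiftsMod J M N := by
  obtain ⟨i, p, hip⟩ := hM
  obtain ⟨i', p', hip'⟩ := hN
  constructor
  · intro η
    choose f hf using fun a b => (h a b).lift (homComp (quotHom J (i' b)) (homComp η (p a)))
    refine ⟨∑ a, ∑ b, homConj (p' b) (i a) (f a b), fun x => ?_⟩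
    rw [sum_hom_apply, map_sum]
    have h1 : ∀ a, (quotMk J N).1 ((∑ b, homConj (p' b) (i a) (f a b)).1 x) =
        η.1 ((p a).1 ((i a).1 x)) := by
      intro a
      rw [sum_hom_apply, map_sum]
      obtain ⟨z, hz⟩ := quotMk_surjective (η.1 ((p a).1 ((i a).1 x)))
      rw [← hz]
      conv_rhs => rw [← hip' z, map_sum]
      refine Finset.sum_congr rfl fun b _ => ?_
      rw [homConj_apply, ← quotHom_mk, hf, homComp_apply, homComp_apply, ← hz, quotHom_mk,
        quotHom_mk]
    rw [Finset.sum_congr rfl fun a _ => h1 a, ← map_sum, hip]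
  · intro f hf
    have h1 : f = ∑ a, ∑ b, homConj (p' b) (i a) (homConj (i' b) (p a) f) := by
      refine Subtype.ext (LinearMap.ext fun x => ?_)
      rw [sum_hom_apply]
      conv_lhs => rw [← hip x, map_sum]
      refine Finset.sum_congr rfl fun a _ => ?_
      rw [sum_hom_apply]
      conv_lhs => rw [← hip' (f.1 _)]
      rfl
    rw [h1]
    refine sum_mem fun a _ => sum_mem fun b _ => ?_
    refine Submodule.smul_top_le_comap_smul_top J (homConj (p' b) (i a)) ?_
    refine (h a b).mem _ fun x => ?_
    exact Submodule.smul_top_le_comap_smul_top J (i' b).1 (hf _)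

end Retract

/-! ### Soergel bimodules as ungraded direct factors, and finite generation -/

section SoergelRetract

universe u v w

variable {k : Type u} [Field k] {V : Type v} [AddCommGroup V] [Module k V]
  {W : Type w} [Group W] {ρ : Representation k W V} {g : W} {φ : Module.Dual k V}
  {I : Type*} {m : CoxeterMatrix I} {cs : CoxeterSystem m W}

/-- A shift only relabels degrees, so it disappears once gradings are ignored. -/
theorem IsSoergel.isRetract {M : GrBimod (Reg k V) (Reg k V)} (h : IsSoergel ρ cs M) :
    ∃ (n : ℕ) (l : Fin n → List I), IsRetract M fun a => thetaWord ρ cs (l a) := by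
  obtain ⟨-, n, l, d, f, -, g, -, hfg⟩ := h
  exact ⟨n, l, isRetract_of_directSum f g hfg⟩

theorem finite_theta_tensor (h2 : (2 : k) ≠ 0) (hr : IsRoot ρ g φ)
    {M : GrBimod (Reg k V) (Reg k V)} (hM : Module.Finite (Reg k V) M.carrier) :
    Module.Finite (Reg k V) ((theta ρ g).tensor M).carrier := by
  classical
  obtain ⟨s, hs⟩ := hM.fg_top
  refine ⟨s.image (fun x => thetaMk ρ g 1 x) ∪ s.image (fun x => thetaMk ρ g 1 (linForm φ • x)),
    eq_top_iff.2 ?_⟩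
  set S := Submodule.span (Reg k V) (↑(s.image (fun x => thetaMk ρ g 1 x) ∪
    s.image (fun x => thetaMk ρ g 1 (linForm φ • x))) :
      Set ((theta ρ g).tensor M).carrier) with hS
  have h1 : ∀ x ∈ s, thetaMk ρ g 1 x ∈ S := fun x hx => Submodule.subset_span
    (by rw [Finset.coe_union]; exact Or.inl (Finset.mem_coe.2 (Finset.mem_image_of_mem _ hx)))
  have h3 : ∀ x ∈ s, thetaMk ρ g 1 (linForm φ • x) ∈ S := fun x hx => Submodule.subset_span
    (by rw [Finset.coe_union]; exact Or.inr (Finset.mem_coe.2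
          (Finset.mem_image_of_mem (fun x => thetaMk ρ g 1 (linForm φ • x)) hx)))
  have h4 : ∀ x, thetaMk ρ g 1 x ∈ S := by
    intro x
    have hx : x ∈ Submodule.span (Reg k V) (s : Set M.carrier) := hs ▸ trivial
    induction hx using Submodule.span_induction with
    | mem x hx => exact h1 x hx
    | zero =>
      rw [show thetaMk ρ g 1 (0 : M.carrier) = 0 from tmk_zero_right _]
      exact zero_mem _
    | add x y _ _ hx hy => rw [thetaMk_add_right]; exact add_mem hx hy
    | smul r x hx' hx =>
      -- The element `1 ⊗ r x` is not `r (1 ⊗ x)`, so the claim at `x` alone is of no use. A second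
      -- induction proves it for all multiples of `x` at once, splitting `r` over the invariants.
      clear hx
      induction hx' using Submodule.span_induction generalizing r with
      | mem x hx =>
        rw [eq_demazure_add h2 hr r, add_smul, thetaMk_add_right, mul_smul, smul_comm (linForm φ),
          thetaMk_inv_smul _ (regAct_demazure h2 hr _),
          thetaMk_inv_smul _ (regAct_demazure h2 hr _)]
        exact add_mem (Submodule.smul_mem _ _ (h1 x hx)) (Submodule.smul_mem _ _ (h3 x hx))
      | zero =>
        rw [smul_zero, show thetaMk ρ g 1 (0 : M.carrier) = 0 from tmk_zero_right _]
        exact zero_mem _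
      | add x y _ _ hx hy => rw [smul_add, thetaMk_add_right]; exact add_mem (hx r) (hy r)
      | smul t x _ hx => rw [smul_smul]; exact hx _
  rintro x -
  induction x using thetaMk_induction with
  | mk r x =>
    rw [show thetaMk ρ g r x = r • thetaMk ρ g 1 x by rw [smul_thetaMk, mul_one]]
    exact Submodule.smul_mem _ _ (h4 x)
  | add x y hx hy => exact add_mem hx hy

theorem finite_thetaWord (h2 : (2 : k) ≠ 0) {φ : I → Module.Dual k V}
    (hφ : ∀ i, IsRoot ρ (cs.simple i) (φ i)) (l : List I) :
    Module.Finite (Reg k V) (thetaWord ρ cs l).carrier := by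
  induction l with
  | nil => exact (inferInstance : Module.Finite (Reg k V) (Reg k V))
  | cons i l ih => exact finite_theta_tensor h2 (hφ i) ih

/-- An element invariant under all simple reflections crosses each tensor sign of the word. -/
theorem right_thetaWord_eq_smul {y : Reg k V} (hy : ∀ i, regAct ρ (cs.simple i) y = y)
    (l : List I) (x : (thetaWord ρ cs l).carrier) : (thetaWord ρ cs l).right y x = y • x := by
  induction l with
  | nil => exact mul_comm (G := Reg k V) x y
  | cons i l ih =>
    change ((theta ρ (cs.simple i)).tensor (thetaWord ρ cs l)).carrier at x
    change ((theta ρ (cs.simple i)).tensor (thetaWord ρ cs l)).right y x = y • x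
    induction x using thetaMk_induction with
    | mk r x => rw [right_thetaMk, ih, thetaMk_inv_smul _ (hy i)]
    | add x z hx hz => rw [map_add, smul_add, hx, hz]

end SoergelRetract

end Soergel

namespace Soergel

open GrBimod

/-! ### Internal gradings and homogeneous components -/

section Internal

variable {M : Type*} [AddCommGroup M] {A : ℤ → AddSubgroup M}

theorem coe_sum_of (s : Finset ℤ) (f : ∀ i, A i) :
    DirectSum.coeAddMonoidHom A (∑ i ∈ s, DirectSum.of (fun i => A i) i (f i)) =
      ∑ i ∈ s, (f i : M) := by
  rw [map_sum]
  exact Finset.sum_congr rfl fun i _ => DirectSum.coeAddMonoidHom_of _ _ _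

/-- A family of subgroups is an internal direct sum if every element is a sum of homogeneous
elements and the homogeneous elements are independent. -/
theorem isInternal_of_sum (hs : ∀ x, ∃ (s : Finset ℤ) (f : ℤ → M), (∀ i, f i ∈ A i) ∧
      ∑ i ∈ s, f i = x)
    (hi : ∀ (s : Finset ℤ) (f : ℤ → M), (∀ i, f i ∈ A i) → ∑ i ∈ s, f i = 0 →
      ∀ i ∈ s, f i = 0) : DirectSum.IsInternal A := by
  classical
  constructor
  · refine (injective_iff_map_eq_zero _).2 fun x hx => ?_
    rw [← DirectSum.sum_support_of x, coe_sum_of] at hx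
    have h1 := hi _ (fun i => (x i : M)) (fun i => (x i).2) hx
    ext i
    by_cases h : i ∈ DFinsupp.support x
    · exact h1 i h
    · rw [DFinsupp.notMem_support_iff.1 h]
      rfl
  · intro x
    obtain ⟨s, f, hf, rfl⟩ := hs x
    exact ⟨_, coe_sum_of s fun i => ⟨f i, hf i⟩⟩

theorem eq_zero_of_isInternal (h : DirectSum.IsInternal A) (s : Finset ℤ) (f : ℤ → M)
    (hf : ∀ i, f i ∈ A i) (h0 : ∑ i ∈ s, f i = 0) : ∀ i ∈ s, f i = 0 := by
  classical
  intro i hi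
  have h1 : ∑ i ∈ s, DirectSum.of (fun i => A i) i ⟨f i, hf i⟩ = 0 :=
    h.1 (by rw [coe_sum_of, h0, map_zero])
  have h3 := congrArg ((A i).subtype.comp (DFinsupp.evalAddMonoidHom (β := fun i => A i) i)) h1
  rw [map_zero, map_sum, Finset.sum_eq_single i] at h3
  · have e : DirectSum.of (fun i => A i) i ⟨f i, hf i⟩ i = ⟨f i, hf i⟩ :=
      DirectSum.of_eq_same (β := fun i => A i) i _
    exact (congrArg Subtype.val e).symm.trans h3
  · intro j _ hj
    have e : DirectSum.of (fun i => A i) j ⟨f j, hf j⟩ i = 0 :=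
      DirectSum.of_eq_of_ne (β := fun i => A i) _ _ _ hj.symm
    exact congrArg Subtype.val e
  · exact fun h => absurd hi h

theorem isInternal_induction (h : DirectSum.IsInternal A) {P : M → Prop}
    (hom : ∀ i, ∀ x ∈ A i, P x) (add : ∀ x y, P x → P y → P (x + y)) (x : M) : P x := by
  obtain ⟨d, rfl⟩ := h.2 x
  induction d using DirectSum.induction_on with
  | zero => exact hom 0 _ (by rw [map_zero]; exact zero_mem _)
  | of i a => exact hom i _ (by rw [DirectSum.coeAddMonoidHom_of]; exact a.2)
  | add a b ha hb => rw [map_add]; exact add _ _ ha hb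

/-- An additive map defined on homogeneous elements. -/
noncomputable def ofHomogeneous {N : Type*} [AddCommGroup N] (h : DirectSum.IsInternal A)
    (f : ℤ → M →+ N) : M →+ N :=
  (DirectSum.toAddMonoid fun i => (f i).comp (A i).subtype).comp
    (AddEquiv.ofBijective _ h).symm.toAddMonoidHom

theorem ofHomogeneous_of_mem {N : Type*} [AddCommGroup N] (h : DirectSum.IsInternal A)
    (f : ℤ → M →+ N) {i : ℤ} {x : M} (hx : x ∈ A i) : ofHomogeneous h f x = f i x := by
  have h1 : (AddEquiv.ofBijective _ h).symm x = DirectSum.of (fun i => A i) i ⟨x, hx⟩ := by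
    rw [AddEquiv.symm_apply_eq]
    exact (DirectSum.coeAddMonoidHom_of A i ⟨x, hx⟩).symm
  change DirectSum.toAddMonoid _ ((AddEquiv.ofBijective _ h).symm x) = f i x
  rw [h1, DirectSum.toAddMonoid_of]
  rfl

open scoped Classical in
/-- The component of degree `i`. -/
noncomputable def homogeneousPart (h : DirectSum.IsInternal A) (i : ℤ) : M →+ M :=
  ofHomogeneous h fun j => if j = i then AddMonoidHom.id M else 0

variable (h : DirectSum.IsInternal A)

theorem homogeneousPart_of_mem {i : ℤ} {x : M} (hx : x ∈ A i) : homogeneousPart h i x = x := by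
  rw [homogeneousPart, ofHomogeneous_of_mem h _ hx, if_pos rfl]
  rfl

theorem homogeneousPart_of_ne {i j : ℤ} (hij : j ≠ i) {x : M} (hx : x ∈ A j) :
    homogeneousPart h i x = 0 := by
  rw [homogeneousPart, ofHomogeneous_of_mem h _ hx, if_neg hij]
  rfl

theorem homogeneousPart_mem (i : ℤ) (x : M) : homogeneousPart h i x ∈ A i := by
  induction x using isInternal_induction h with
  | hom j x hx =>
    by_cases hij : j = i
    · subst hij
      rwa [homogeneousPart_of_mem h hx]
    · rw [homogeneousPart_of_ne h hij hx]
      exact zero_mem _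
  | add x y hx hy => rw [map_add]; exact add_mem hx hy

theorem exists_sum_homogeneousPart (x : M) :
    ∃ s : Finset ℤ, ∀ t, s ⊆ t → ∑ i ∈ t, homogeneousPart h i x = x := by
  classical
  induction x using isInternal_induction h with
  | hom j x hx =>
    refine ⟨{j}, fun t ht => ?_⟩
    rw [Finset.sum_eq_single j, homogeneousPart_of_mem h hx]
    · exact fun i _ hi => homogeneousPart_of_ne h hi.symm hx
    · exact fun hj => absurd (ht (Finset.mem_singleton_self j)) hj
  | add x y hx hy =>
    obtain ⟨s, hs⟩ := hx
    obtain ⟨s', hs'⟩ := hy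
    refine ⟨s ∪ s', fun t ht => ?_⟩
    simp only [map_add]
    rw [Finset.sum_add_distrib, hs t (Finset.union_subset_left ht),
      hs' t (Finset.union_subset_right ht)]

theorem homogeneousPart_map {N : Type*} [AddCommGroup N] {B : ℤ → AddSubgroup N}
    (hB : DirectSum.IsInternal B) {f : M →+ N} {d : ℤ} (hf : ∀ i, ∀ x ∈ A i, f x ∈ B (d + i))
    (i : ℤ) (x : M) : homogeneousPart hB (d + i) (f x) = f (homogeneousPart h i x) := by
  induction x using isInternal_induction h with
  | hom j x hx =>
    by_cases hij : j = i
    · subst hij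
      rw [homogeneousPart_of_mem h hx, homogeneousPart_of_mem hB (hf _ x hx)]
    · rw [homogeneousPart_of_ne h hij hx, homogeneousPart_of_ne hB _ (hf _ x hx), map_zero]
      omega
  | add x y hx hy => rw [map_add, map_add, map_add, map_add, hx, hy]

/-- A preimage of a homogeneous element can be replaced by its component of that degree. -/
theorem map_homogeneousPart_of_mem {N : Type*} [AddCommGroup N] {B : ℤ → AddSubgroup N}
    (hB : DirectSum.IsInternal B) {f : M →+ N} (hf : ∀ i, ∀ x ∈ A i, f x ∈ B i) {i : ℤ} {x : M}
    (hx : f x ∈ B i) : f (homogeneousPart h i x) = f x := by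
  have h1 := homogeneousPart_map h hB (f := f) (d := 0)
    (fun i x hx => by rw [zero_add]; exact hf i x hx) i x
  rw [zero_add, homogeneousPart_of_mem hB hx] at h1
  exact h1.symm

end Internal

/-! ### The grading on homomorphisms -/

section HomGrading

variable {k : Type*} [Field k] {V : Type*} [AddCommGroup V] [Module k V]
  {M N : GrBimod (Reg k V) (Reg k V)}

/-- The component of degree `d` of a homomorphism, as an additive map. -/
noncomputable def homPartAux (hM : DirectSum.IsInternal M.deg) (hN : DirectSum.IsInternal N.deg)
    (f : Hom M N) (d : ℤ) : M.carrier →+ N.carrier :=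
  ofHomogeneous hM fun i => (homogeneousPart hN (i + d)).comp f.1.toAddMonoidHom

theorem homPartAux_of_mem (hM : DirectSum.IsInternal M.deg) (hN : DirectSum.IsInternal N.deg)
    (f : Hom M N) (d : ℤ) {i : ℤ} {x : M.carrier} (hx : x ∈ M.deg i) :
    homPartAux hM hN f d x = homogeneousPart hN (i + d) (f.1 x) :=
  ofHomogeneous_of_mem hM _ hx

/-- The component of degree `d` of a homomorphism between graded bimodules. -/
noncomputable def homPart (hM : M.IsGraded (regDeg k V) (regDeg k V))
    (hN : N.IsGraded (regDeg k V) (regDeg k V)) (f : Hom M N) (d : ℤ) : Hom M N :=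
  ⟨{ toFun := homPartAux hM.1 hN.1 f d
     map_add' := map_add _
     map_smul' := fun r x => by
      rw [RingHom.id_apply]
      induction r using regDeg_induction generalizing x with
      | hom i r hr =>
        induction x using isInternal_induction hM.1 with
        | hom j x hx =>
          rw [homPartAux_of_mem _ _ _ _ hx, homPartAux_of_mem _ _ _ _ (hM.2 i j r hr x hx),
            map_smul, add_assoc]
          exact homogeneousPart_map hN.1 hN.1 (f := DistribSMul.toAddMonoidHom _ r)
            (fun j x hx => hN.2 i j r hr x hx) _ _
        | add x y hx hy => rw [smul_add, map_add, map_add, hx, hy, smul_add]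
      | add a b ha hb => rw [add_smul, map_add, ha, hb, add_smul] },
   fun r x => by
    change homPartAux hM.1 hN.1 f d (M.right r x) = N.right r (homPartAux hM.1 hN.1 f d x)
    induction r using regDeg_induction generalizing x with
    | hom i r hr =>
      induction x using isInternal_induction hM.1 with
      | hom j x hx =>
        rw [homPartAux_of_mem _ _ _ _ hx, homPartAux_of_mem _ _ _ _ (hM.3 i j r hr x hx),
          f.2, add_assoc]
        exact homogeneousPart_map hN.1 hN.1 (f := (N.right r).toAddMonoidHom)
          (fun j x hx => hN.3 i j r hr x hx) _ _
      | add x y hx hy => rw [map_add, map_add, map_add, map_add, hx, hy]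
    | add a b ha hb =>
      rw [map_add, map_add, LinearMap.add_apply, LinearMap.add_apply, map_add, ha, hb]⟩

theorem homPart_apply_of_mem (hM : M.IsGraded (regDeg k V) (regDeg k V))
    (hN : N.IsGraded (regDeg k V) (regDeg k V)) (f : Hom M N) (d : ℤ) {i : ℤ} {x : M.carrier}
    (hx : x ∈ M.deg i) : (homPart hM hN f d).1 x = homogeneousPart hN.1 (i + d) (f.1 x) :=
  homPartAux_of_mem hM.1 hN.1 f d hx

theorem homPart_mem (hM : M.IsGraded (regDeg k V) (regDeg k V))
    (hN : N.IsGraded (regDeg k V) (regDeg k V)) (f : Hom M N) (d : ℤ) :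
    homPart hM hN f d ∈ homDeg M N d := by
  intro i x hx
  rw [homPart_apply_of_mem hM hN f d hx]
  exact homogeneousPart_mem _ _ _

theorem exists_sum_homPart_apply (hM : M.IsGraded (regDeg k V) (regDeg k V))
    (hN : N.IsGraded (regDeg k V) (regDeg k V)) (f : Hom M N) (x : M.carrier) :
    ∃ s : Finset ℤ, ∀ t, s ⊆ t → ∑ d ∈ t, (homPart hM hN f d).1 x = f.1 x := by
  classical
  induction x using isInternal_induction hM.1 with
  | hom i x hx =>
    obtain ⟨s, hs⟩ := exists_sum_homogeneousPart hN.1 (f.1 x)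
    refine ⟨s.map (Equiv.subRight i).toEmbedding, fun t ht => ?_⟩
    rw [← hs (t.map (Equiv.addLeft i).toEmbedding), Finset.sum_map]
    · exact Finset.sum_congr rfl fun d _ => homPart_apply_of_mem hM hN f d hx
    · intro e he
      refine Finset.mem_map.2 ⟨e - i, ht (Finset.mem_map.2 ⟨e, he, rfl⟩), ?_⟩
      simp
  | add x y hx hy =>
    obtain ⟨s, hs⟩ := hx
    obtain ⟨s', hs'⟩ := hy
    refine ⟨s ∪ s', fun t ht => ?_⟩
    simp only [map_add]
    rw [Finset.sum_add_distrib, hs t (Finset.union_subset_left ht),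
      hs' t (Finset.union_subset_right ht)]

/-- The homomorphisms from a finitely generated graded bimodule are graded. -/
theorem isInternal_homDeg (hM : M.IsGraded (regDeg k V) (regDeg k V))
    (hN : N.IsGraded (regDeg k V) (regDeg k V)) (hfin : Module.Finite (Reg k V) M.carrier) :
    DirectSum.IsInternal (homDeg M N) := by
  classical
  refine isInternal_of_sum (fun f => ?_) fun s f hf h0 => ?_
  · obtain ⟨S, hS⟩ := hfin.fg_top
    choose s hs using exists_sum_homPart_apply hM hN f
    -- On one element finitely many components add up to `f`; a finite generating set makes one
    -- finite set of degrees sufficient.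
    refine ⟨S.biUnion s, homPart hM hN f, homPart_mem hM hN f, Subtype.ext ?_⟩
    refine LinearMap.ext_on (s := (S : Set M.carrier)) hS fun x hx => ?_
    rw [sum_hom_apply]
    exact hs x _ (Finset.subset_biUnion_of_mem s (Finset.mem_coe.1 hx))
  · intro d hd
    refine Subtype.ext (LinearMap.ext fun x => ?_)
    induction x using isInternal_induction hM.1 with
    | hom i x hx =>
      -- At `x` of degree `i` the values lie in the distinct degrees `i + d`; the sum is reindexed
      -- by `e = i + d`.
      have h1 := eq_zero_of_isInternal hN.1 (s.map (Equiv.addLeft i).toEmbedding)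
        (fun e => (f (e - i)).1 x) (fun e => by
          have := hf (e - i) i x hx
          rwa [add_sub_cancel] at this) (by
          rw [Finset.sum_map]
          simp only [Equiv.coe_toEmbedding, Equiv.coe_addLeft, add_sub_cancel_left]
          rw [← sum_hom_apply, h0]
          rfl) (i + d) (Finset.mem_map.2 ⟨d, hd, rfl⟩)
      simp only [add_sub_cancel_left] at h1
      exact h1
    | add x y hx hy => rw [map_add, hx, hy, map_add]

end HomGrading

end Soergel

namespace Soergel

open GrBimod

/-! ### The reduction of N as the quotient N / J N -/

section Reduction

universe u v w w'

variable {k : Type u} [Field k] {V : Type v} [AddCommGroup V] [Module k V] {V' : Submodule k V}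
  {M : GrBimod.{max u v, max u v, w} (Reg k V) (Reg k V)}
  {N : GrBimod.{max u v, max u v, w'} (Reg k V) (Reg k V)}

/-- `R'` as an `(R', R)`-bimodule. -/
noncomputable abbrev leftBase (V' : Submodule k V) :
    GrBimod.{max u v, max u v, max u v} (Reg k V') (Reg k V) :=
  ofRingHom (RingHom.id (Reg k V')) (algebraMap (Reg k V) (Reg k V')) (regDeg k V')

/-- `R'` as an `(R, R')`-bimodule. -/
noncomputable abbrev rightBase (V' : Submodule k V) :
    GrBimod.{max u v, max u v, max u v} (Reg k V) (Reg k V') :=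
  ofRingHom (algebraMap (Reg k V) (Reg k V')) (RingHom.id (Reg k V')) (regDeg k V')

/-- The element `a ⊗ m` of `R' ⊗ M`. -/
noncomputable def leftMk (a : Reg k V') (m : M.carrier) : ((leftBase V').tensor M).carrier :=
  tmk (M := leftBase V') a m

/-- The element `t ⊗ b` of `R' ⊗ M ⊗ R'`. -/
noncomputable def rightMk (t : ((leftBase V').tensor M).carrier) (b : Reg k V') :
    (frakX V' M).carrier :=
  tmk (N := rightBase V') t b

theorem leftMk_mul (a : Reg k V') (r : Reg k V) (m : M.carrier) :
    leftMk (a * restrictReg k V V' r) m = leftMk a (r • m) :=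
  tmk_right (M := leftBase V') a r m

theorem right_leftMk (a : Reg k V') (r : Reg k V) (m : M.carrier) :
    ((leftBase V').tensor M).right r (leftMk a m) = leftMk a (M.right r m) := rfl

theorem rightMk_right (t : ((leftBase V').tensor M).carrier) (r : Reg k V) (b : Reg k V') :
    rightMk (((leftBase V').tensor M).right r t) b = rightMk t (restrictReg k V V' r * b) :=
  tmk_right (N := rightBase V') t r b

theorem rightMk_add_left (t t' : ((leftBase V').tensor M).carrier) (b : Reg k V') :
    rightMk (t + t') b = rightMk t b + rightMk t' b :=
  tmk_add_left (N := rightBase V') t t' b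

theorem leftMk_induction {P : ((leftBase V').tensor M).carrier → Prop}
    (mk : ∀ a m, P (leftMk a m)) (add : ∀ x y, P x → P y → P (x + y)) (x) : P x :=
  tmk_induction mk add x

theorem rightMk_induction {P : (frakX V' M).carrier → Prop}
    (mk : ∀ t b, P (rightMk t b)) (add : ∀ x y, P x → P y → P (x + y)) (x) : P x :=
  tmk_induction mk add x

/-- The map `M → R' ⊗ M ⊗ R'`, `m ↦ 1 ⊗ m ⊗ 1`. -/
noncomputable def redMk (V' : Submodule k V)
    (M : GrBimod.{max u v, max u v, w} (Reg k V) (Reg k V)) :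
    M.carrier →+ (frakX V' M).carrier :=
  AddMonoidHom.mk' (fun m => rightMk (leftMk 1 m) 1) fun a b =>
    (congrArg (fun t => rightMk t 1) (tmk_add_right (M := leftBase V') (1 : Reg k V') a b)).trans
      (rightMk_add_left _ _ _)

theorem redMk_apply (m : M.carrier) : redMk V' M m = rightMk (leftMk 1 m) 1 := rfl

theorem rightMk_leftMk (r s : Reg k V) (m : M.carrier) :
    rightMk (leftMk (restrictReg k V V' r) m) (restrictReg k V V' s) =
      redMk V' M (r • M.right s m) := by
  rw [redMk_apply, ← leftMk_mul, ← right_leftMk, rightMk_right, one_mul, mul_one]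

theorem redMk_smul (r : Reg k V) (m : M.carrier) :
    redMk V' M (r • m) = restrictReg k V V' r • redMk V' M m := by
  have h1 := rightMk_leftMk (V' := V') r 1 m
  rw [map_one, map_one] at h1
  refine h1.symm.trans ?_
  refine congrArg (fun a : Reg k V' => rightMk (leftMk a m) 1) ?_
  exact (mul_one (restrictReg k V V' r)).symm

theorem redMk_right (r : Reg k V) (m : M.carrier) :
    redMk V' M (M.right r m) = (frakX V' M).right (restrictReg k V V' r) (redMk V' M m) := by
  have h1 := rightMk_leftMk (V' := V') 1 r m
  rw [map_one, one_smul] at h1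
  refine h1.symm.trans ?_
  refine congrArg (tmk _) ?_
  exact (one_mul (restrictReg k V V' r)).symm

/-- Since R → R' is onto, both outer factors can be absorbed into `M`. -/
theorem redMk_surjective : Function.Surjective (redMk V' M) := by
  intro x
  induction x using rightMk_induction with
  | mk t b =>
    obtain ⟨s, rfl⟩ := restrictReg_surjective V' b
    induction t using leftMk_induction with
    | mk a m =>
      obtain ⟨r, rfl⟩ := restrictReg_surjective V' a
      exact ⟨_, (rightMk_leftMk r s m).symm⟩
    | add x y hx hy =>
      obtain ⟨m, hm⟩ := hx
      obtain ⟨m', hm'⟩ := hy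
      exact ⟨m + m', by rw [map_add, hm, hm', rightMk_add_left]⟩
  | add x y hx hy =>
    obtain ⟨m, rfl⟩ := hx
    obtain ⟨m', rfl⟩ := hy
    exact ⟨m + m', map_add _ _ _⟩

theorem reductionHom_redMk (f : Hom M N) (m : M.carrier) :
    (reductionHom (regDeg k V') f).1 (redMk V' M m) = redMk V' N (f.1 m) := rfl

theorem hom_frakX_ext {P : GrBimod (Reg k V') (Reg k V')} {f g : Hom (frakX V' M) P}
    (h : ∀ m, f.1 (redMk V' M m) = g.1 (redMk V' M m)) : f = g := by
  refine Subtype.ext (LinearMap.ext fun x => ?_)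
  obtain ⟨m, rfl⟩ := redMk_surjective x
  exact h m

/-- The linear forms that vanish on `V'` act in the same way on both sides. -/
def IsCentralOn (V' : Submodule k V) (N : GrBimod.{max u v, max u v, w'} (Reg k V) (Reg k V)) :
    Prop :=
  ∀ y ∈ vanishingForms V', ∀ n, N.right y n = y • n

/-- Centrality of the generators makes the right action of `J` land in `J N`, so that R' also acts
on `N / J N` from the right. -/
theorem IsCentralOn.right_mem (hN : IsCentralOn V' N) {r : Reg k V}
    (hr : r ∈ Ideal.span (vanishingForms V')) (n : N.carrier) :
    N.right r n ∈ (Ideal.span (vanishingForms V') • ⊤ : Submodule (Reg k V) N.carrier) := by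
  induction hr using Submodule.span_induction generalizing n with
  | mem y hy =>
    rw [hN y hy]
    exact Submodule.smul_mem_smul (Ideal.subset_span hy) trivial
  | zero => rw [map_zero]; exact zero_mem _
  | add a b _ _ ha hb => rw [map_add]; exact add_mem (ha n) (hb n)
  | smul a b _ hb => rw [smul_eq_mul, mul_comm, map_mul]; exact hb _

theorem sub_mem_span_of_restrictReg_eq {r s : Reg k V}
    (h : restrictReg k V V' r = restrictReg k V V' s) :
    r - s ∈ Ideal.span (vanishingForms V') := by
  rw [← ker_restrictReg, RingHom.mem_ker, map_sub]
  exact sub_eq_zero.2 h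

/-- This makes the set-theoretic section `extendReg` usable: it fails to be a homomorphism only by
elements of `J`, which the quotient ignores. -/
theorem quotMk_smul_eq {r s : Reg k V} (h : restrictReg k V V' r = restrictReg k V V' s)
    (z : (N.quot (Ideal.span (vanishingForms V'))).carrier) : r • z = s • z := by
  obtain ⟨n, rfl⟩ := quotMk_surjective z
  rw [← map_smul, ← map_smul, quotMk_eq, ← sub_smul]
  exact Submodule.smul_mem_smul (sub_mem_span_of_restrictReg_eq h) trivial

theorem IsCentralOn.quot_right_eq (hN : IsCentralOn V' N) {r s : Reg k V}
    (h : restrictReg k V V' r = restrictReg k V V' s)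
    (z : (N.quot (Ideal.span (vanishingForms V'))).carrier) :
    (N.quot _).right r z = (N.quot _).right s z := by
  obtain ⟨n, rfl⟩ := quotMk_surjective z
  rw [← (quotMk _ N).2, ← (quotMk _ N).2, quotMk_eq, ← LinearMap.sub_apply, ← map_sub]
  exact hN.right_mem (sub_mem_span_of_restrictReg_eq h) n

/-- A set-theoretic section of the restriction map. -/
noncomputable def extendReg (V' : Submodule k V) : Reg k V' → Reg k V :=
  Function.surjInv (restrictReg_surjective V')

theorem restrictReg_extendReg (a : Reg k V') : restrictReg k V V' (extendReg V' a) = a :=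
  Function.surjInv_eq _ a

theorem restrictReg_extendReg_add (a b : Reg k V') :
    restrictReg k V V' (extendReg V' (a + b)) =
      restrictReg k V V' (extendReg V' a + extendReg V' b) := by
  rw [map_add, restrictReg_extendReg, restrictReg_extendReg, restrictReg_extendReg]

theorem restrictReg_extendReg_mul (a : Reg k V') (r : Reg k V) :
    restrictReg k V V' (extendReg V' (a * restrictReg k V V' r)) =
      restrictReg k V V' (extendReg V' a * r) := by
  rw [map_mul, restrictReg_extendReg, restrictReg_extendReg]

theorem restrictReg_extendReg_mul' (a : Reg k V') (r : Reg k V) :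
    restrictReg k V V' (extendReg V' (restrictReg k V V' r * a)) =
      restrictReg k V V' (extendReg V' a * r) := by
  rw [mul_comm, restrictReg_extendReg_mul]

/-- The map `a ⊗ n ↦ a n` to the quotient. -/
noncomputable def redLiftLeft (V' : Submodule k V)
    (N : GrBimod.{max u v, max u v, w'} (Reg k V) (Reg k V)) :
    ((leftBase V').tensor N).carrier →+ (N.quot (Ideal.span (vanishingForms V'))).carrier :=
  tensorLift (M := leftBase V')
    (AddMonoidHom.mk' (fun a : Reg k V' =>
        (DistribSMul.toAddMonoidHom (N.quot (Ideal.span (vanishingForms V'))).carrier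
          (extendReg V' a)).comp (quotMk _ N).1.toAddMonoidHom) fun a b =>
      AddMonoidHom.ext fun n =>
        (quotMk_smul_eq (restrictReg_extendReg_add a b) ((quotMk _ N).1 n)).trans
          (add_smul _ _ _))
    fun a r n =>
      (quotMk_smul_eq (restrictReg_extendReg_mul a r) _).trans ((mul_smul _ _ _).trans
        (congrArg (extendReg V' a • ·) ((quotMk _ N).1.map_smul r n).symm))

theorem redLiftLeft_leftMk (a : Reg k V') (n : N.carrier) :
    redLiftLeft V' N (leftMk a n) = extendReg V' a • (quotMk _ N).1 n := rfl

theorem redLiftLeft_right (r : Reg k V) (x : ((leftBase V').tensor N).carrier) :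
    redLiftLeft V' N (((leftBase V').tensor N).right r x) =
      (N.quot _).right r (redLiftLeft V' N x) := by
  induction x using leftMk_induction with
  | mk a n => rw [right_leftMk, redLiftLeft_leftMk, redLiftLeft_leftMk, map_smul, (quotMk _ N).2]
  | add x y hx hy => rw [map_add, map_add, map_add, map_add, hx, hy]

/-- The map `R' ⊗ N ⊗ R' → N / J N`, for `J` the kernel of `R → R'`. -/
noncomputable def redLift (hN : IsCentralOn V' N) :
    (frakX V' N).carrier →+ (N.quot (Ideal.span (vanishingForms V'))).carrier :=
  tensorLift (N := rightBase V')
    (AddMonoidHom.flip (AddMonoidHom.mk' (fun b : Reg k V' =>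
        ((N.quot (Ideal.span (vanishingForms V'))).right
          (extendReg V' b)).toAddMonoidHom.comp (redLiftLeft V' N)) fun a b =>
      AddMonoidHom.ext fun _ =>
        (hN.quot_right_eq (restrictReg_extendReg_add a b) _).trans
          (LinearMap.congr_fun (map_add (N.quot _).right _ _) _)))
    fun x r b =>
      (congrArg ((N.quot _).right (extendReg V' b)) (redLiftLeft_right r x)).trans
        ((LinearMap.congr_fun (map_mul (N.quot _).right (extendReg V' b) r) _).symm.trans
          (hN.quot_right_eq (restrictReg_extendReg_mul' b r) _).symm)

theorem redLift_redMk (hN : IsCentralOn V' N) (n : N.carrier) :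
    redLift hN (redMk V' N n) = (quotMk _ N).1 n := by
  change (N.quot _).right (extendReg V' 1) (extendReg V' 1 • (quotMk _ N).1 n) = _
  have h1 : restrictReg k V V' (extendReg V' 1) = restrictReg k V V' 1 := by
    rw [restrictReg_extendReg, map_one]
  rw [hN.quot_right_eq h1, quotMk_smul_eq h1, map_one, one_smul]
  rfl

/-- The map `redLift` back to `N / J N` detects the kernel. The converse holds without centrality,
as `J` acts by zero on R'. -/
theorem redMk_eq_zero (hN : IsCentralOn V' N) {n : N.carrier} : redMk V' N n = 0 ↔
    n ∈ (Ideal.span (vanishingForms V') • ⊤ : Submodule (Reg k V) N.carrier) := by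
  constructor
  · intro h
    rw [← quotMk_eq_zero, ← redLift_redMk hN, h, map_zero]
  · intro h
    induction h using Submodule.smul_induction_on' with
    | smul r hr n _ =>
      rw [redMk_smul]
      rw [← ker_restrictReg] at hr
      rw [(RingHom.mem_ker).1 hr, zero_smul]
    | add x _ y _ hx hy => rw [map_add, hx, hy, add_zero]

theorem finite_frakX (hM : Module.Finite (Reg k V) M.carrier) :
    Module.Finite (Reg k V') (frakX V' M).carrier := by
  have : RingHomSurjective (restrictReg k V V').toRingHom := ⟨restrictReg_surjective V'⟩
  let q : M.carrier →ₛₗ[(restrictReg k V V').toRingHom] (frakX V' M).carrier :=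
    { toFun := redMk V' M
      map_add' := map_add _
      map_smul' := redMk_smul }
  exact Module.Finite.of_surjective q redMk_surjective

theorem redMk_mem_deg {d : ℤ} {m : M.carrier} (hm : m ∈ M.deg d) :
    redMk V' M m ∈ (frakX V' M).deg d := by
  have h1 := tmk_mem_deg (M := leftBase V') (m := (1 : Reg k V')) one_mem_regDeg hm
  have h3 := tmk_mem_deg (N := rightBase V') (n := (1 : Reg k V')) h1 one_mem_regDeg
  rw [zero_add, add_zero] at h3
  exact h3

theorem exists_redMk_of_mem_deg (hM : M.IsGraded (regDeg k V) (regDeg k V)) {d : ℤ}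
    {x : (frakX V' M).carrier} (hx : x ∈ (frakX V' M).deg d) :
    ∃ m ∈ M.deg d, redMk V' M m = x := by
  refine tensor_deg_le (N := rightBase V') (S := (M.deg d).map (redMk V' M))
    (fun i j hij t ht b hb => ?_) hx
  obtain ⟨s, hs, rfl⟩ := exists_restrictReg_of_mem_regDeg V' hb
  refine tensor_deg_le (M := leftBase V') (S := ((M.deg d).map (redMk V' M)).comap
    (AddMonoidHom.mk' (fun t => rightMk t (restrictReg k V V' s))
      fun a b => rightMk_add_left a b _)) (fun i' j' hij' a ha m hm => ?_) ht
  obtain ⟨r, hr, rfl⟩ := exists_restrictReg_of_mem_regDeg V' ha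
  refine ⟨_, ?_, (rightMk_leftMk r s m).symm⟩
  have h1 := hM.2 _ _ r hr _ (hM.3 _ _ s hs m hm)
  rwa [show i' + (j + j') = d by omega] at h1

/-- The generators of `J` are homogeneous of degree 2, so `J N` contains the components of its
elements. The grading of `N` then descends to the reduction. -/
theorem homogeneousPart_mem_smul_top (hN : N.IsGraded (regDeg k V) (regDeg k V)) (i : ℤ)
    {n : N.carrier}
    (hn : n ∈ (Ideal.span (vanishingForms V') • ⊤ : Submodule (Reg k V) N.carrier)) :
    homogeneousPart hN.1 i n ∈
      (Ideal.span (vanishingForms V') • ⊤ : Submodule (Reg k V) N.carrier) := by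
  induction hn using Submodule.smul_induction_on' with
  | smul r hr n _ =>
    induction hr using Submodule.span_induction generalizing n with
    | mem y hy =>
      have h1 := homogeneousPart_map hN.1 hN.1 (f := DistribSMul.toAddMonoidHom _ y) (d := 2)
        (fun j x hx => by
          obtain ⟨ψ, -, rfl⟩ := hy
          exact hN.2 2 j _ (linForm_mem_regDeg ψ) x hx) (i - 2) n
      rw [add_sub_cancel] at h1
      rw [DistribSMul.toAddMonoidHom_apply] at h1
      rw [h1]
      exact Submodule.smul_mem_smul (Ideal.subset_span hy) trivial
    | zero => rw [zero_smul, map_zero]; exact zero_mem _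
    | add a b _ _ ha hb => rw [add_smul, map_add]; exact add_mem (ha n trivial) (hb n trivial)
    | smul a b _ hb => rw [smul_eq_mul, mul_comm, mul_smul]; exact hb _ trivial
  | add a _ b _ ha hb => rw [map_add]; exact add_mem ha hb

theorem isGraded_frakX (hN : N.IsGraded (regDeg k V) (regDeg k V)) (hc : IsCentralOn V' N) :
    (frakX V' N).IsGraded (regDeg k V') (regDeg k V') where
  isInternal := by
    classical
    refine isInternal_of_sum (fun x => ?_) fun s f hf h0 i hi => ?_
    · obtain ⟨n, rfl⟩ := redMk_surjective x
      obtain ⟨s, hs⟩ := exists_sum_homogeneousPart hN.1 n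
      refine ⟨s, fun i => redMk V' N (homogeneousPart hN.1 i n),
        fun i => redMk_mem_deg (homogeneousPart_mem _ _ _), ?_⟩
      rw [← map_sum, hs s subset_rfl]
    · choose n hn hnf using fun i => exists_redMk_of_mem_deg hN (hf i)
      rw [← hnf]
      simp only [← hnf] at h0
      rw [← map_sum, redMk_eq_zero hc] at h0
      rw [redMk_eq_zero hc]
      have h1 := homogeneousPart_mem_smul_top hN i h0
      rw [map_sum, Finset.sum_eq_single i, homogeneousPart_of_mem _ (hn i)] at h1
      · exact h1
      · exact fun j _ hj => homogeneousPart_of_ne _ hj (hn j)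
      · exact fun h => absurd hi h
  smul_mem i j a ha x hx := by
    obtain ⟨n, hn, rfl⟩ := exists_redMk_of_mem_deg hN hx
    obtain ⟨r, hr, rfl⟩ := exists_restrictReg_of_mem_regDeg V' ha
    rw [← redMk_smul]
    exact redMk_mem_deg (hN.2 i j r hr n hn)
  right_mem i j a ha x hx := by
    obtain ⟨n, hn, rfl⟩ := exists_redMk_of_mem_deg hN hx
    obtain ⟨r, hr, rfl⟩ := exists_restrictReg_of_mem_regDeg V' ha
    rw [← redMk_right]
    exact redMk_mem_deg (hN.3 i j r hr n hn)

end Reduction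

end Soergel

namespace Soergel

open GrBimod

/-! ### The canonical base change map -/

section BaseChange

universe u v w w'

variable {k : Type u} [Field k] {V : Type v} [AddCommGroup V] [Module k V] (V' : Submodule k V)
  (M : GrBimod.{max u v, max u v, w} (Reg k V) (Reg k V))
  (N : GrBimod.{max u v, max u v, w'} (Reg k V) (Reg k V))

/-- The canonical map `r' ⊗ f ↦ r' (id ⊗ f ⊗ id)`. -/
noncomputable def baseChangeMap :
    Reg k V' ⊗[Reg k V] Hom M N →ₗ[Reg k V'] Hom (frakX V' M) (frakX V' N) :=
  letI : Module (Reg k V) (Hom (frakX V' M) (frakX V' N)) :=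
    Module.compHom _ (algebraMap (Reg k V) (Reg k V'))
  haveI : IsScalarTower (Reg k V) (Reg k V') (Hom (frakX V' M) (frakX V' N)) :=
    IsScalarTower.of_algebraMap_smul fun _ _ => rfl
  LinearMap.liftBaseChange (Reg k V')
    { toFun := reductionHom (regDeg k V')
      map_add' := fun f g => hom_frakX_ext fun m => map_add (redMk V' N) (f.1 m) (g.1 m)
      map_smul' := fun r f => hom_frakX_ext fun m => redMk_smul r (f.1 m) }

variable {V' M N}

theorem baseChangeMap_tmul (r : Reg k V') (f : Hom M N) :
    baseChangeMap V' M N (r ⊗ₜ[Reg k V] f) = r • reductionHom (regDeg k V') f := rfl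

theorem exists_eq_one_tmul (x : Reg k V' ⊗[Reg k V] Hom M N) :
    ∃ f : Hom M N, x = (1 : Reg k V') ⊗ₜ[Reg k V] f := by
  induction x using TensorProduct.induction_on with
  | zero => exact ⟨0, (TensorProduct.tmul_zero _ _).symm⟩
  | tmul a f =>
    obtain ⟨r, rfl⟩ := restrictReg_surjective V' a
    refine ⟨r • f, ?_⟩
    rw [← TensorProduct.smul_tmul, Algebra.smul_def, mul_one]
    rfl
  | add x y hx hy =>
    obtain ⟨f, rfl⟩ := hx
    obtain ⟨g, rfl⟩ := hy
    exact ⟨f + g, (TensorProduct.tmul_add _ _ _).symm⟩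

theorem one_tmul_eq_zero {f : Hom M N}
    (hf : f ∈ (Ideal.span (vanishingForms V') • ⊤ : Submodule (Reg k V) (Hom M N))) :
    (1 : Reg k V') ⊗ₜ[Reg k V] f = 0 := by
  induction hf using Submodule.smul_induction_on' with
  | smul r hr f _ =>
    rw [← ker_restrictReg, RingHom.mem_ker] at hr
    rw [← TensorProduct.smul_tmul, Algebra.smul_def, mul_one, algebraMap_eq_restrictReg, hr,
      TensorProduct.zero_tmul]
  | add f _ g _ hf hg => rw [TensorProduct.tmul_add, hf, hg, add_zero]

/-- Every tensor is `1 ⊗ f`, and its image vanishes only if `f` maps `M` into `J N`. Then `f` lies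
in `J Hom(M, N)`, which `1 ⊗` kills. -/
theorem baseChangeMap_injective (hN : IsCentralOn V' N)
    (h : LiftsMod (Ideal.span (vanishingForms V')) M N) :
    Function.Injective (baseChangeMap V' M N) := by
  refine (injective_iff_map_eq_zero _).2 fun x hx => ?_
  obtain ⟨f, rfl⟩ := exists_eq_one_tmul x
  rw [baseChangeMap_tmul, one_smul] at hx
  refine one_tmul_eq_zero (h.mem f fun m => ?_)
  rw [← redMk_eq_zero hN, ← reductionHom_redMk, hx]
  rfl

theorem redLift_smul (hN : IsCentralOn V' N) (r : Reg k V) (x : (frakX V' N).carrier) :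
    redLift hN (restrictReg k V V' r • x) = r • redLift hN x := by
  obtain ⟨n, rfl⟩ := redMk_surjective x
  rw [← redMk_smul, redLift_redMk, redLift_redMk, map_smul]

theorem redLift_right (hN : IsCentralOn V' N) (r : Reg k V) (x : (frakX V' N).carrier) :
    redLift hN ((frakX V' N).right (restrictReg k V V' r) x) =
      (N.quot _).right r (redLift hN x) := by
  obtain ⟨n, rfl⟩ := redMk_surjective x
  rw [← redMk_right, redLift_redMk, redLift_redMk, (quotMk _ N).2]

/-- A homomorphism of reductions, as a homomorphism `M → N / J N`. -/
noncomputable def toQuot (hN : IsCentralOn V' N) (η : Hom (frakX V' M) (frakX V' N)) :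
    Hom M (N.quot (Ideal.span (vanishingForms V'))) :=
  ⟨{ toFun := fun m => redLift hN (η.1 (redMk V' M m))
     map_add' := fun a b =>
      ((congrArg (fun z => redLift hN (η.1 z)) (map_add (redMk V' M) a b)).trans
        (congrArg (redLift hN) (map_add η.1 _ _))).trans (map_add (redLift hN) _ _)
     map_smul' := fun r m =>
      ((congrArg (fun z => redLift hN (η.1 z)) (redMk_smul r m)).trans
        (congrArg (redLift hN) (map_smul η.1 _ _))).trans (redLift_smul hN r _) },
   fun r m =>
    ((congrArg (fun z => redLift hN (η.1 z)) (redMk_right r m)).trans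
      (congrArg (redLift hN) (η.2 _ _))).trans (redLift_right hN r _)⟩

/-- Restricting `η` to the image of `M` gives a homomorphism to `N / J N`. A lift of it reduces to
`η`, since the image of `M` is all of the reduction. -/
theorem baseChangeMap_surjective (hN : IsCentralOn V' N)
    (h : LiftsMod (Ideal.span (vanishingForms V')) M N) :
    Function.Surjective (baseChangeMap V' M N) := by
  intro η
  obtain ⟨f, hf⟩ := h.lift (toQuot hN η)
  refine ⟨(1 : Reg k V') ⊗ₜ[Reg k V] f, hom_frakX_ext fun m => ?_⟩
  rw [baseChangeMap_tmul, one_smul, reductionHom_redMk]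
  obtain ⟨n, hn⟩ := redMk_surjective (η.1 (redMk V' M m))
  have h1 : (quotMk _ N).1 (f.1 m) = redLift hN (η.1 (redMk V' M m)) := hf m
  rw [← hn, redLift_redMk, quotMk_eq, ← redMk_eq_zero hN, map_sub, sub_eq_zero] at h1
  rw [h1, hn]

theorem baseChangeMap_mem_homDeg (hM : M.IsGraded (regDeg k V) (regDeg k V))
    (hN : N.IsGraded (regDeg k V) (regDeg k V)) (hc : IsCentralOn V' N) {d : ℤ}
    {x : Reg k V' ⊗[Reg k V] Hom M N} (hx : x ∈ baseChangeHomDeg (regDeg k V') M N d) :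
    baseChangeMap V' M N x ∈ homDeg (frakX V' M) (frakX V' N) d := by
  refine (AddSubgroup.closure_le ((homDeg (frakX V' M) (frakX V' N) d).comap
    (baseChangeMap V' M N).toAddMonoidHom)).2 ?_ hx
  rintro _ ⟨i, j, rfl, a, ha, f, hf, rfl⟩ e y hy
  obtain ⟨m, hm, rfl⟩ := exists_redMk_of_mem_deg hM hy
  have h1 := (isGraded_frakX hN hc).2 i _ a ha _ (redMk_mem_deg (V' := V') (hf e m hm))
  rw [add_left_comm] at h1
  exact h1

variable (V' M N) in
/-- The additive map `f ↦ id ⊗ f ⊗ id`. -/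
noncomputable def reductionAddHom : Hom M N →+ Hom (frakX V' M) (frakX V' N) :=
  AddMonoidHom.mk' (fun f => reductionHom (regDeg k V') f) fun f g =>
    hom_frakX_ext fun m => map_add (redMk V' N) (f.1 m) (g.1 m)

theorem baseChangeMap_one_tmul (f : Hom M N) :
    baseChangeMap V' M N ((1 : Reg k V') ⊗ₜ[Reg k V] f) = reductionAddHom V' M N f := by
  rw [baseChangeMap_tmul, one_smul]
  rfl

/-- If the image of `1 ⊗ f` is homogeneous of degree `d`, it is also the image of `1 ⊗ f_d`, with
`f_d` the component of `f`. Injectivity then gives `1 ⊗ f = 1 ⊗ f_d`. -/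
theorem mem_baseChangeHomDeg_iff (hM : M.IsGraded (regDeg k V) (regDeg k V))
    (hN : N.IsGraded (regDeg k V) (regDeg k V)) (hc : IsCentralOn V' N)
    (hinj : Function.Injective (baseChangeMap V' M N))
    (hint : DirectSum.IsInternal (homDeg M N))
    (hint' : DirectSum.IsInternal (homDeg (frakX V' M) (frakX V' N))) (d : ℤ)
    (x : Reg k V' ⊗[Reg k V] Hom M N) : x ∈ baseChangeHomDeg (regDeg k V') M N d ↔
      baseChangeMap V' M N x ∈ homDeg (frakX V' M) (frakX V' N) d := by
  refine ⟨baseChangeMap_mem_homDeg hM hN hc, fun hx => ?_⟩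
  have hone : ∀ e, ∀ f ∈ homDeg M N e,
      (1 : Reg k V') ⊗ₜ[Reg k V] f ∈ baseChangeHomDeg (regDeg k V') M N e := fun e f hf =>
    AddSubgroup.subset_closure ⟨0, e, zero_add e, 1, one_mem_regDeg, f, hf, rfl⟩
  obtain ⟨f, rfl⟩ := exists_eq_one_tmul x
  rw [baseChangeMap_one_tmul] at hx
  have hred : ∀ e, ∀ f ∈ homDeg M N e,
      reductionAddHom V' M N f ∈ homDeg (frakX V' M) (frakX V' N) e := fun e f hf => by
    rw [← baseChangeMap_one_tmul]
    exact baseChangeMap_mem_homDeg hM hN hc (hone e f hf)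
  have h1 := map_homogeneousPart_of_mem hint hint' hred hx
  rw [← baseChangeMap_one_tmul, ← baseChangeMap_one_tmul] at h1
  rw [← hinj h1]
  exact hone d _ (homogeneousPart_mem hint d f)

end BaseChange

/-! ### Good pairs and Soergel bimodules -/

section Main

universe u v w

variable {k : Type u} [Field k] {V : Type v} [AddCommGroup V] [Module k V]
  {I : Type*} {W : Type w} [Group W] {m : CoxeterMatrix I} {cs : CoxeterSystem m W}
  {ρ : Representation k W V} {V' : Subrepresentation ρ}

theorem IsGoodPair.exists_isRoot (h : IsGoodPair cs ρ V') (h2 : (2 : k) ≠ 0) (i : I) :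
    ∃ φ, IsRoot ρ (cs.simple i) φ := by
  obtain ⟨x, φ, hx, hφ⟩ := h.reflection i
  exact ⟨φ, isRoot_of_reflection (cs.inv_simple i) hx h2 hφ⟩

/-- The roots lie in `V'`, so the linear forms vanishing on `V'` are invariant. -/
theorem IsGoodPair.regAct_vanishingForms (h : IsGoodPair cs ρ V') (h2 : (2 : k) ≠ 0) (i : I)
    {y : Reg k V} (hy : y ∈ vanishingForms V'.toSubmodule) : regAct ρ (cs.simple i) y = y := by
  obtain ⟨ψ, hψ, rfl⟩ := hy
  obtain ⟨x, φ, hx, hφ⟩ := h.reflection i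
  obtain ⟨x', φ', hx', hφ'⟩ := h.reflection_sub i
  have h1 : ρ (cs.simple i) x' = -(x' : V) := by
    have := congrArg Subtype.val (LinearMap.congr_fun hφ' x')
    rw [Module.preReflection_apply, hx'] at this
    refine Eq.trans this ?_
    rw [two_smul]
    simp
  -- The vector `x'` of `V'` is negated by the reflection of `V`, so `φ(x') x = 2 x'`. As `x'` is
  -- nonzero, `φ(x') ≠ 0`, so `x` is a multiple of `x'`, where `ψ` vanishes.
  have hx0 : ψ x = 0 := by
    rw [hφ, Module.preReflection_apply] at h1
    have h3 : φ x' • x = (2 : k) • (x' : V) := by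
      rw [two_smul, ← sub_eq_zero]
      rw [← sub_eq_zero] at h1
      rw [← neg_eq_zero, ← h1]
      abel
    have hψ' : ψ x' = 0 := LinearMap.congr_fun hψ x'
    have h4 := congrArg ψ h3
    rw [map_smul, map_smul, hψ', smul_zero, smul_eq_mul, mul_eq_zero] at h4
    refine h4.resolve_left fun h0 => ?_
    rw [h0, zero_smul] at h3
    have h5 : x' = 0 := Subtype.ext ((smul_eq_zero.1 h3.symm).resolve_left h2)
    rw [h5, map_zero] at hx'
    exact h2 hx'.symm
  rw [regAct_linForm]
  congr 1
  ext v
  rw [Representation.dual_apply, cs.inv_simple, hφ, Module.Dual.transpose_apply,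
    LinearMap.comp_apply, Module.preReflection_apply, map_sub, map_smul, hx0, smul_zero, sub_zero]

theorem IsSoergel.isCentralOn {M : GrBimod (Reg k V) (Reg k V)} (hM : IsSoergel ρ cs M)
    (h : IsGoodPair cs ρ V') (h2 : (2 : k) ≠ 0) : IsCentralOn V'.toSubmodule M := by
  intro y hy
  obtain ⟨n, l, hl⟩ := hM.isRetract
  exact right_eq_smul_of_isRetract hl fun a x =>
    right_thetaWord_eq_smul (fun i => h.regAct_vanishingForms h2 i hy) _ _

theorem IsSoergel.finite {M : GrBimod (Reg k V) (Reg k V)} (hM : IsSoergel ρ cs M)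
    (h : IsGoodPair cs ρ V') (h2 : (2 : k) ≠ 0) : Module.Finite (Reg k V) M.carrier := by
  choose φ hφ using h.exists_isRoot h2
  obtain ⟨n, l, hl⟩ := hM.isRetract
  exact finite_of_isRetract hl fun a => finite_thetaWord h2 hφ _

theorem IsSoergel.liftsMod [FiniteDimensional k V] {M N : GrBimod (Reg k V) (Reg k V)}
    (hM : IsSoergel ρ cs M) (hN : IsSoergel ρ cs N) (h : IsGoodPair cs ρ V') (h2 : (2 : k) ≠ 0)
    (hfaithful : Function.Injective V'.toRepresentation) :
    LiftsMod (Ideal.span (vanishingForms V'.toSubmodule)) M N := by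
  choose φ hφ using h.exists_isRoot h2
  obtain ⟨n, l, hl⟩ := hM.isRetract
  obtain ⟨n', l', hl'⟩ := hN.isRetract
  refine LiftsMod.of_isRetract hl hl' fun a b => ?_
  exact liftsMod_thetaWord cs h2 φ hφ (injective_of_subrepresentation ρ V' hfaithful)
    h.homFormula (Reg k V'.toSubmodule) (faithfulQuotientRestrict ρ V' hfaithful)
    (ker_restrictReg _) (fun i y hy => h.regAct_vanishingForms h2 i hy) _ _

end Main

end Soergel

theorem mainTheorem1
    {k : Type*} [Field k] (hk : ringChar k ≠ 2)
    {V : Type*} [AddCommGroup V] [Module k V] [FiniteDimensional k V]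
    {I W : Type*} [Group W] {m : CoxeterMatrix I} (cs : CoxeterSystem m W)
    (ρ : Representation k W V) (V' : Subrepresentation ρ)
    (hgood : Soergel.IsGoodPair cs ρ V')
    (hfaithful : Function.Injective V'.toRepresentation)
    (M N : Soergel.GrBimod (Soergel.Reg k V) (Soergel.Reg k V))
    (hM : Soergel.IsSoergel ρ cs M) (hN : Soergel.IsSoergel ρ cs N) :
    DirectSum.IsInternal (Soergel.GrBimod.homDeg M N) ∧
    DirectSum.IsInternal (Soergel.GrBimod.homDeg
      (Soergel.frakX V'.toSubmodule M) (Soergel.frakX V'.toSubmodule N)) ∧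
    ∃ e : TensorProduct (Soergel.Reg k V) (Soergel.Reg k V'.toSubmodule)
          (Soergel.GrBimod.Hom M N) ≃ₗ[Soergel.Reg k V'.toSubmodule]
        Soergel.GrBimod.Hom (Soergel.frakX V'.toSubmodule M) (Soergel.frakX V'.toSubmodule N),
      (∀ (r : Soergel.Reg k V'.toSubmodule) (f : Soergel.GrBimod.Hom M N),
        e (TensorProduct.tmul (Soergel.Reg k V) r f) =
          r • Soergel.GrBimod.reductionHom (Soergel.regDeg k V'.toSubmodule) f) ∧
      ∀ (d : ℤ) (x : TensorProduct (Soergel.Reg k V) (Soergel.Reg k V'.toSubmodule)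
          (Soergel.GrBimod.Hom M N)),
        x ∈ Soergel.GrBimod.baseChangeHomDeg (Soergel.regDeg k V'.toSubmodule) M N d ↔
          e x ∈ Soergel.GrBimod.homDeg
            (Soergel.frakX V'.toSubmodule M) (Soergel.frakX V'.toSubmodule N) d := by
  have h2 : (2 : k) ≠ 0 := Ring.two_ne_zero hk
  have hcM := hM.isCentralOn hgood h2
  have hcN := hN.isCentralOn hgood h2
  have hlift := hM.liftsMod hN hgood h2 hfaithful
  have hfin := hM.finite hgood h2
  have hint := Soergel.isInternal_homDeg hM.1 hN.1 hfin
  have hint' := Soergel.isInternal_homDeg (Soergel.isGraded_frakX hM.1 hcM)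
    (Soergel.isGraded_frakX hN.1 hcN) (Soergel.finite_frakX hfin)
  have hinj := Soergel.baseChangeMap_injective hcN hlift
  refine ⟨hint, hint', LinearEquiv.ofBijective (Soergel.baseChangeMap V'.toSubmodule M N)
    ⟨hinj, Soergel.baseChangeMap_surjective hcN hlift⟩, fun r f => rfl, fun d x => ?_⟩
  exact Soergel.mem_baseChangeHomDeg_iff hM.1 hN.1 hcN hinj hint hint' d x
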